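/- Let $n,k$ be integers with $1\le k<n$ and let $2\le p<n$ be real; put $H=\frac{p-k}{p}$. Consider pairs $(\Omega,K)$ where $\Omega\subset\mathbb R^n$ is a bounded domain and $K\subset\mathbb R^n$ is a closed (for instance compact) embedded $C^2$ submanifold without boundary, of codimension $k$, with $K=\partial\Omega$ if $k=1$ and $K\cap\overline\Omega\neq\emptyset$ if $k>1$. Write $d(x)=\mathrm{dist}(x,K)$ and $K_\delta=\{x\in\Omega: d(x)\le\delta\}$. We say that $(\Omega,K)$ satisfies condition (R) if there are $c_0>0$ and $\delta^*>0$ such that, for $0<\delta\le\delta^*$, the function $d$ is of class $C^2$ near each point of $K_\delta\setminus K$ and $$|d\,\Delta d+1-k|\le c_0\, d\qquad\text{on } K_\delta\setminus K .$$ For a set $V$, $C_0^\infty(V)$ denotes the smooth real functions on $\mathbb R^n$ whose support is a compact subset of $V$. For every $q$ with $p<q\le\frac{np}{n-p}$ there is a constant $C=C(n,k,p,q)>0$, independent of $\Omega$ and $K$, and for every pair $(\Omega,K)$ as above satisfying (R) there is $\delta_0=\delta_0(p,n,\Omega,K)>0$, independent of $q$, such that for all such $q$ and all $0<\delta\le\delta_0$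 the following hold. (a) If $p>k$, then for all $u\in C_0^\infty(\Omega\setminus K)$ $$\int_{K_\delta}|\nabla u|^p\,dx-|H|^p\int_{K_\delta}\frac{|u|^p}{d^p}\,dx\ \ge\ C\left(\int_{K_\delta}d^{-q+\frac{q-p}{p}n}|u|^q\,dx\right)^{p/q}.\qquad(*)$$ (b) If $p<k$, there is a constant $M>0$ (independent of $u$, but allowed to depend on $\delta$ and on the other data) such that for all $u\in C_0^\infty(\Omega\setminus K)$ $$\int_{K_\delta}|\nabla u|^p\,dx-|H|^p\int_{K_\delta}\frac{|u|^p}{d^p}\,dx+M\int_{K_\delta}|u|^p\,dx\ \ge\ C\left(\int_{K_\delta}d^{-q+\frac{q-p}{p}n}|u|^q\,dx\right)^{p/q}.$$ (c) If $p\ne k$ (in particular also if $p<k$), then $(*)$ holds for all $u\in C_0^\infty(K_\delta\setminus K)$. Moreover, if $p<k$, the Hardy inequality without the term with $M$ fails in general: there are such a pair $(\Omega,K)$ satisfying (R), with $K$ compact and $K\subset\Omega$, and a $\delta_1>0$ such that for every $0<\delta\le\delta_1$ there is $u\in C_0^\infty(\Omega\setminus K)$ with $$\int_{K_\delta}|\nabla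 u|^p\,dx-|H|^p\int_{K_\delta}\frac{|u|^p}{d^p}\,dx<0 .$$ -/

import Mathlib

open Set MeasureTheory
open scoped ContDiff

noncomputable section

namespace HardySobolev

/-- The Euclidean space `ℝⁿ`. -/
abbrev E (n : ℕ) : Type := EuclideanSpace ℝ (Fin n)

/-- `K` is a closed set which is an embedded `C²` submanifold of `ℝⁿ`, without boundary, of
codimension `k`: near each of its points it is the zero set of a `C²` submersion into `ℝᵏ`. -/
structure IsC2Surface (n k : ℕ) (K : Set (E n)) : Prop where
  isClosed : IsClosed K
  exists_submersion : ∀ x ∈ K, ∃ (U : Set (E n)) (g : E n → E k),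
    IsOpen U ∧ x ∈ U ∧ ContDiffOn ℝ 2 g U ∧
    (∀ y ∈ U, Function.Surjective (fderiv ℝ g y)) ∧
    K ∩ U = {y ∈ U | g y = 0}

/-- `Ω` is a bounded domain and `K` is a `C²` surface of codimension `k`, which is the boundary
of `Ω` when `k = 1` and which meets the closure of `Ω` when `k > 1`. -/
structure IsDomainWithSurface (n k : ℕ) (Ω K : Set (E n)) : Prop where
  isOpen : IsOpen Ω
  isConnected : IsConnected Ω
  isBounded : Bornology.IsBounded Ω
  isC2Surface : IsC2Surface n k K
  eq_frontier : k = 1 → K = frontier Ω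
  meets : 1 < k → (K ∩ closure Ω).Nonempty

/-- The distance `d(x) = dist(x, K)`. -/
def d {n : ℕ} (K : Set (E n)) (x : E n) : ℝ := Metric.infDist x K

/-- The tubular neighbourhood `K_δ = {x ∈ Ω : dist(x, K) ≤ δ}`. -/
def tube {n : ℕ} (Ω K : Set (E n)) (δ : ℝ) : Set (E n) := {x ∈ Ω | d K x ≤ δ}

/-- Condition (R): there are `c₀ > 0` and `δ* > 0` such that `d` is of class `C²` off `K` in
`K_δ` and `|d Δd + 1 - k| ≤ c₀ d` there, for all `0 < δ ≤ δ*`. -/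
def ConditionR {n : ℕ} (k : ℕ) (Ω K : Set (E n)) : Prop :=
  ∃ c₀ > 0, ∃ δs > 0, ∀ δ : ℝ, 0 < δ → δ ≤ δs → ∀ x ∈ tube Ω K δ \ K,
    ContDiffAt ℝ 2 (d K) x ∧
    |d K x * Laplacian.laplacian (d K) x + 1 - (k : ℝ)| ≤ c₀ * d K x

/-- `u ∈ C₀^∞(V)`: `u` is a smooth real function on `ℝⁿ` with compact support contained
in `V`. -/
def IsTestFunction {n : ℕ} (V : Set (E n)) (u : E n → ℝ) : Prop :=
  ContDiff ℝ ∞ u ∧ HasCompactSupport u ∧ tsupport u ⊆ V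

/-- The Hardy functional
`I_{p,k}[u](V) = ∫_V |∇u|^p dx - |(p-k)/p|^p ∫_V |u|^p / d^p dx`. -/
def hardyFunctional {n : ℕ} (k : ℕ) (p : ℝ) (K V : Set (E n)) (u : E n → ℝ) : ℝ :=
  (∫ x in V, ‖gradient u x‖ ^ p) -
    |(p - k) / p| ^ p * ∫ x in V, |u x| ^ p / d K x ^ p

/-- `(∫_V d^{-q + ((q-p)/p) n} |u|^q dx)^{p/q}`. -/
def weightedNormPow {n : ℕ} (p q : ℝ) (K V : Set (E n)) (u : E n → ℝ) : ℝ :=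
  (∫ x in V, d K x ^ (-q + (q - p) / p * n) * |u x| ^ q) ^ (p / q)

end HardySobolev

end

/-! The proof works with the gradient flow of the distance `d` to `K` alone: condition (R) says that
`|∇d| = 1` and `d Δd = k - 1 + O(d)` near `K`, and nothing else about `K` is used for the estimates.

Write `V = ∇u - H (u / d) ∇d` (`remainder`); for the ground state substitution `u = d ^ H v` it is
`d ^ H ∇v`. Since `‖·‖ ^ p` is uniformly convex for `p ≥ 2` (`norm_add_rpow_ge`), `|∇u| ^ p` is at
least `|H u / d| ^ p` plus a term linear in `V` plus a multiple of `|V| ^ p`. The linear term is,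
up to an error of lower order, the divergence of a multiple of `d ^ (1 - p) |u| ^ p ∇d`, hence the
Hardy functional dominates `∫ |V| ^ p` up to a boundary term on `{d = δ}`, of the sign of `H`, and
an error `∫ d ^ (1 - p) |u| ^ p` (`IsTubular.hardy_ge`). The error is absorbed in thin tubes
(`exists_weakHardyTerm_le`). The boundary term is harmless if `p > k`, vanishes if `u` is supported
in the tube, and is otherwise controlled by a multiple of `∫ |u| ^ p` through a trace inequality
(`exists_boundaryTerm_le`). Together this is `exists_tubeHardy_ge`. Surface integrals over
`{d = δ}`, which need not be a compact surface inside `Ω`, are replaced by the volume integral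
`flux`, a limit of integrals over thin shells.

The Sobolev term is controlled by the remainder in `exists_weightedSobolev`. The
Gagliardo–Nirenberg–Sobolev inequality in `L¹` is applied to `d ^ b |u| ^ s`, cut off at `{d = δ}`,
with `s = 1 + q (p - 1) / p`. The weight is such that `d ^ b |u| ^ (s - 1)` is the power
`(p - 1) / p` of the integrand `d ^ (-q + (q - p) n / p) |u| ^ q`. The divergence of
`d ^ b |u| ^ s ∇d` then has the leading coefficient `κ = (q - p) (p - 1) (n - k) / p ^ 2`, which is
positive even if `p < k`, so the norm of `d ^ (b - 1) |u| ^ s` in `L¹` is controlled as well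
(`exists_sobolev_of_pos`). Hölder's inequality, interpolating between these two norms on one side
and separating `V` on the other, concludes. All constants depend on `n, k, p, q` only, and the
smallness of `δ` only on the constants of condition (R) and on `p, k`.

If `p < k`, let `K` be the unit sphere of a coordinate subspace, of codimension `k`, in a larger
ball. Its tubes of radius `ρ` have volume `O(ρ ^ k)`, so `K` has zero `p`-capacity: the functions
which vanish within distance `ρ` of `K` and are one beyond `2ρ` have energy `O(ρ ^ (k - p))`, while
`∫ |u| ^ p / d ^ p` stays bounded below (`exists_hardyFunctional_neg`). -/

namespace HardySobolev

open Filter Topology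

/-! ### Convexity inequalities for powers of the norm -/

section Convexity

/-- Young's inequality with a small parameter. -/
lemma young_rpow {p : ℝ} (hp : 1 ≤ p) {ε : ℝ} (hε : 0 < ε) :
    ∃ C : ℝ, 0 < C ∧ ∀ a b : ℝ, 0 ≤ a → 0 ≤ b →
      p * a ^ (p - 1) * b ≤ ε * a ^ p + C * b ^ p := by
  have hp0 : 0 < p := by linarith
  refine ⟨p * (p / ε) ^ (p - 1), by positivity, fun a b ha hb => ?_⟩
  have key : ∀ x : ℝ, 0 ≤ x → x ^ (p - 1) * x = x ^ p := by
    intro x hx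
    rcases hx.eq_or_lt with rfl | hx
    · simp [Real.zero_rpow hp0.ne']
    · rw [Real.rpow_sub_one hx.ne']; field_simp
  by_cases h : p * b ≤ ε * a
  · have h1 : p * a ^ (p - 1) * b ≤ ε * a ^ p := by
      calc p * a ^ (p - 1) * b = a ^ (p - 1) * (p * b) := by ring
        _ ≤ a ^ (p - 1) * (ε * a) := by gcongr
        _ = ε * a ^ p := by rw [← key a ha]; ring
    have : 0 ≤ p * (p / ε) ^ (p - 1) * b ^ p := by positivity
    linarith
  · have h2 : a ≤ p / ε * b := by
      rw [div_mul_eq_mul_div, le_div_iff₀ hε]; linarith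
    have h1 : p * a ^ (p - 1) * b ≤ p * (p / ε) ^ (p - 1) * b ^ p := by
      calc p * a ^ (p - 1) * b ≤ p * (p / ε * b) ^ (p - 1) * b := by gcongr
        _ = p * (p / ε) ^ (p - 1) * b ^ p := by
          rw [Real.mul_rpow (by positivity) hb, ← key b hb]; ring
    have : 0 ≤ ε * a ^ p := by positivity
    linarith

section Vector

variable {F : Type*} [NormedAddCommGroup F] [InnerProductSpace ℝ F]

/-- The tangent-plane inequality for the convex function `‖·‖ ^ p`. -/
lemma norm_add_rpow_ge_tangent {p : ℝ} (hp : 2 ≤ p) (a b : F) :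
    ‖a‖ ^ p + p * ‖a‖ ^ (p - 2) * inner ℝ a b ≤ ‖a + b‖ ^ p := by
  have hp0 : 0 < p := by linarith
  have hq : (p / (p - 1)).HolderConjugate p :=
    (Real.HolderConjugate.conjExponent (by linarith : 1 < p)).symm
  have h1 : ‖a‖ ^ (p - 1) * ‖a + b‖ ≤ (p - 1) / p * ‖a‖ ^ p + ‖a + b‖ ^ p / p := by
    have := Real.young_inequality_of_nonneg (a := ‖a‖ ^ (p - 1)) (b := ‖a + b‖) (by positivity)
      (by positivity) hq
    rw [← Real.rpow_mul (by positivity), mul_div_cancel₀ p (by linarith : p - 1 ≠ 0)] at this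
    have e : ‖a‖ ^ p / (p / (p - 1)) = (p - 1) / p * ‖a‖ ^ p := by
      have : p - 1 ≠ 0 := by linarith
      field_simp
    linarith
  have h2 : inner ℝ a (a + b) ≤ ‖a‖ * ‖a + b‖ := real_inner_le_norm _ _
  rw [inner_add_right, real_inner_self_eq_norm_sq] at h2
  have hn : 0 ≤ ‖a‖ := norm_nonneg _
  have e1 : ‖a‖ ^ (p - 2) * ‖a‖ ^ 2 = ‖a‖ ^ p := by
    rw [← Real.rpow_natCast, ← Real.rpow_add_of_nonneg hn (by linarith) (by norm_num)]
    congr 1; push_cast; ring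
  have e2 : ‖a‖ ^ (p - 2) * ‖a‖ = ‖a‖ ^ (p - 1) := by
    nth_rewrite 2 [← Real.rpow_one ‖a‖]
    rw [← Real.rpow_add_of_nonneg hn (by linarith) (by norm_num)]
    congr 1; ring
  have h3 : ‖a‖ ^ (p - 2) * (‖a‖ ^ 2 + inner ℝ a b) ≤ ‖a‖ ^ (p - 2) * (‖a‖ * ‖a + b‖) := by
    gcongr
  have h4 : p * ((p - 1) / p * ‖a‖ ^ p + ‖a + b‖ ^ p / p) = (p - 1) * ‖a‖ ^ p + ‖a + b‖ ^ p := by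
    field_simp
  have h5 := mul_le_mul_of_nonneg_left h1 hp0.le
  have h6 : ‖a‖ ^ p + ‖a‖ ^ (p - 2) * inner ℝ a b ≤ ‖a‖ ^ (p - 1) * ‖a + b‖ := by
    rw [← e1, ← e2]; linarith
  have h7 := mul_le_mul_of_nonneg_left h6 hp0.le
  nlinarith

/-- Clarkson's inequality for exponents `p ≥ 2`, in an inner product space. -/
lemma clarkson {p : ℝ} (hp : 2 ≤ p) (x y : F) :
    2 * ‖x‖ ^ p + 2 * ‖y‖ ^ p ≤ ‖x + y‖ ^ p + ‖x - y‖ ^ p := by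
  have hs : ∀ z : F, ‖z‖ ^ p = (‖z‖ ^ 2) ^ (p / 2) := by
    intro z
    rw [← Real.rpow_natCast, ← Real.rpow_mul (norm_nonneg _)]
    congr 1; push_cast; ring
  have hp2 : 1 ≤ p / 2 := by linarith
  have par := parallelogram_law_with_norm ℝ x y
  simp only [hs]
  set α := ‖x + y‖ ^ 2
  set β := ‖x - y‖ ^ 2
  have hα : 0 ≤ α := by positivity
  have hβ : 0 ≤ β := by positivity
  have hsup : (‖x‖ ^ 2) ^ (p / 2) + (‖y‖ ^ 2) ^ (p / 2) ≤ (‖x‖ ^ 2 + ‖y‖ ^ 2) ^ (p / 2) :=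
    Real.add_rpow_le_rpow_add (by positivity) (by positivity) hp2
  have e : ‖x‖ ^ 2 + ‖y‖ ^ 2 = (1 / 2) * α + (1 / 2) * β := by
    simp only [α, β]; linarith
  have hconv := (convexOn_rpow hp2).2 (mem_Ici.2 hα) (mem_Ici.2 hβ)
    (by norm_num : (0 : ℝ) ≤ 1 / 2) (by norm_num : (0 : ℝ) ≤ 1 / 2) (by norm_num)
  simp only [smul_eq_mul] at hconv
  rw [e] at hsup
  linarith

/-- Uniform convexity of `‖·‖ ^ p`, `p ≥ 2`: the tangent-plane inequality with a remainder. -/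
lemma norm_add_rpow_ge {p : ℝ} (hp : 2 ≤ p) (a b : F) :
    ‖a‖ ^ p + p * ‖a‖ ^ (p - 2) * inner ℝ a b + 2 ^ (1 - p) * ‖b‖ ^ p ≤ ‖a + b‖ ^ p := by
  have h1 := norm_add_rpow_ge_tangent hp a ((1 / 2 : ℝ) • b)
  have h2 := clarkson hp (a + (1 / 2 : ℝ) • b) ((1 / 2 : ℝ) • b)
  have e1 : a + (1 / 2 : ℝ) • b + (1 / 2 : ℝ) • b = a + b := by
    rw [add_assoc, ← add_smul]; norm_num
  have e2 : a + (1 / 2 : ℝ) • b - (1 / 2 : ℝ) • b = a := by abel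
  rw [e1, e2] at h2
  rw [inner_smul_right] at h1
  have e3 : 2 * ‖(1 / 2 : ℝ) • b‖ ^ p = 2 ^ (1 - p) * ‖b‖ ^ p := by
    rw [norm_smul, Real.mul_rpow (by positivity) (by positivity),
      Real.rpow_sub (by norm_num), Real.norm_of_nonneg (by norm_num), one_div,
      Real.inv_rpow (by norm_num)]
    simp; ring
  rw [e3] at h2
  linarith

end Vector

end Convexity

/-! ### Green's identity -/

section Green

variable {n : ℕ}

lemma integrable_of_continuousOn_of_zero {G : Type*} [NormedAddCommGroup G] {f : E n → G}
    {S : Set (E n)}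
    (hS : IsCompact S) (hf : ContinuousOn f S) (h0 : ∀ x, x ∉ S → f x = 0) : Integrable f := by
  refine (integrableOn_iff_integrable_of_support_subset (s := S) ?_).1 (hf.integrableOn_compact hS)
  intro x hx
  by_contra h
  exact hx (h0 x h)

lemma inner_gradient (f : E n → ℝ) (x v : E n) : inner ℝ (gradient f x) v = fderiv ℝ f x v := by
  simp [gradient]

lemma continuousAt_gradient {f : E n → ℝ} {x : E n} (hf : ContDiffAt ℝ 1 f x) :
    ContinuousAt (gradient f) x := by
  have h : ContinuousAt (fderiv ℝ f) x :=
    (hf.fderiv_right (m := 0) (by norm_num)).continuousAt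
  exact (InnerProductSpace.toDual ℝ (E n)).symm.continuous.continuousAt.comp h

lemma laplacian_eq_sum_fderiv (f : E n → ℝ) (x : E n) :
    Laplacian.laplacian f x = ∑ i, fderiv ℝ (fderiv ℝ f) x (stdOrthonormalBasis ℝ (E n) i)
      (stdOrthonormalBasis ℝ (E n) i) := by
  rw [InnerProductSpace.laplacian_eq_iteratedFDeriv_stdOrthonormalBasis]
  simp [iteratedFDeriv_two_apply]

lemma continuousAt_laplacian {f : E n → ℝ} {x : E n} (hf : ContDiffAt ℝ 2 f x) :
    ContinuousAt (Laplacian.laplacian f) x := by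
  have h1 : ContDiffAt ℝ 1 (fderiv ℝ f) x := hf.fderiv_right (by norm_num)
  have h2 : ContinuousAt (fderiv ℝ (fderiv ℝ f)) x :=
    (h1.fderiv_right (m := 0) (by norm_num)).continuousAt
  have : Laplacian.laplacian f = fun x => ∑ i, fderiv ℝ (fderiv ℝ f) x
      (stdOrthonormalBasis ℝ (E n) i) (stdOrthonormalBasis ℝ (E n) i) :=
    funext (laplacian_eq_sum_fderiv f)
  rw [this]
  fun_prop

lemma gradient_eq_zero_of_notMem_tsupport {f : E n → ℝ} {x : E n} (hx : x ∉ tsupport f) :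
    gradient f x = 0 := by
  have : fderiv ℝ f x = 0 := by
    have := support_fderiv_subset ℝ (f := f)
    by_contra h
    exact hx (this h)
  simp [gradient, this]

/-- Green's identity for a compactly supported `ψ`. -/
lemma integral_inner_gradient_add_laplacian_eq_zero {ψ D : E n → ℝ} (hψ : ContDiff ℝ 1 ψ)
    (hc : HasCompactSupport ψ) (hD : ∀ x ∈ tsupport ψ, ContDiffAt ℝ 2 D x) :
    ∫ x, (inner ℝ (gradient ψ x) (gradient D x) + ψ x * Laplacian.laplacian D x) = 0 := by
  set e := stdOrthonormalBasis ℝ (E n)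
  have hψ' : Continuous (fderiv ℝ ψ) := hψ.continuous_fderiv (by norm_num)
  have hD1 : ∀ x ∈ tsupport ψ, ContDiffAt ℝ 1 (fderiv ℝ D) x := fun x hx =>
    (hD x hx).fderiv_right (by norm_num)
  have hD1c : ∀ x ∈ tsupport ψ, ContinuousAt (fderiv ℝ D) x := fun x hx => (hD1 x hx).continuousAt
  have hD2c : ∀ x ∈ tsupport ψ, ContinuousAt (fderiv ℝ (fderiv ℝ D)) x := fun x hx =>
    ((hD1 x hx).fderiv_right (m := 0) (by norm_num)).continuousAt
  have hz : ∀ x, x ∉ tsupport ψ → fderiv ℝ ψ x = 0 := by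
    intro x hx
    by_contra h
    exact hx (support_fderiv_subset ℝ h)
  have hz0 : ∀ x, x ∉ tsupport ψ → ψ x = 0 := fun x hx => image_eq_zero_of_notMem_tsupport hx
  have i1 : ∀ i, Integrable (fun x => fderiv ℝ ψ x (e i) * fderiv ℝ D x (e i)) := by
    intro i
    refine integrable_of_continuousOn_of_zero hc ?_ (fun x hx => by simp [hz x hx])
    intro x hx
    have := hD1c x hx
    exact ContinuousAt.continuousWithinAt (by fun_prop)
  have i2 : ∀ i, Integrable (fun x => ψ x * fderiv ℝ (fderiv ℝ D) x (e i) (e i)) := by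
    intro i
    refine integrable_of_continuousOn_of_zero hc ?_ (fun x hx => by simp [hz0 x hx])
    intro x hx
    have := hD2c x hx
    have := hψ.continuous
    exact ContinuousAt.continuousWithinAt (by fun_prop)
  have i3 : ∀ i, Integrable (fun x => ψ x * fderiv ℝ D x (e i)) := by
    intro i
    refine integrable_of_continuousOn_of_zero hc ?_ (fun x hx => by simp [hz0 x hx])
    intro x hx
    have := hD1c x hx
    have := hψ.continuous
    exact ContinuousAt.continuousWithinAt (by fun_prop)
  have hdd : ∀ i, ∀ x ∈ tsupport ψ, fderiv ℝ (fun y => fderiv ℝ D y (e i)) x (e i) =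
      fderiv ℝ (fderiv ℝ D) x (e i) (e i) := by
    intro i x hx
    have hd : DifferentiableAt ℝ (fderiv ℝ D) x := (hD1 x hx).differentiableAt (by norm_num)
    rw [fderiv_clm_apply hd (differentiableAt_const _)]
    simp
  have hmul : ∀ i, (fun x => ψ x * fderiv ℝ (fun y => fderiv ℝ D y (e i)) x (e i)) =
      fun x => ψ x * fderiv ℝ (fderiv ℝ D) x (e i) (e i) := by
    intro i
    funext x
    by_cases hx : x ∈ tsupport ψ
    · rw [hdd i x hx]
    · simp [hz0 x hx]
  have ibp : ∀ i, ∫ x, (fderiv ℝ ψ x (e i) * fderiv ℝ D x (e i) +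
      ψ x * fderiv ℝ (fderiv ℝ D) x (e i) (e i)) = 0 := by
    intro i
    rw [integral_add (i1 i) (i2 i), ← hmul i]
    rw [integral_mul_fderiv_eq_neg_fderiv_mul_of_integrable (i1 i) (by rw [hmul i]; exact i2 i)
      (i3 i) (fun x _ => hψ.differentiable (by norm_num) x)]
    · ring
    · intro x hx
      have hd : DifferentiableAt ℝ (fderiv ℝ D) x := (hD1 x hx).differentiableAt (by norm_num)
      exact hd.clm_apply (differentiableAt_const _)
  have heq : ∀ x, inner ℝ (gradient ψ x) (gradient D x) + ψ x * Laplacian.laplacian D x =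
      ∑ i, (fderiv ℝ ψ x (e i) * fderiv ℝ D x (e i) +
        ψ x * fderiv ℝ (fderiv ℝ D) x (e i) (e i)) := by
    intro x
    rw [Finset.sum_add_distrib, laplacian_eq_sum_fderiv, Finset.mul_sum,
      ← e.sum_inner_mul_inner]
    congr 1
    refine Finset.sum_congr rfl fun i _ => ?_
    rw [inner_gradient, real_inner_comm, inner_gradient]
  simp_rw [heq]
  rw [integral_finsetSum]
  · exact Finset.sum_eq_zero fun i _ => ibp i
  · exact fun i _ => (i1 i).add (i2 i)

end Green

/-! ### Eikonal functions and the divergence theorem on their sublevel sets -/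

section Eikonal

variable {n : ℕ}

/-- `D` behaves on `{x ∈ U | D x < r}` like the distance to a set outside the open set `U`:
it is positive, of class `C²`, and solves the eikonal equation `|∇D| = 1`. -/
structure IsEikonal (D : E n → ℝ) (U : Set (E n)) (r : ℝ) : Prop where
  isOpen : IsOpen U
  continuous : Continuous D
  pos : ∀ x ∈ U, 0 < D x
  contDiffAt : ∀ x ∈ U, D x < r → ContDiffAt ℝ 2 D x
  norm_gradient : ∀ x ∈ U, D x < r → ‖gradient D x‖ = 1

/-- The sublevel set `{x ∈ U | D x ≤ δ}`. -/
def sublevel (D : E n → ℝ) (U : Set (E n)) (δ : ℝ) : Set (E n) := {x ∈ U | D x ≤ δ}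

/-- The divergence of the vector field `w ∇D`. -/
noncomputable def divGrad (D w : E n → ℝ) (x : E n) : ℝ :=
  inner ℝ (gradient w x) (gradient D x) + w x * Laplacian.laplacian D x

/-- The flux `∫_{D ≤ δ} div (w ∇D)` of `w ∇D` through the level set `{D = δ}`. When `|∇D| = 1`
it plays the part of the surface integral of `w` over that level set. -/
noncomputable def flux (D : E n → ℝ) (U : Set (E n)) (δ : ℝ) (w : E n → ℝ) : ℝ :=
  ∫ x in sublevel D U δ, divGrad D w x

lemma IsEikonal.measurableSet_sublevel {D : E n → ℝ} {U : Set (E n)} {r : ℝ}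
    (h : IsEikonal D U r) (δ : ℝ) : MeasurableSet (sublevel D U δ) :=
  h.isOpen.measurableSet.inter (h.continuous.measurable measurableSet_Iic)

lemma IsEikonal.differentiableAt {D : E n → ℝ} {U : Set (E n)} {r : ℝ}
    (h : IsEikonal D U r) {x : E n} (hx : x ∈ U) (hr : D x < r) : DifferentiableAt ℝ D x :=
  (h.contDiffAt x hx hr).differentiableAt (by norm_num)

/-- A function which vanishes off the support of `w` is integrable on the sublevel set as soon as
it is continuous at the points of `U` where `D < r`. -/
lemma IsEikonal.integrableOn {G : Type*} [NormedAddCommGroup G] {D : E n → ℝ} {U : Set (E n)}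
    {r δ : ℝ} (h : IsEikonal D U r) (hδ : δ < r)
    {w : E n → ℝ} (hc : HasCompactSupport w) (hU : tsupport w ⊆ U) {f : E n → G}
    (hf : ∀ x ∈ U, D x < r → ContinuousAt f x) (h0 : ∀ x, x ∉ tsupport w → f x = 0) :
    IntegrableOn f (sublevel D U δ) := by
  have hS : IsCompact (tsupport w ∩ {x | D x ≤ δ}) :=
    hc.isCompact.inter_right (isClosed_le h.continuous continuous_const)
  have h1 : IntegrableOn f (tsupport w ∩ {x | D x ≤ δ}) :=
    ContinuousOn.integrableOn_compact hS fun x hx => (hf x (hU hx.1)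
      (lt_of_le_of_lt hx.2 hδ)).continuousWithinAt
  have h2 := (integrable_indicator_iff hS.measurableSet).2 h1
  refine (integrable_indicator_iff (h.measurableSet_sublevel δ)).1 (h2.congr ?_)
  refine Eventually.of_forall fun x => ?_
  by_cases hx : x ∈ tsupport w
  · have hiff : x ∈ tsupport w ∩ {x | D x ≤ δ} ↔ x ∈ sublevel D U δ := by
      simp [sublevel, hx, hU hx]
    by_cases hx2 : x ∈ sublevel D U δ
    · rw [indicator_of_mem hx2, indicator_of_mem (hiff.2 hx2)]
    · rw [indicator_of_notMem hx2, indicator_of_notMem (fun h => hx2 (hiff.1 h))]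
  · rw [indicator_of_notMem (fun h => hx h.1)]
    by_cases hx2 : x ∈ sublevel D U δ
    · rw [indicator_of_mem hx2, h0 x hx]
    · rw [indicator_of_notMem hx2]

lemma continuousAt_divGrad {D w : E n → ℝ} {x : E n} (hw : ContDiff ℝ 1 w)
    (hD : ContDiffAt ℝ 2 D x) : ContinuousAt (divGrad D w) x := by
  have h1 := continuousAt_gradient (f := w) (x := x) hw.contDiffAt
  have h2 := continuousAt_gradient (f := D) (x := x) (hD.of_le (by norm_num))
  have h3 := continuousAt_laplacian hD
  have h4 := hw.continuous
  unfold divGrad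
  exact (h1.inner h2).add (h4.continuousAt.mul h3)

lemma divGrad_eq_zero {D w : E n → ℝ} {x : E n} (hx : x ∉ tsupport w) : divGrad D w x = 0 := by
  simp [divGrad, gradient_eq_zero_of_notMem_tsupport hx, image_eq_zero_of_notMem_tsupport hx]

section Cutoff

/-- A function which is nonincreasing, equal to `1` on `(-∞, δ]` and to `0` on `[δ + ε, ∞)`. -/
noncomputable def cutoff (δ ε t : ℝ) : ℝ := Real.smoothTransition ((δ + ε - t) / ε)

variable {δ ε t : ℝ}

lemma contDiff_cutoff (δ ε : ℝ) : ContDiff ℝ ∞ (cutoff δ ε) := by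
  unfold cutoff
  exact Real.smoothTransition.contDiff.comp (by fun_prop)

lemma cutoff_eq_one (hε : 0 < ε) (ht : t ≤ δ) : cutoff δ ε t = 1 := by
  apply Real.smoothTransition.one_of_one_le
  rw [le_div_iff₀ hε]; linarith

lemma cutoff_eq_zero (hε : 0 < ε) (ht : δ + ε ≤ t) : cutoff δ ε t = 0 := by
  apply Real.smoothTransition.zero_of_nonpos
  exact div_nonpos_of_nonpos_of_nonneg (by linarith) hε.le

lemma cutoff_nonneg (δ ε t : ℝ) : 0 ≤ cutoff δ ε t := Real.smoothTransition.nonneg _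

lemma cutoff_le_one (δ ε t : ℝ) : cutoff δ ε t ≤ 1 := Real.smoothTransition.le_one _

lemma deriv_cutoff_nonpos (hε : 0 < ε) : deriv (cutoff δ ε) t ≤ 0 := by
  have : Antitone (cutoff δ ε) := by
    intro a b hab
    apply Real.smoothTransition.monotone
    gcongr
  exact this.deriv_nonpos

lemma deriv_cutoff_of_le (hε : 0 < ε) (ht : t ≤ δ) : deriv (cutoff δ ε) t = 0 := by
  apply IsLocalMax.deriv_eq_zero
  refine Eventually.of_forall fun s => ?_
  rw [cutoff_eq_one hε ht]
  exact cutoff_le_one _ _ _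

lemma deriv_cutoff_of_ge (hε : 0 < ε) (ht : δ + ε ≤ t) : deriv (cutoff δ ε) t = 0 := by
  apply IsLocalMin.deriv_eq_zero
  refine Eventually.of_forall fun s => ?_
  rw [cutoff_eq_zero hε ht]
  exact cutoff_nonneg _ _ _

end Cutoff

section Flux

variable {D : E n → ℝ} {U : Set (E n)} {r δ : ℝ} {w : E n → ℝ}

lemma gradient_comp_mul {ξ : ℝ → ℝ} {x : E n} (hξ : DifferentiableAt ℝ ξ (D x))
    (hD : DifferentiableAt ℝ D x) (hw : DifferentiableAt ℝ w x) :
    gradient (fun y => ξ (D y) * w y) x =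
      (deriv ξ (D x) * w x) • gradient D x + ξ (D x) • gradient w x := by
  have h1 : HasFDerivAt (fun y => ξ (D y)) (deriv ξ (D x) • fderiv ℝ D x) x :=
    hξ.hasDerivAt.comp_hasFDerivAt x hD.hasFDerivAt
  have h2 := (h1.mul hw.hasFDerivAt).fderiv
  unfold gradient
  rw [show (fun y => ξ (D y) * w y) = (fun y => ξ (D y)) * w from rfl, h2]
  simp only [map_add, map_smul, smul_smul]
  rw [add_comm, mul_comm (w x)]

/-- The product `ξ (D) w` is of class `C¹` if `ξ` vanishes near and beyond `r`. -/
lemma IsEikonal.contDiff_comp_mul (h : IsEikonal D U r) (hw : ContDiff ℝ 1 w)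
    (hU : tsupport w ⊆ U) {ξ : ℝ → ℝ} (hξ : ∀ t, 0 < t → ContDiffAt ℝ 1 ξ t)
    {δ' : ℝ} (hδ' : δ' < r) (hξ0 : ∀ t, δ' ≤ t → ξ t = 0) :
    ContDiff ℝ 1 (fun y => ξ (D y) * w y) := by
  rw [contDiff_iff_contDiffAt]
  intro x
  by_cases hx : x ∈ tsupport w
  · have hxU := hU hx
    by_cases hr : D x < r
    · exact ((hξ _ (h.pos x hxU)).comp x ((h.contDiffAt x hxU hr).of_le (by norm_num))).mul
        hw.contDiffAt
    · have : (fun y => ξ (D y) * w y) =ᶠ[𝓝 x] fun _ => 0 := by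
        have : ∀ᶠ y in 𝓝 x, δ' < D y :=
          h.continuous.continuousAt.eventually (lt_mem_nhds (by linarith))
        filter_upwards [this] with y hy
        simp [hξ0 _ hy.le]
      exact contDiffAt_const.congr_of_eventuallyEq this
  · have : (fun y => ξ (D y) * w y) =ᶠ[𝓝 x] fun _ => 0 := by
      filter_upwards [notMem_tsupport_iff_eventuallyEq.1 hx] with y hy
      simp [hy]
    exact contDiffAt_const.congr_of_eventuallyEq this

lemma IsEikonal.tsupport_comp_mul (h : IsEikonal D U r) {ξ : ℝ → ℝ} {δ' : ℝ}
    (hξ0 : ∀ t, δ' ≤ t → ξ t = 0) :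
    tsupport (fun y => ξ (D y) * w y) ⊆ tsupport w ∩ {x | D x ≤ δ'} := by
  apply closure_minimal _ ((isClosed_tsupport w).inter (isClosed_le h.continuous continuous_const))
  intro x hx
  refine ⟨subset_tsupport w fun h0 => hx ?_, ?_⟩
  · simp [h0]
  · by_contra h0
    exact hx (by simp [hξ0 _ (not_le.1 h0).le])

/-- The divergence theorem for the compactly supported field `ξ (D) w ∇D`. -/
lemma IsEikonal.integral_div_eq_zero (h : IsEikonal D U r) (hw : ContDiff ℝ 1 w)
    (hc : HasCompactSupport w) (hU : tsupport w ⊆ U) {ξ : ℝ → ℝ}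
    (hξ : ∀ t, 0 < t → ContDiffAt ℝ 1 ξ t)
    {δ' : ℝ} (hδ' : δ' < r) (hξ0 : ∀ t, δ' ≤ t → ξ t = 0) :
    ∫ x, (deriv ξ (D x) * w x + ξ (D x) * divGrad D w x) = 0 := by
  have hs := h.tsupport_comp_mul (w := w) hξ0
  rw [← integral_inner_gradient_add_laplacian_eq_zero (D := D)
    (h.contDiff_comp_mul hw hU hξ hδ' hξ0)
    (hc.of_isClosed_subset (isClosed_tsupport _) (hs.trans inter_subset_left))
    (fun x hx => h.contDiffAt x (hU (hs hx).1) (lt_of_le_of_lt (hs hx).2 hδ'))]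
  congr 1
  funext x
  by_cases hx : x ∈ tsupport w
  · have hxU := hU hx
    by_cases hr : D x < r
    · rw [gradient_comp_mul ((hξ _ (h.pos x hxU)).differentiableAt (by norm_num))
        (h.differentiableAt hxU hr) (hw.differentiable (by norm_num) x), inner_add_left,
        inner_smul_left, inner_smul_left, real_inner_self_eq_norm_sq, h.norm_gradient x hxU hr]
      simp [divGrad]; ring
    · have hx2 : x ∉ tsupport (fun y => ξ (D y) * w y) := fun hx2 => by
        have := (hs hx2).2
        simp at this
        linarith
      have hd : deriv ξ (D x) = 0 := by
        have : ξ =ᶠ[𝓝 (D x)] fun _ => 0 := by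
          filter_upwards [lt_mem_nhds (show δ' < D x by linarith)] with t ht using hξ0 t ht.le
        rw [this.deriv_eq]; simp
      rw [gradient_eq_zero_of_notMem_tsupport hx2, hξ0 (D x) (by linarith), hd]
      simp
  · have hx2 : x ∉ tsupport (fun y => ξ (D y) * w y) := fun hx2 => hx (hs hx2).1
    rw [gradient_eq_zero_of_notMem_tsupport hx2, divGrad_eq_zero hx,
      image_eq_zero_of_notMem_tsupport hx]
    simp

/-- The integrals of a function against the cutoffs of the sublevel set converge to the integral
over that set. -/
lemma IsEikonal.tendsto_integral_cutoff (h : IsEikonal D U r) (hc : HasCompactSupport w)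
    (hU : tsupport w ⊆ U) {ε : ℕ → ℝ} (hε : ∀ j, 0 < ε j) (hεr : ∃ δ' < r, ∀ j, δ + ε j ≤ δ')
    (hε0 : Tendsto ε atTop (𝓝 0))
    {f : E n → ℝ} (hf : ∀ x ∈ U, D x < r → ContinuousAt f x) (h0 : ∀ x, x ∉ tsupport w → f x = 0) :
    (∀ j, Integrable fun x => cutoff δ (ε j) (D x) * f x) ∧
    Tendsto (fun j => ∫ x, cutoff δ (ε j) (D x) * f x) atTop
      (𝓝 (∫ x in sublevel D U δ, f x)) := by
  obtain ⟨δ', hδ', hle⟩ := hεr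
  have hi : ∀ j, Integrable fun x => cutoff δ (ε j) (D x) * f x := by
    intro j
    have hS : IsCompact (tsupport w ∩ {x | D x ≤ δ'}) :=
      hc.isCompact.inter_right (isClosed_le h.continuous continuous_const)
    refine integrable_of_continuousOn_of_zero hS ?_ ?_
    · intro x hx
      have h1 := hf x (hU hx.1) (lt_of_le_of_lt hx.2 hδ')
      have h2 := (contDiff_cutoff δ (ε j)).continuous.comp h.continuous
      exact (h2.continuousAt.mul h1).continuousWithinAt
    · intro x hx
      by_cases hx1 : x ∈ tsupport w
      · have : δ' < D x := by
          by_contra h2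
          exact hx ⟨hx1, not_lt.1 h2⟩
        rw [cutoff_eq_zero (hε j) (by linarith [hle j])]; simp
      · simp [h0 x hx1]
  refine ⟨hi, ?_⟩
  rw [← integral_indicator (h.measurableSet_sublevel δ)]
  have hb : Integrable (fun x => (sublevel D U δ').indicator f x) :=
    (integrable_indicator_iff (h.measurableSet_sublevel δ')).2 (h.integrableOn hδ' hc hU hf h0)
  refine tendsto_integral_of_dominated_convergence (fun x => ‖(sublevel D U δ').indicator f x‖)
    (fun j => (hi j).aestronglyMeasurable) hb.norm ?_ ?_
  · intro j
    refine Eventually.of_forall fun x => ?_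
    by_cases hx1 : x ∈ tsupport w
    · by_cases hx2 : D x ≤ δ'
      · rw [indicator_of_mem (show x ∈ sublevel D U δ' from ⟨hU hx1, hx2⟩), norm_mul]
        have : ‖cutoff δ (ε j) (D x)‖ ≤ 1 := by
          rw [Real.norm_of_nonneg (cutoff_nonneg _ _ _)]; exact cutoff_le_one _ _ _
        exact mul_le_of_le_one_left (norm_nonneg _) this
      · rw [cutoff_eq_zero (hε j) (by linarith [hle j])]; simp
    · simp [h0 x hx1]
  · refine Eventually.of_forall fun x => ?_
    by_cases hx1 : x ∈ tsupport w
    · by_cases hx2 : D x ≤ δ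
      · rw [indicator_of_mem (show x ∈ sublevel D U δ from ⟨hU hx1, hx2⟩)]
        simp [cutoff_eq_one (hε _) hx2]
      · rw [indicator_of_notMem (fun h2 => hx2 h2.2)]
        refine tendsto_const_nhds.congr' ?_
        filter_upwards [hε0.eventually (gt_mem_nhds (show 0 < D x - δ by linarith))] with j hj
        rw [cutoff_eq_zero (hε j) (by linarith)]; simp
    · rw [h0 x hx1]
      have : (sublevel D U δ).indicator f x = 0 := by
        by_cases hx2 : x ∈ sublevel D U δ
        · rw [indicator_of_mem hx2, h0 x hx1]
        · rw [indicator_of_notMem hx2]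
      simp [this]

/-- Widths of the cutoffs used to approximate the indicator of `(-∞, δ]`. -/
lemma exists_cutoff_widths (hδ : δ < r) : ∃ ε : ℕ → ℝ, (∀ j, 0 < ε j) ∧
    (∃ δ' < r, ∀ j, δ + ε j ≤ δ') ∧ Tendsto ε atTop (𝓝 0) := by
  refine ⟨fun j => (r - δ) / 2 * (1 / ((j : ℝ) + 1)), fun j => ?_,
    ⟨(δ + r) / 2, by linarith, ?_⟩, ?_⟩
  · have : 0 < r - δ := by linarith
    positivity
  · intro j
    have h1 : 1 / ((j : ℝ) + 1) ≤ 1 := by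
      rw [div_le_one (by positivity)]; linarith [(Nat.cast_nonneg j : (0 : ℝ) ≤ j)]
    nlinarith
  · simpa using tendsto_one_div_add_atTop_nhds_zero_nat.const_mul ((r - δ) / 2)

lemma contDiffAt_mul_rpow {χ : ℝ → ℝ} (hχ : ContDiff ℝ ∞ χ) (b : ℝ) {t : ℝ} (ht : 0 < t) :
    ContDiffAt ℝ 1 (fun t => χ t * t ^ b) t :=
  (hχ.contDiffAt.of_le (by exact_mod_cast le_top)).mul
    (Real.contDiffAt_rpow_const_of_ne ht.ne')

lemma deriv_mul_rpow {χ : ℝ → ℝ} (hχ : ContDiff ℝ ∞ χ) (b : ℝ) {t : ℝ} (ht : 0 < t) :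
    deriv (fun t => χ t * t ^ b) t = deriv χ t * t ^ b + χ t * (b * t ^ (b - 1)) := by
  have h1 : DifferentiableAt ℝ χ t := hχ.differentiable (by simp) t
  exact (h1.hasDerivAt.mul (Real.hasDerivAt_rpow_const (Or.inl ht.ne'))).deriv

/-- The shell integral `∫ -χ'(D) D ^ b w` of a cutoff `χ`, expressed as a volume integral. -/
lemma IsEikonal.integral_shell (h : IsEikonal D U r) (hw : ContDiff ℝ 1 w)
    (hc : HasCompactSupport w) (hU : tsupport w ⊆ U) {ε : ℝ} (hε : 0 < ε) (hr : δ + ε < r) (b : ℝ) :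
    Integrable (fun x => -deriv (cutoff δ ε) (D x) * (D x ^ b * w x)) ∧
    ∫ x, -deriv (cutoff δ ε) (D x) * (D x ^ b * w x) =
      ∫ x, cutoff δ ε (D x) * (b * D x ^ (b - 1) * w x + D x ^ b * divGrad D w x) := by
  have hz := h.integral_div_eq_zero hw hc hU (ξ := fun t => cutoff δ ε t * t ^ b)
    (fun t ht => contDiffAt_mul_rpow (contDiff_cutoff δ ε) b ht) hr
    (fun t ht => by simp [cutoff_eq_zero hε ht])
  have hS : IsCompact (tsupport w ∩ {x | D x ≤ δ + ε}) :=
    hc.isCompact.inter_right (isClosed_le h.continuous continuous_const)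
  have hcd : Continuous (deriv (cutoff δ ε)) := (contDiff_cutoff δ ε).continuous_deriv (by simp)
  have hpow : ∀ (a : ℝ), ∀ x ∈ U, ContinuousAt (fun x => D x ^ a) x := fun a x hx =>
    h.continuous.continuousAt.rpow_const (Or.inl (h.pos x hx).ne')
  have hint : ∀ f : E n → ℝ, (∀ x ∈ U, D x < r → ContinuousAt f x) →
      (∀ x, x ∉ tsupport w → f x = 0) → (∀ x, δ + ε ≤ D x → f x = 0) → Integrable f := by
    intro f hf h0 h1
    refine integrable_of_continuousOn_of_zero hS
      (fun x hx => (hf x (hU hx.1) (lt_of_le_of_lt hx.2 hr)).continuousWithinAt) fun x hx => ?_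
    by_cases hx1 : x ∈ tsupport w
    · exact h1 x (le_of_lt (not_le.1 fun h2 => hx ⟨hx1, h2⟩))
    · exact h0 x hx1
  have i1 : Integrable (fun x => -deriv (cutoff δ ε) (D x) * (D x ^ b * w x)) := by
    refine hint _ (fun x hx _ => ?_) (fun x hx => by simp [image_eq_zero_of_notMem_tsupport hx])
      (fun x hx => by simp [deriv_cutoff_of_ge hε hx])
    exact ((hcd.comp h.continuous).neg.continuousAt).mul
      ((hpow b x hx).mul hw.continuous.continuousAt)
  have i2 : Integrable (fun x => cutoff δ ε (D x) *
      (b * D x ^ (b - 1) * w x + D x ^ b * divGrad D w x)) := by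
    refine hint _ (fun x hx hxr => ?_) (fun x hx => by
      simp [image_eq_zero_of_notMem_tsupport hx, divGrad_eq_zero hx])
      (fun x hx => by simp [cutoff_eq_zero hε hx])
    exact (((contDiff_cutoff δ ε).continuous.comp h.continuous).continuousAt).mul
      (((continuousAt_const.mul (hpow _ x hx)).mul hw.continuous.continuousAt).add
        ((hpow b x hx).mul (continuousAt_divGrad hw (h.contDiffAt x hx hxr))))
  refine ⟨i1, ?_⟩
  rw [← sub_eq_zero, ← integral_sub i1 i2, ← neg_eq_zero, ← integral_neg]
  rw [← hz]
  congr 1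
  funext x
  by_cases hx : x ∈ tsupport w
  · rw [deriv_mul_rpow (contDiff_cutoff δ ε) b (h.pos x (hU hx))]; ring
  · simp [image_eq_zero_of_notMem_tsupport hx, divGrad_eq_zero hx]

end Flux

end Eikonal

/-! ### The flux through a level set, and Sobolev's inequality on a sublevel set -/

section FluxSobolev

variable {n : ℕ} {D : E n → ℝ} {U : Set (E n)} {r δ : ℝ} {w : E n → ℝ}

lemma continuousAt_rpow_comp (h : IsEikonal D U r) (a : ℝ) {x : E n} (hx : x ∈ U) :
    ContinuousAt (fun x => D x ^ a) x :=
  h.continuous.continuousAt.rpow_const (Or.inl (h.pos x hx).ne')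

/-- The flux is the limit of integrals over shrinking shells. -/
lemma IsEikonal.tendsto_integral_shell (h : IsEikonal D U r) (hw : ContDiff ℝ 1 w)
    (hc : HasCompactSupport w) (hU : tsupport w ⊆ U) {ε : ℕ → ℝ} (hε : ∀ j, 0 < ε j)
    (hεr : ∃ δ' < r, ∀ j, δ + ε j ≤ δ') (hε0 : Tendsto ε atTop (𝓝 0)) (b : ℝ) :
    Tendsto (fun j => ∫ x, -deriv (cutoff δ (ε j)) (D x) * (D x ^ b * w x)) atTop
      (𝓝 (∫ x in sublevel D U δ, (b * D x ^ (b - 1) * w x + D x ^ b * divGrad D w x))) := by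
  have h1 := (h.tendsto_integral_cutoff (δ := δ) hc hU hε hεr hε0
    (f := fun x => b * D x ^ (b - 1) * w x + D x ^ b * divGrad D w x)
    (fun x hx hxr => ((continuousAt_const.mul (continuousAt_rpow_comp h _ hx)).mul
      hw.continuous.continuousAt).add ((continuousAt_rpow_comp h b hx).mul
        (continuousAt_divGrad hw (h.contDiffAt x hx hxr))))
    (fun x hx => by simp [image_eq_zero_of_notMem_tsupport hx, divGrad_eq_zero hx])).2
  obtain ⟨δ', hδ', hle⟩ := hεr
  refine h1.congr fun j => ?_
  rw [(h.integral_shell hw hc hU (hε j) (lt_of_le_of_lt (hle j) hδ') b).2]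

lemma abs_rpow_sub_rpow_le {δ ε t : ℝ} (hδ : 0 < δ) (h1 : δ ≤ t) (h2 : t ≤ δ + ε) (b : ℝ) :
    |t ^ b - δ ^ b| ≤ |(δ + ε) ^ b - δ ^ b| := by
  rcases le_total 0 b with hb | hb
  · have e1 := Real.rpow_le_rpow hδ.le h1 hb
    have e2 := Real.rpow_le_rpow (hδ.le.trans h1) h2 hb
    rw [abs_of_nonneg (by linarith), abs_of_nonneg (by linarith)]; linarith
  · have e1 := Real.rpow_le_rpow_of_nonpos hδ h1 hb
    have e2 := Real.rpow_le_rpow_of_nonpos (hδ.trans_le h1) h2 hb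
    rw [abs_of_nonpos (by linarith), abs_of_nonpos (by linarith)]; linarith

lemma IsEikonal.tendsto_integral_shell_flux (h : IsEikonal D U r) (hw : ContDiff ℝ 1 w)
    (hc : HasCompactSupport w) (hU : tsupport w ⊆ U) {ε : ℕ → ℝ} (hε : ∀ j, 0 < ε j)
    (hεr : ∃ δ' < r, ∀ j, δ + ε j ≤ δ') (hε0 : Tendsto ε atTop (𝓝 0)) :
    Tendsto (fun j => ∫ x, -deriv (cutoff δ (ε j)) (D x) * w x) atTop (𝓝 (flux D U δ w)) := by
  simpa [flux] using h.tendsto_integral_shell hw hc hU hε hεr hε0 0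

lemma IsEikonal.flux_nonneg (h : IsEikonal D U r) (hδr : δ < r) (hw : ContDiff ℝ 1 w)
    (hc : HasCompactSupport w) (hU : tsupport w ⊆ U) (hw0 : ∀ x, 0 ≤ w x) : 0 ≤ flux D U δ w := by
  obtain ⟨ε, hε, hεr, hε0⟩ := exists_cutoff_widths hδr
  refine ge_of_tendsto' (h.tendsto_integral_shell_flux hw hc hU hε hεr hε0) fun j => ?_
  exact integral_nonneg fun x =>
    mul_nonneg (neg_nonneg.2 (deriv_cutoff_nonpos (hε j))) (hw0 x)

/-- There is no flux through `{D = δ}` if `w` is supported in `{D ≤ δ}`. -/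
lemma IsEikonal.flux_eq_zero (h : IsEikonal D U r) (hδr : δ < r) (hw : ContDiff ℝ 1 w)
    (hc : HasCompactSupport w) (hU : tsupport w ⊆ U) (hw0 : ∀ x, δ < D x → w x = 0) :
    flux D U δ w = 0 := by
  obtain ⟨ε, hε, hεr, hε0⟩ := exists_cutoff_widths hδr
  refine tendsto_nhds_unique (h.tendsto_integral_shell_flux hw hc hU hε hεr hε0) ?_
  refine tendsto_const_nhds.congr fun j => ?_
  rw [← integral_zero (E n) ℝ]
  congr 1
  funext x
  rcases le_or_gt (D x) δ with hx | hx
  · simp [deriv_cutoff_of_le (hε j) hx]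
  · simp [hw0 x hx]

/-- On `{D = δ}` the weight `D ^ b` is the constant `δ ^ b`. -/
lemma IsEikonal.integral_rpow_flux (h : IsEikonal D U r) (hδ : 0 < δ) (hδr : δ < r)
    (hw : ContDiff ℝ 1 w)
    (hc : HasCompactSupport w) (hU : tsupport w ⊆ U) (hw0 : ∀ x, 0 ≤ w x) (b : ℝ) :
    ∫ x in sublevel D U δ, (b * D x ^ (b - 1) * w x + D x ^ b * divGrad D w x) =
      δ ^ b * flux D U δ w := by
  obtain ⟨ε, hε, hεr, hε0⟩ := exists_cutoff_widths hδr
  have t1 := h.tendsto_integral_shell hw hc hU hε hεr hε0 b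
  have t2 := h.tendsto_integral_shell_flux hw hc hU hε hεr hε0
  have t3 := t1.sub (t2.const_mul (δ ^ b))
  rw [← sub_eq_zero]
  refine tendsto_nhds_unique t3 ?_
  have t4 : Tendsto (fun j => |(δ + ε j) ^ b - δ ^ b| *
      ∫ x, -deriv (cutoff δ (ε j)) (D x) * w x) atTop (𝓝 0) := by
    have : Tendsto (fun j => |(δ + ε j) ^ b - δ ^ b|) atTop (𝓝 0) := by
      have h1 : Tendsto (fun j => δ + ε j) atTop (𝓝 δ) := by simpa using hε0.const_add δ
      have h2 := h1.rpow_const (p := b) (Or.inl hδ.ne')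
      simpa using (h2.sub_const (δ ^ b)).abs
    simpa using this.mul t2
  refine squeeze_zero_norm (fun j => ?_) t4
  obtain ⟨δ', hδ', hle⟩ := hεr
  have i1 := (h.integral_shell hw hc hU (hε j) (lt_of_le_of_lt (hle j) hδ') b).1
  have i2 : Integrable (fun x => -deriv (cutoff δ (ε j)) (D x) * w x) := by
    simpa using (h.integral_shell hw hc hU (hε j) (lt_of_le_of_lt (hle j) hδ') 0).1
  rw [← integral_const_mul, ← integral_sub i1 (i2.const_mul _), ← integral_const_mul]
  refine norm_integral_le_of_norm_le (i2.const_mul _) (Eventually.of_forall fun x => ?_)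
  have h0 : 0 ≤ -deriv (cutoff δ (ε j)) (D x) := neg_nonneg.2 (deriv_cutoff_nonpos (hε j))
  rw [show -deriv (cutoff δ (ε j)) (D x) * (D x ^ b * w x) -
      δ ^ b * (-deriv (cutoff δ (ε j)) (D x) * w x) =
      (D x ^ b - δ ^ b) * (-deriv (cutoff δ (ε j)) (D x) * w x) by ring, norm_mul,
    Real.norm_of_nonneg (mul_nonneg h0 (hw0 x)), Real.norm_eq_abs]
  rcases le_or_gt (D x) δ with hx | hx
  · simp [deriv_cutoff_of_le (hε j) hx]
  rcases le_or_gt (δ + ε j) (D x) with hx2 | hx2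
  · simp [deriv_cutoff_of_ge (hε j) hx2]
  exact mul_le_mul_of_nonneg_right (abs_rpow_sub_rpow_le hδ hx.le hx2.le b)
    (mul_nonneg h0 (hw0 x))

/-- The Gagliardo–Nirenberg–Sobolev inequality for the exponent `1`, in terms of integrals. -/
lemma exists_sobolev_const (hn : 2 ≤ n) : ∃ S : ℝ, 0 < S ∧ ∀ g : E n → ℝ, ContDiff ℝ 1 g →
    HasCompactSupport g →
    (∫ x, |g x| ^ ((n : ℝ) / (n - 1))) ^ (((n : ℝ) - 1) / n) ≤ S * ∫ x, ‖gradient g x‖ := by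
  have hn' : (2 : ℝ) ≤ n := by exact_mod_cast hn
  have hpr : (0 : ℝ) ≤ n / (n - 1) := div_nonneg (by linarith) (by linarith)
  set p : NNReal := ⟨(n : ℝ) / (n - 1), hpr⟩ with hp
  have hpos : (0 : ℝ) < n / (n - 1) := div_pos (by linarith) (by linarith)
  have hconj : NNReal.HolderConjugate (Module.finrank ℝ (E n)) p := by
    rw [← NNReal.holderConjugate_coe_iff]
    simp only [finrank_euclideanSpace, Fintype.card_fin, NNReal.coe_natCast]
    exact Real.HolderConjugate.conjExponent (by linarith : (1 : ℝ) < n)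
  set C := eLpNormLESNormFDerivOneConst (volume : Measure (E n)) p
  refine ⟨C + 1, by positivity, fun g hg hc => ?_⟩
  have hs : _ ≤ (C : ENNReal) * _ := eLpNorm_le_eLpNorm_fderiv_one volume hg hc hconj
  have m1 : MemLp g p volume := hg.continuous.memLp_of_hasCompactSupport hc
  have m2 : MemLp (fderiv ℝ g) 1 volume :=
    (hg.continuous_fderiv (by norm_num)).memLp_of_hasCompactSupport (hc.fderiv ℝ)
  have hpne : (p : ENNReal) ≠ 0 := by
    intro h0
    have : p = 0 := by exact_mod_cast h0
    have : (p : ℝ) = 0 := by rw [this]; rfl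
    exact hpos.ne' this
  rw [m1.eLpNorm_eq_integral_rpow_norm hpne ENNReal.coe_ne_top,
    m2.eLpNorm_eq_integral_rpow_norm one_ne_zero ENNReal.one_ne_top] at hs
  rw [← ENNReal.ofReal_coe_nnreal (p := C), ← ENNReal.ofReal_mul C.coe_nonneg,
    ENNReal.ofReal_le_ofReal_iff (by positivity)] at hs
  have e1 : (p : ENNReal).toReal = (n : ℝ) / (n - 1) := rfl
  have e2 : ∀ x, ‖gradient g x‖ = ‖fderiv ℝ g x‖ := by
    intro x; simp [gradient]
  rw [e1] at hs
  simp only [Real.norm_eq_abs, ENNReal.toReal_one, Real.rpow_one, inv_one, inv_div] at hs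
  simp_rw [e2]
  refine hs.trans ?_
  gcongr
  linarith

/-- The weighted Sobolev inequality on a sublevel set, for functions which need not vanish on its
boundary. The boundary term is the flux: the cutoffs `χ` of the sublevel set have
`∫ |∇χ(D)| D ^ b w → δ ^ b flux w`. -/
lemma exists_sobolev_sublevel_const (hn : 2 ≤ n) : ∃ S : ℝ, 0 < S ∧
    ∀ (D : E n → ℝ) (U : Set (E n)) (r δ : ℝ) (w : E n → ℝ), IsEikonal D U r → 0 < δ → δ < r →
    ContDiff ℝ 1 w → HasCompactSupport w → tsupport w ⊆ U → (∀ x, 0 ≤ w x) → ∀ b : ℝ,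
    (∫ x in sublevel D U δ, (D x ^ b * w x) ^ ((n : ℝ) / (n - 1))) ^ (((n : ℝ) - 1) / n) ≤
      S * ((∫ x in sublevel D U δ,
        ‖(b * D x ^ (b - 1) * w x) • gradient D x + D x ^ b • gradient w x‖) +
          δ ^ b * flux D U δ w) := by
  obtain ⟨S, hS, hsob⟩ := exists_sobolev_const hn
  have hn' : (2 : ℝ) ≤ n := by exact_mod_cast hn
  have hpos : (0 : ℝ) < n / (n - 1) := div_pos (by linarith) (by linarith)
  refine ⟨S, hS, fun D U r δ w h hδ hδr hw hc hU hw0 b => ?_⟩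
  obtain ⟨ε, hε, hεr, hε0⟩ := exists_cutoff_widths hδr
  set G : E n → E n := fun x =>
    (b * D x ^ (b - 1) * w x) • gradient D x + D x ^ b • gradient w x with hG
  have hGc : ∀ x ∈ U, D x < r → ContinuousAt G x := by
    intro x hx hxr
    have := continuousAt_rpow_comp h b hx
    have := continuousAt_rpow_comp h (b - 1) hx
    have := hw.continuous.continuousAt (x := x)
    have := continuousAt_gradient (hw.contDiffAt (x := x))
    have := continuousAt_gradient
      ((h.contDiffAt x hx hxr).of_le (by norm_num : (1 : WithTop ℕ∞) ≤ 2))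
    fun_prop
  have hG0 : ∀ x, x ∉ tsupport w → G x = 0 := by
    intro x hx
    simp [hG, image_eq_zero_of_notMem_tsupport hx, gradient_eq_zero_of_notMem_tsupport hx]
  have c1 := h.tendsto_integral_cutoff (δ := δ) hc hU hε hεr hε0 (f := fun x => ‖G x‖)
    (fun x hx hxr => (hGc x hx hxr).norm) (fun x hx => by simp [hG0 x hx])
  have c2 := h.tendsto_integral_shell hw hc hU hε hεr hε0 b
  rw [h.integral_rpow_flux hδ hδr hw hc hU hw0 b] at c2
  refine ge_of_tendsto' ((c1.2.add c2).const_mul S) fun j => ?_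
  obtain ⟨δ', hδ', hle⟩ := hεr
  have hjr : δ + ε j < r := lt_of_le_of_lt (hle j) hδ'
  set χ := cutoff δ (ε j) with hχ
  have hξ : ∀ t, 0 < t → ContDiffAt ℝ 1 (fun t => χ t * t ^ b) t := fun t ht =>
    contDiffAt_mul_rpow (contDiff_cutoff δ (ε j)) b ht
  have hξ0 : ∀ t, δ + ε j ≤ t → (fun t => χ t * t ^ b) t = 0 := fun t ht => by
    simp [hχ, cutoff_eq_zero (hε j) ht]
  have hg := h.contDiff_comp_mul hw hU hξ hjr hξ0
  have hgs := h.tsupport_comp_mul (w := w) hξ0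
  have hgc : HasCompactSupport (fun y => (fun t => χ t * t ^ b) (D y) * w y) :=
    hc.of_isClosed_subset (isClosed_tsupport _) (hgs.trans inter_subset_left)
  have hs := hsob _ hg hgc
  have i1 : Integrable (fun x => |(fun t => χ t * t ^ b) (D x) * w x| ^ ((n : ℝ) / (n - 1))) := by
    have hcont : Continuous
        (fun x => |(fun t => χ t * t ^ b) (D x) * w x| ^ ((n : ℝ) / (n - 1))) :=
      hg.continuous.abs.rpow_const fun x => Or.inr hpos.le
    refine hcont.integrable_of_hasCompactSupport (hgc.mono' fun x hx => subset_tsupport _ ?_)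
    intro h0
    apply hx
    simp only at h0
    simp only [h0, abs_zero, Real.zero_rpow hpos.ne']
  have i2 := (h.integral_shell hw hc hU (hε j) hjr b).1
  have l1 : ∫ x in sublevel D U δ, (D x ^ b * w x) ^ ((n : ℝ) / (n - 1)) ≤
      ∫ x, |(fun t => χ t * t ^ b) (D x) * w x| ^ ((n : ℝ) / (n - 1)) := by
    refine le_trans (le_of_eq ?_) (setIntegral_le_integral (s := sublevel D U δ) i1
      (Eventually.of_forall fun x => by positivity))
    refine setIntegral_congr_fun (h.measurableSet_sublevel δ) fun x hx => ?_
    have : 0 ≤ D x ^ b * w x := mul_nonneg (Real.rpow_nonneg (h.pos x hx.1).le _) (hw0 x)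
    simp only [hχ, cutoff_eq_one (hε j) hx.2, one_mul, abs_of_nonneg this]
  have l2 : ∫ x, ‖gradient (fun y => (fun t => χ t * t ^ b) (D y) * w y) x‖ ≤
      (∫ x, χ (D x) * ‖G x‖) + ∫ x, -deriv χ (D x) * (D x ^ b * w x) := by
    rw [← integral_add (c1.1 j) i2]
    refine integral_mono_of_nonneg (Eventually.of_forall fun x => norm_nonneg _)
      ((c1.1 j).add i2) (Eventually.of_forall fun x => ?_)
    have hn1 : 0 ≤ χ (D x) := cutoff_nonneg _ _ _
    have hn2 : 0 ≤ -deriv χ (D x) := neg_nonneg.2 (deriv_cutoff_nonpos (hε j))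
    by_cases hx : x ∈ tsupport (fun y => (fun t => χ t * t ^ b) (D y) * w y)
    · have hxU := hU (hgs hx).1
      have hxr : D x < r := lt_of_le_of_lt (hgs hx).2 hjr
      have hx0 := h.pos x hxU
      show ‖gradient (fun y => (fun t => χ t * t ^ b) (D y) * w y) x‖ ≤ _
      rw [gradient_comp_mul ((hξ _ hx0).differentiableAt (by norm_num))
        (h.differentiableAt hxU hxr) (hw.differentiable (by norm_num) x),
        deriv_mul_rpow (contDiff_cutoff δ (ε j)) b hx0]
      have e : ((deriv χ (D x) * D x ^ b + χ (D x) * (b * D x ^ (b - 1))) * w x) • gradient D x +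
          (χ (D x) * D x ^ b) • gradient w x =
          χ (D x) • G x + (deriv χ (D x) * (D x ^ b * w x)) • gradient D x := by
        simp only [hG, smul_add, smul_smul]
        rw [add_right_comm, ← add_smul]
        congr 2
        ring
      rw [e]
      refine (norm_add_le _ _).trans (le_of_eq ?_)
      rw [norm_smul, norm_smul, h.norm_gradient x hxU hxr, Real.norm_of_nonneg hn1, norm_mul,
        Real.norm_of_nonneg (mul_nonneg (Real.rpow_nonneg hx0.le _) (hw0 x)),
        ← norm_neg (deriv χ (D x)),
        Real.norm_of_nonneg hn2]
      simp [χ]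
    · show ‖gradient (fun y => (fun t => χ t * t ^ b) (D y) * w y) x‖ ≤ _
      rw [gradient_eq_zero_of_notMem_tsupport hx, norm_zero]
      refine add_nonneg (mul_nonneg hn1 (norm_nonneg _)) ?_
      by_cases hxw : x ∈ tsupport w
      · exact mul_nonneg hn2 (mul_nonneg (Real.rpow_nonneg (h.pos x (hU hxw)).le _) (hw0 x))
      · simp [image_eq_zero_of_notMem_tsupport hxw]
  calc _ ≤ (∫ x, |(fun t => χ t * t ^ b) (D x) * w x| ^ ((n : ℝ) / (n - 1))) ^
        (((n : ℝ) - 1) / n) := by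
        refine Real.rpow_le_rpow ?_ l1 (div_nonneg (by linarith) (by linarith))
        exact setIntegral_nonneg (h.measurableSet_sublevel δ) fun x hx => Real.rpow_nonneg
          (mul_nonneg (Real.rpow_nonneg (h.pos x hx.1).le _) (hw0 x)) _
    _ ≤ S * ∫ x, ‖gradient (fun y => (fun t => χ t * t ^ b) (D y) * w y) x‖ := hs
    _ ≤ _ := by gcongr

end FluxSobolev

/-! ### Tubular functions and the ground state estimate -/

section Tubular

variable {n : ℕ} {D : E n → ℝ} {U : Set (E n)} {r δ : ℝ} {u : E n → ℝ}

section AbsRpow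

lemma contDiff_abs_rpow_comp {s : ℝ} (hs : 1 < s) (hu : ContDiff ℝ 1 u) :
    ContDiff ℝ 1 (fun x => |u x| ^ s) := by
  have := (contDiff_norm_rpow (E := ℝ) hs).comp hu
  simpa [Function.comp_def, Real.norm_eq_abs] using this

lemma gradient_abs_rpow {s : ℝ} (hs : 1 < s) {x : E n} (hu : DifferentiableAt ℝ u x) :
    gradient (fun x => |u x| ^ s) x = (s * |u x| ^ (s - 2) * u x) • gradient u x := by
  have h := ((hasDerivAt_abs_rpow (u x) hs).comp_hasFDerivAt x hu.hasFDerivAt).fderiv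
  unfold gradient
  rw [show (fun x => |u x| ^ s) = (fun x => |x| ^ s) ∘ u from rfl, h, map_smul]

lemma tsupport_abs_rpow {s : ℝ} (hs : 0 < s) : tsupport (fun x => |u x| ^ s) ⊆ tsupport u := by
  refine closure_mono fun x hx h0 => hx ?_
  simp [h0, Real.zero_rpow hs.ne']

lemma hasCompactSupport_abs_rpow {s : ℝ} (hs : 0 < s) (hc : HasCompactSupport u) :
    HasCompactSupport (fun x => |u x| ^ s) :=
  hc.of_isClosed_subset (isClosed_tsupport _) (tsupport_abs_rpow hs)

lemma abs_rpow_sub_two_mul_sq {s : ℝ} (hs : 1 < s) (a : ℝ) : |a| ^ (s - 2) * a * a = |a| ^ s := by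
  rcases eq_or_ne a 0 with rfl | ha
  · simp [Real.zero_rpow (show s ≠ 0 by linarith)]
  · have h0 : 0 < |a| := abs_pos.2 ha
    have : a * a = |a| ^ (2 : ℝ) := by
      rw [show (2 : ℝ) = ((2 : ℕ) : ℝ) by norm_num, Real.rpow_natCast, sq_abs, sq]
    rw [mul_assoc, this, ← Real.rpow_add h0]
    congr 1; ring

lemma abs_abs_rpow_sub_two_mul {s : ℝ} (hs : 1 < s) (a : ℝ) :
    |(|a| ^ (s - 2) * a)| = |a| ^ (s - 1) := by
  rcases eq_or_ne a 0 with rfl | ha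
  · simp [Real.zero_rpow (show s - 1 ≠ 0 by linarith)]
  · have h0 : 0 < |a| := abs_pos.2 ha
    rw [abs_mul, abs_of_nonneg (by positivity)]
    nth_rewrite 2 [← Real.rpow_one |a|]
    rw [← Real.rpow_add h0]
    congr 1; ring

end AbsRpow

/-- The remainder `∇u - H (u / D) ∇D`: it equals `D ^ H ∇v` for the ground state substitution
`u = D ^ H v`. -/
noncomputable def remainder (H : ℝ) (D u : E n → ℝ) (x : E n) : E n :=
  gradient u x - (H * u x / D x) • gradient D x

lemma remainder_eq_zero (H : ℝ) {x : E n} (hx : x ∉ tsupport u) : remainder H D u x = 0 := by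
  simp [remainder, gradient_eq_zero_of_notMem_tsupport hx, image_eq_zero_of_notMem_tsupport hx]

lemma IsEikonal.continuousAt_remainder (h : IsEikonal D U r) (H : ℝ) (hu : ContDiff ℝ 1 u) {x : E n}
    (hx : x ∈ U) (hr : D x < r) : ContinuousAt (remainder H D u) x := by
  have h1 := continuousAt_gradient (hu.contDiffAt (x := x))
  have h2 := continuousAt_gradient
    ((h.contDiffAt x hx hr).of_le (by norm_num : (1 : WithTop ℕ∞) ≤ 2))
  have h3 := hu.continuous.continuousAt (x := x)
  have h4 := h.continuous.continuousAt (x := x)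
  have h5 := (h.pos x hx).ne'
  unfold remainder
  exact h1.sub (((continuousAt_const.mul h3).div h4 h5).smul h2)

lemma IsEikonal.integrableOn_rpow_mul (h : IsEikonal D U r) (hδ : δ < r) (hu : ContDiff ℝ 1 u)
    (hc : HasCompactSupport u) (hU : tsupport u ⊆ U) (a : ℝ) {s : ℝ} (hs : 0 < s) :
    IntegrableOn (fun x => D x ^ a * |u x| ^ s) (sublevel D U δ) := by
  refine h.integrableOn hδ hc hU (fun x hx _ => ?_) (fun x hx => ?_)
  · exact (continuousAt_rpow_comp h a hx).mul
      (hu.continuous.abs.continuousAt.rpow_const (Or.inr hs.le))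
  · simp [image_eq_zero_of_notMem_tsupport hx, Real.zero_rpow hs.ne']

lemma IsEikonal.integrableOn_rpow_mul_remainder (h : IsEikonal D U r) (hδ : δ < r)
    (hu : ContDiff ℝ 1 u) (hc : HasCompactSupport u) (hU : tsupport u ⊆ U) (H a : ℝ) {s t : ℝ}
    (hs : 0 ≤ s) (ht : 0 < t) :
    IntegrableOn (fun x => D x ^ a * |u x| ^ s * ‖remainder H D u x‖ ^ t) (sublevel D U δ) := by
  refine h.integrableOn hδ hc hU (fun x hx hr => ?_) (fun x hx => ?_)
  · exact ((continuousAt_rpow_comp h a hx).mul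
      (hu.continuous.abs.continuousAt.rpow_const (Or.inr hs))).mul
        ((h.continuousAt_remainder H hu hx hr).norm.rpow_const (Or.inr ht.le))
  · simp [remainder_eq_zero H hx, Real.zero_rpow ht.ne']

lemma IsEikonal.integrableOn_div (h : IsEikonal D U r) (hδ : δ < r) {w : E n → ℝ}
    (hw : ContDiff ℝ 1 w) (hc : HasCompactSupport w) (hU : tsupport w ⊆ U) (b : ℝ) :
    IntegrableOn (fun x => b * D x ^ (b - 1) * w x + D x ^ b * divGrad D w x)
      (sublevel D U δ) :=
  h.integrableOn hδ hc hU
    (fun x hx hxr => ((continuousAt_const.mul (continuousAt_rpow_comp h _ hx)).mul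
      hw.continuous.continuousAt).add ((continuousAt_rpow_comp h b hx).mul
        (continuousAt_divGrad hw (h.contDiffAt x hx hxr))))
    (fun x hx => by simp [image_eq_zero_of_notMem_tsupport hx, divGrad_eq_zero hx])

/-- The divergence of `D ^ b |u| ^ s ∇D`, in terms of the remainder `∇u - H (u / D) ∇D`. -/
lemma IsEikonal.div_eq (h : IsEikonal D U r) (hu : ContDiff ℝ 1 u) (H b k : ℝ) {s : ℝ} (hs : 1 < s)
    {x : E n} (hx : x ∈ U) (hr : D x < r) :
    b * D x ^ (b - 1) * |u x| ^ s + D x ^ b * divGrad D (fun x => |u x| ^ s) x =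
      (b + s * H + k - 1) * (D x ^ (b - 1) * |u x| ^ s) +
      (D x * Laplacian.laplacian D x + 1 - k) * (D x ^ (b - 1) * |u x| ^ s) +
      s * D x ^ b * (|u x| ^ (s - 2) * u x) * inner ℝ (remainder H D u x) (gradient D x) := by
  have h0 := h.pos x hx
  have e1 : D x ^ b = D x ^ (b - 1) * D x := by
    rw [Real.rpow_sub_one h0.ne']; field_simp
  have e2 : inner ℝ (gradient u x) (gradient D x) =
      inner ℝ (remainder H D u x) (gradient D x) + H * u x / D x := by
    rw [remainder, inner_sub_left, inner_smul_left, real_inner_self_eq_norm_sq,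
      h.norm_gradient x hx hr]
    simp
  have e3 := abs_rpow_sub_two_mul_sq hs (u x)
  rw [divGrad, gradient_abs_rpow hs (hu.differentiable (by norm_num) x), inner_smul_left, e2, e1]
  simp only [conj_trivial]
  have e4 : s * |u x| ^ (s - 2) * u x * (inner ℝ (remainder H D u x) (gradient D x) +
      H * u x / D x) = s * (|u x| ^ (s - 2) * u x) * inner ℝ (remainder H D u x) (gradient D x) +
      s * H / D x * |u x| ^ s := by
    rw [← e3]; ring
  rw [e4]
  have e5 : D x ^ (b - 1) * D x * (s * H / D x * |u x| ^ s) =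
      s * H * (D x ^ (b - 1) * |u x| ^ s) := by
    field_simp
  linear_combination e5

/-- `D` is an eikonal function whose level sets have the mean curvature of a tube around a surface
of codimension `k`, up to a bounded error: `|D ΔD + 1 - k| ≤ c D`. -/
structure IsTubular (k c : ℝ) (D : E n → ℝ) (U : Set (E n)) (r : ℝ) : Prop
    extends IsEikonal D U r where
  abs_laplacian_le : ∀ x ∈ U, D x < r → |D x * Laplacian.laplacian D x + 1 - k| ≤ c * D x

variable {k c : ℝ}

/-- The divergence theorem for `D ^ b |u| ^ s ∇D`, as a comparison between the flux and a weighted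
volume integral. -/
lemma IsTubular.abs_integral_sub_flux_le (h : IsTubular k c D U r) (hδ : 0 < δ) (hδr : δ < r)
    (hu : ContDiff ℝ 1 u) (hc : HasCompactSupport u) (hU : tsupport u ⊆ U) (H b : ℝ) {s : ℝ}
    (hs : 1 < s) :
    |(b + s * H + k - 1) * (∫ x in sublevel D U δ, D x ^ (b - 1) * |u x| ^ s) -
        δ ^ b * flux D U δ (fun x => |u x| ^ s)| ≤
      c * (∫ x in sublevel D U δ, D x ^ b * |u x| ^ s) +
        s * ∫ x in sublevel D U δ, D x ^ b * |u x| ^ (s - 1) * ‖remainder H D u x‖ := by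
  have hs0 : 0 < s := by linarith
  have hw := contDiff_abs_rpow_comp hs hu
  have hwc := hasCompactSupport_abs_rpow hs0 hc
  have hwU := (tsupport_abs_rpow (u := u) hs0).trans hU
  have hfl := h.integral_rpow_flux hδ hδr hw hwc hwU (fun x => by positivity) b
  have hF := h.integrableOn_div hδr hw hwc hwU b
  have i1 := h.integrableOn_rpow_mul hδr hu hc hU (b - 1) hs0
  have i2 := h.integrableOn_rpow_mul hδr hu hc hU b hs0
  have i3 : IntegrableOn (fun x => D x ^ b * |u x| ^ (s - 1) * ‖remainder H D u x‖)
      (sublevel D U δ) := by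
    simpa using h.integrableOn_rpow_mul_remainder hδr hu hc hU H b (s := s - 1) (t := 1)
      (by linarith) one_pos
  rw [← hfl, ← integral_const_mul, ← integral_const_mul, ← integral_const_mul,
    ← integral_sub (i1.const_mul _) hF, ← integral_add (i2.const_mul _) (i3.const_mul _)]
  rw [← Real.norm_eq_abs]
  refine (norm_integral_le_of_norm_le (g := fun x => c * (D x ^ b * |u x| ^ s) +
    s * (D x ^ b * |u x| ^ (s - 1) * ‖remainder H D u x‖))
    ((i2.const_mul c).add (i3.const_mul s)) ?_)
  refine (ae_restrict_iff' (h.measurableSet_sublevel δ)).2 (Eventually.of_forall fun x hx => ?_)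
  have hxr : D x < r := lt_of_le_of_lt hx.2 hδr
  have h0 := h.pos x hx.1
  rw [h.div_eq hu H b k hs hx.1 hxr, Real.norm_eq_abs]
  have e1 : D x ^ b = D x * D x ^ (b - 1) := by
    rw [Real.rpow_sub_one h0.ne']; field_simp
  have a1 : |(D x * Laplacian.laplacian D x + 1 - k) * (D x ^ (b - 1) * |u x| ^ s)| ≤
      c * (D x ^ b * |u x| ^ s) := by
    rw [abs_mul, abs_of_nonneg (show 0 ≤ D x ^ (b - 1) * |u x| ^ s by positivity), e1]
    calc _ ≤ c * D x * (D x ^ (b - 1) * |u x| ^ s) := by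
          gcongr; exact h.abs_laplacian_le x hx.1 hxr
      _ = _ := by ring
  have a2 : |s * D x ^ b * (|u x| ^ (s - 2) * u x) *
      inner ℝ (remainder H D u x) (gradient D x)| ≤
      s * (D x ^ b * |u x| ^ (s - 1) * ‖remainder H D u x‖) := by
    rw [abs_mul, abs_mul, abs_abs_rpow_sub_two_mul hs,
      abs_of_nonneg (show 0 ≤ s * D x ^ b by positivity)]
    have := abs_real_inner_le_norm (remainder H D u x) (gradient D x)
    rw [h.norm_gradient x hx.1 hxr, mul_one] at this
    calc _ ≤ s * D x ^ b * |u x| ^ (s - 1) * ‖remainder H D u x‖ := by gcongr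
      _ = _ := by ring
  rw [abs_le] at a1 a2 ⊢
  constructor <;> linarith [a1.1, a1.2, a2.1, a2.2]

/-- The ground state estimate: the Hardy functional dominates the `L^p` norm of the remainder, up to
a boundary term and a lower order term. -/
lemma IsTubular.hardy_ge (h : IsTubular k c D U r) (hδ : 0 < δ) (hδr : δ < r)
    (hu : ContDiff ℝ 1 u) (hc : HasCompactSupport u) (hU : tsupport u ⊆ U) {p : ℝ} (hp : 2 ≤ p)
    {H : ℝ} (hH : p * H = p - k) :
    |H| ^ (p - 2) * H * (δ ^ (1 - p) * flux D U δ (fun x => |u x| ^ p)) -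
        |H| ^ (p - 1) * (c * ∫ x in sublevel D U δ, D x ^ (1 - p) * |u x| ^ p) +
        2 ^ (1 - p) * (∫ x in sublevel D U δ, ‖remainder H D u x‖ ^ p) ≤
      (∫ x in sublevel D U δ, ‖gradient u x‖ ^ p) -
        |H| ^ p * ∫ x in sublevel D U δ, |u x| ^ p / D x ^ p := by
  have hp1 : 1 < p := by linarith
  have hp0 : 0 < p := by linarith
  have hw := contDiff_abs_rpow_comp hp1 hu
  have hwc := hasCompactSupport_abs_rpow hp0 hc
  have hwU := (tsupport_abs_rpow (u := u) hp0).trans hU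
  have hfl := h.integral_rpow_flux hδ hδr hw hwc hwU (fun x => by positivity) (1 - p)
  have hF := h.integrableOn_div hδr hw hwc hwU (1 - p)
  have i2 := h.integrableOn_rpow_mul hδr hu hc hU (1 - p) hp0
  have i3 : IntegrableOn (fun x => ‖remainder H D u x‖ ^ p) (sublevel D U δ) := by
    simpa using h.integrableOn_rpow_mul_remainder hδr hu hc hU H 0 (s := 0) le_rfl hp0
  have i4 : IntegrableOn (fun x => ‖gradient u x‖ ^ p) (sublevel D U δ) := by
    refine h.integrableOn hδr hc hU (fun x hx _ => ?_) (fun x hx => ?_)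
    · exact (continuousAt_gradient hu.contDiffAt).norm.rpow_const (Or.inr hp0.le)
    · simp [gradient_eq_zero_of_notMem_tsupport hx, Real.zero_rpow hp0.ne']
  have i5 : IntegrableOn (fun x => |u x| ^ p / D x ^ p) (sublevel D U δ) := by
    refine (h.integrableOn_rpow_mul hδr hu hc hU (-p) hp0).congr_fun (fun x hx => ?_)
      (h.measurableSet_sublevel δ)
    simp only [Real.rpow_neg (h.pos x hx.1).le]
    rw [mul_comm, div_eq_mul_inv]
  rw [← hfl, ← integral_const_mul, ← integral_const_mul, ← integral_const_mul,
    ← integral_const_mul, ← integral_const_mul, ← integral_sub (hF.const_mul _)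
    ((i2.const_mul _).const_mul _), ← integral_sub i4 (i5.const_mul _)]
  have i6 : IntegrableOn (fun x => |H| ^ (p - 2) * H * ((1 - p) * D x ^ (1 - p - 1) * |u x| ^ p +
      D x ^ (1 - p) * divGrad D (fun x => |u x| ^ p) x) -
      |H| ^ (p - 1) * (c * (D x ^ (1 - p) * |u x| ^ p))) (sublevel D U δ) :=
    (hF.const_mul _).sub ((i2.const_mul c).const_mul _)
  rw [← integral_add i6 (i3.const_mul _)]
  refine setIntegral_mono_on (i6.add
    (i3.const_mul _)) (i4.sub (i5.const_mul _)) (h.measurableSet_sublevel δ) fun x hx => ?_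
  have hxr : D x < r := lt_of_le_of_lt hx.2 hδr
  have h0 := h.pos x hx.1
  rw [h.div_eq hu H (1 - p) k hp1 hx.1 hxr, show 1 - p + p * H + k - 1 = 0 by rw [hH]; ring,
    zero_mul, zero_add]
  set R := D x * Laplacian.laplacian D x + 1 - k with hR
  set V := remainder H D u x with hV
  have hg : gradient u x = (H * u x / D x) • gradient D x + V := by
    rw [hV, remainder]; abel
  have hv := norm_add_rpow_ge hp ((H * u x / D x) • gradient D x) V
  rw [← hg, norm_smul, h.norm_gradient x hx.1 hxr, mul_one, inner_smul_left, Real.norm_eq_abs,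
    abs_div, abs_mul, abs_of_pos h0, real_inner_comm] at hv
  simp only [conj_trivial] at hv
  have e1 : (|H| * |u x| / D x) ^ p = |H| ^ p * (|u x| ^ p / D x ^ p) := by
    rw [Real.div_rpow (by positivity) h0.le, Real.mul_rpow (by positivity) (by positivity)]
    ring
  have e2 : (|H| * |u x| / D x) ^ (p - 2) * (H * u x / D x * inner ℝ V (gradient D x)) =
      |H| ^ (p - 2) * H * (D x ^ (1 - p) * (|u x| ^ (p - 2) * u x) * inner ℝ V (gradient D x)) := by
    rw [Real.div_rpow (by positivity) h0.le, Real.mul_rpow (by positivity) (by positivity)]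
    have : D x ^ (1 - p) = (D x ^ (p - 2))⁻¹ * (D x)⁻¹ := by
      rw [← Real.rpow_neg h0.le, ← Real.rpow_neg_one, ← Real.rpow_add h0]
      congr 1; ring
    rw [this]
    field_simp
  rw [mul_assoc p, e1, e2] at hv
  have a1 : |H| ^ (p - 2) * H * (R * (D x ^ (1 - p - 1) * |u x| ^ p)) ≤
      |H| ^ (p - 1) * (c * (D x ^ (1 - p) * |u x| ^ p)) := by
    refine (le_abs_self _).trans ?_
    rw [abs_mul, abs_abs_rpow_sub_two_mul (by linarith), abs_mul,
      abs_of_nonneg (show 0 ≤ D x ^ (1 - p - 1) * |u x| ^ p by positivity)]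
    have e : D x ^ (1 - p) = D x * D x ^ (1 - p - 1) := by
      rw [Real.rpow_sub_one h0.ne' (1 - p)]; field_simp
    have : |R| * (D x ^ (1 - p - 1) * |u x| ^ p) ≤ c * D x * (D x ^ (1 - p - 1) * |u x| ^ p) := by
      gcongr; exact h.abs_laplacian_le x hx.1 hxr
    rw [e]
    calc _ ≤ |H| ^ (p - 1) * (c * D x * (D x ^ (1 - p - 1) * |u x| ^ p)) := by gcongr
      _ = _ := by ring
  linarith

end Tubular

/-! ### Control of the remainder and of the boundary terms -/

section TubeTerms

variable {n : ℕ} {D : E n → ℝ} {U : Set (E n)} {r δ : ℝ} {u : E n → ℝ} {k c p H : ℝ}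

/-- A tubular function `D`, a width `δ` of the tube, and a `C¹` function `u` with compact support
in `U`; it need not vanish on `{D = δ}`. -/
structure IsTubularPair (k c : ℝ) (D : E n → ℝ) (U : Set (E n)) (r δ : ℝ) (u : E n → ℝ) : Prop
    extends IsTubular k c D U r where
  nonneg : 0 ≤ c
  δ_pos : 0 < δ
  δ_lt : δ < r
  contDiff : ContDiff ℝ 1 u
  hasCompactSupport : HasCompactSupport u
  tsupport_subset : tsupport u ⊆ U

/-- The boundary term `∫_{D = δ} D ^ (1 - p) |u| ^ p`. -/
noncomputable def boundaryTerm (p : ℝ) (D : E n → ℝ) (U : Set (E n)) (δ : ℝ) (u : E n → ℝ) : ℝ :=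
  δ ^ (1 - p) * flux D U δ (fun x => |u x| ^ p)

/-- The subcritical Hardy term `∫ (D / δ) |u| ^ p / D ^ p` of the tube. -/
noncomputable def weakHardyTerm (p : ℝ) (D : E n → ℝ) (U : Set (E n)) (δ : ℝ) (u : E n → ℝ) : ℝ :=
  δ⁻¹ * ∫ x in sublevel D U δ, D x ^ (1 - p) * |u x| ^ p

/-- The remainder term `∫ |∇u - H (u / D) ∇D| ^ p` of the tube. -/
noncomputable def remainderTerm (p H : ℝ) (D : E n → ℝ) (U : Set (E n)) (δ : ℝ) (u : E n → ℝ) :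
    ℝ :=
  ∫ x in sublevel D U δ, ‖remainder H D u x‖ ^ p

lemma IsTubularPair.boundaryTerm_nonneg (h : IsTubularPair k c D U r δ u) (hp : 1 < p) :
    0 ≤ boundaryTerm p D U δ u :=
  mul_nonneg (Real.rpow_nonneg h.δ_pos.le _) (h.flux_nonneg h.δ_lt
    (contDiff_abs_rpow_comp hp h.contDiff) (hasCompactSupport_abs_rpow (by linarith)
      h.hasCompactSupport) ((tsupport_abs_rpow (by linarith)).trans h.tsupport_subset)
    (fun x => by positivity))

lemma IsTubularPair.boundaryTerm_eq_zero (h : IsTubularPair k c D U r δ u) (hp : 1 < p)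
    (hu : ∀ x, δ < D x → u x = 0) : boundaryTerm p D U δ u = 0 := by
  rw [boundaryTerm, h.flux_eq_zero h.δ_lt
    (contDiff_abs_rpow_comp hp h.contDiff) (hasCompactSupport_abs_rpow (by linarith)
      h.hasCompactSupport) ((tsupport_abs_rpow (by linarith)).trans h.tsupport_subset)
    (fun x hx => by simp [hu x hx, Real.zero_rpow (show p ≠ 0 by linarith)]), mul_zero]

lemma IsTubularPair.weakHardyTerm_nonneg (h : IsTubularPair k c D U r δ u) (p : ℝ) :
    0 ≤ weakHardyTerm p D U δ u :=
  mul_nonneg (inv_nonneg.2 h.δ_pos.le) (setIntegral_nonneg (h.measurableSet_sublevel δ)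
    fun x hx => mul_nonneg (Real.rpow_nonneg (h.pos x hx.1).le _) (by positivity))

lemma remainderTerm_nonneg (p H : ℝ) (D : E n → ℝ) (U : Set (E n)) (δ : ℝ) (u : E n → ℝ) :
    0 ≤ remainderTerm p H D U δ u :=
  integral_nonneg fun x => by positivity

lemma IsTubularPair.integrableOn_remainder (h : IsTubularPair k c D U r δ u) (H : ℝ) (hp : 0 < p) :
    IntegrableOn (fun x => ‖remainder H D u x‖ ^ p) (sublevel D U δ) := by
  simpa using h.integrableOn_rpow_mul_remainder h.δ_lt h.contDiff h.hasCompactSupport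
    h.tsupport_subset H 0 (s := 0) le_rfl hp

lemma IsTubularPair.integral_rpow_le (h : IsTubularPair k c D U r δ u) (a : ℝ) {s : ℝ}
    (hs : 0 < s) :
    ∫ x in sublevel D U δ, D x ^ a * |u x| ^ s ≤
      δ * ∫ x in sublevel D U δ, D x ^ (a - 1) * |u x| ^ s := by
  rw [← integral_const_mul]
  refine setIntegral_mono_on (h.integrableOn_rpow_mul h.δ_lt h.contDiff h.hasCompactSupport
    h.tsupport_subset a hs) ((h.integrableOn_rpow_mul h.δ_lt h.contDiff h.hasCompactSupport
    h.tsupport_subset (a - 1) hs).const_mul _) (h.measurableSet_sublevel δ) fun x hx => ?_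
  have h0 := h.pos x hx.1
  have e : D x ^ a = D x * D x ^ (a - 1) := by
    rw [Real.rpow_sub_one h0.ne']; field_simp
  rw [e, mul_assoc]
  exact mul_le_mul_of_nonneg_right hx.2 (by positivity)

/-- In a thin tube the subcritical Hardy term is controlled by the boundary and remainder terms. -/
lemma exists_weakHardyTerm_le (hp : 2 ≤ p) : ∃ C : ℝ, 0 < C ∧
    ∀ {n : ℕ} {D : E n → ℝ} {U : Set (E n)} {r δ : ℝ} {u : E n → ℝ} {k c H : ℝ}, p * H = p - k →
    IsTubularPair k c D U r δ u → c * δ ≤ 1 / 4 →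
    weakHardyTerm p D U δ u ≤ 2 * boundaryTerm p D U δ u + C * remainderTerm p H D U δ u := by
  obtain ⟨C, hC, hY⟩ := young_rpow (p := p) (by linarith) (ε := 1 / 4) (by norm_num)
  have hp0 : 0 < p := by linarith
  refine ⟨2 * C, by positivity, ?_⟩
  intro n D U r δ u k c H hH h hcδ
  have hδ := h.δ_pos
  have key := h.abs_integral_sub_flux_le h.δ_pos h.δ_lt h.contDiff h.hasCompactSupport
    h.tsupport_subset H (2 - p) (s := p) (by linarith)
  have i1 := h.integrableOn_rpow_mul h.δ_lt h.contDiff h.hasCompactSupport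
    h.tsupport_subset (1 - p) hp0
  have hA2 := h.integral_rpow_le (2 - p) hp0
  have e1 : (2 : ℝ) - p - 1 = 1 - p := by ring
  rw [e1] at key hA2
  rw [show 2 - p + p * H + k - 1 = 1 by rw [hH]; ring, one_mul] at key
  have e2 : δ ^ (2 - p) = δ * δ ^ (1 - p) := by
    rw [show 2 - p = 1 + (1 - p) by ring, Real.rpow_add hδ, Real.rpow_one]
  have hA3 : p * ∫ x in sublevel D U δ, D x ^ (2 - p) * |u x| ^ (p - 1) * ‖remainder H D u x‖ ≤
      1 / 4 * (∫ x in sublevel D U δ, D x ^ (1 - p) * |u x| ^ p) +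
        C * δ * remainderTerm p H D U δ u := by
    have i3 := h.integrableOn_remainder H hp0
    rw [remainderTerm, ← integral_const_mul, ← integral_const_mul, ← integral_const_mul,
      ← integral_add (i1.const_mul _) (i3.const_mul _)]
    refine setIntegral_mono_on ?_ ((i1.const_mul _).add (i3.const_mul _))
      (h.measurableSet_sublevel δ) fun x hx => ?_
    · have := h.integrableOn_rpow_mul_remainder h.δ_lt h.contDiff h.hasCompactSupport
        h.tsupport_subset H (2 - p) (s := p - 1) (by linarith) one_pos
      simp only [Real.rpow_one] at this
      exact this.const_mul _
    have h0 := h.pos x hx.1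
    have hy := hY (|u x| / D x) ‖remainder H D u x‖ (by positivity) (by positivity)
    have hy2 := mul_le_mul_of_nonneg_left hy h0.le
    rw [Real.div_rpow (by positivity) h0.le, Real.div_rpow (by positivity) h0.le] at hy2
    have f1 : D x ^ (1 - p) = D x / D x ^ p := by
      rw [Real.rpow_sub h0, Real.rpow_one]
    have f2 : D x ^ (2 - p) = D x / D x ^ (p - 1) := by
      rw [show 2 - p = 1 - (p - 1) by ring, Real.rpow_sub h0, Real.rpow_one]
    rw [f1, f2]
    calc p * (D x / D x ^ (p - 1) * |u x| ^ (p - 1) * ‖remainder H D u x‖)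
        = D x * (p * (|u x| ^ (p - 1) / D x ^ (p - 1)) * ‖remainder H D u x‖) := by ring
      _ ≤ _ := hy2
      _ = 1 / 4 * (D x / D x ^ p * |u x| ^ p) + C * D x * ‖remainder H D u x‖ ^ p := by ring
      _ ≤ _ := by gcongr; exact hx.2
  have h1 := (abs_le.1 key).2
  have hA0 : 0 ≤ ∫ x in sublevel D U δ, D x ^ (1 - p) * |u x| ^ p :=
    setIntegral_nonneg (h.measurableSet_sublevel δ)
      fun x hx => mul_nonneg (Real.rpow_nonneg (h.pos x hx.1).le _) (by positivity)
  rw [weakHardyTerm, boundaryTerm, inv_mul_le_iff₀ hδ]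
  set A := ∫ x in sublevel D U δ, D x ^ (1 - p) * |u x| ^ p
  have h2 : c * (∫ x in sublevel D U δ, D x ^ (2 - p) * |u x| ^ p) ≤ 1 / 4 * A :=
    calc _ ≤ c * (δ * A) := mul_le_mul_of_nonneg_left hA2 h.nonneg
      _ = c * δ * A := by ring
      _ ≤ _ := by gcongr
  rw [e2] at h1
  linarith

/-- The trace inequality: the boundary term is controlled by the mass `∫ |u| ^ p` and by an
arbitrarily small multiple of the remainder term. -/
lemma exists_boundaryTerm_le (hp : 2 ≤ p) {η : ℝ} (hη : 0 < η) : ∃ C : ℝ, 0 < C ∧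
    ∀ {n : ℕ} {D : E n → ℝ} {U : Set (E n)} {r δ : ℝ} {u : E n → ℝ} {k c H : ℝ}, p * H = p - k →
    IsTubularPair k c D U r δ u → c * δ ≤ 1 / 4 →
    boundaryTerm p D U δ u ≤ η * remainderTerm p H D U δ u +
      C * (δ ^ (-p) * ∫ x in sublevel D U δ, |u x| ^ p) := by
  obtain ⟨C, hC, hY⟩ := young_rpow (p := p) (by linarith) (ε := 1) (by norm_num)
  have hp0 : 0 < p := by linarith
  -- the parameter of the scaled Young inequality, chosen so that `θ ^ (p - 1) * C = η`
  set θ : ℝ := (η / C) ^ (1 / (p - 1)) with hθ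
  have hθ0 : 0 < θ := by positivity
  have hθη : θ ^ p * C = η * θ := by
    have : θ ^ (p - 1) = η / C := by
      rw [hθ, ← Real.rpow_mul (by positivity), one_div_mul_cancel (by linarith), Real.rpow_one]
    rw [show θ ^ p = θ ^ (p - 1) * θ by rw [Real.rpow_sub_one hθ0.ne']; field_simp, this]
    field_simp
  refine ⟨p + 1 + θ⁻¹, by positivity, ?_⟩
  intro n D U r δ u k c H hH h hcδ
  have hδ := h.δ_pos
  have key := h.abs_integral_sub_flux_le h.δ_pos h.δ_lt h.contDiff h.hasCompactSupport
    h.tsupport_subset H 1 (s := p) (by linarith)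
  have i1 : IntegrableOn (fun x => |u x| ^ p) (sublevel D U δ) := by
    simpa using h.integrableOn_rpow_mul h.δ_lt h.contDiff h.hasCompactSupport
      h.tsupport_subset 0 hp0
  have hA2 := h.integral_rpow_le 1 hp0
  simp only [sub_self, Real.rpow_zero, one_mul, Real.rpow_one] at key hA2
  rw [show 1 + p * H + k - 1 = p by rw [hH]; ring] at key
  have hA3 : p * ∫ x in sublevel D U δ, D x * |u x| ^ (p - 1) * ‖remainder H D u x‖ ≤
      θ⁻¹ * (∫ x in sublevel D U δ, |u x| ^ p) +
        η * δ ^ p * remainderTerm p H D U δ u := by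
    have i3 := h.integrableOn_remainder H hp0
    rw [remainderTerm, ← integral_const_mul, ← integral_const_mul, ← integral_const_mul,
      ← integral_add (i1.const_mul _) (i3.const_mul _)]
    refine setIntegral_mono_on ?_ ((i1.const_mul _).add (i3.const_mul _))
      (h.measurableSet_sublevel δ) fun x hx => ?_
    · have := h.integrableOn_rpow_mul_remainder h.δ_lt h.contDiff h.hasCompactSupport
        h.tsupport_subset H 1 (s := p - 1) (by linarith) one_pos
      simp only [Real.rpow_one] at this
      exact this.const_mul _
    have h0 := h.pos x hx.1
    have hy := hY |u x| (θ * δ * ‖remainder H D u x‖) (by positivity) (by positivity)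
    rw [Real.mul_rpow (by positivity) (by positivity), Real.mul_rpow (by positivity) hδ.le] at hy
    have hy2 := mul_le_mul_of_nonneg_left hy (inv_nonneg.2 hθ0.le)
    calc p * (D x * |u x| ^ (p - 1) * ‖remainder H D u x‖)
        ≤ p * (δ * |u x| ^ (p - 1) * ‖remainder H D u x‖) := by gcongr; exact hx.2
      _ = θ⁻¹ * (p * |u x| ^ (p - 1) * (θ * δ * ‖remainder H D u x‖)) := by field_simp
      _ ≤ _ := hy2
      _ = θ⁻¹ * |u x| ^ p + θ⁻¹ * (θ ^ p * C) * δ ^ p * ‖remainder H D u x‖ ^ p := by ring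
      _ = _ := by rw [hθη]; field_simp
  have h1 := (abs_le.1 key).1
  have hA0 : 0 ≤ ∫ x in sublevel D U δ, |u x| ^ p := integral_nonneg fun x => by positivity
  set A := ∫ x in sublevel D U δ, |u x| ^ p
  have h2 : c * (∫ x in sublevel D U δ, D x * |u x| ^ p) ≤ A :=
    calc _ ≤ c * (δ * A) := mul_le_mul_of_nonneg_left hA2 h.nonneg
      _ = c * δ * A := by ring
      _ ≤ 1 * A := by gcongr; linarith
      _ = A := one_mul A
  have h3 : δ * flux D U δ (fun x => |u x| ^ p) ≤ (p + 1 + θ⁻¹) * A +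
      η * δ ^ p * remainderTerm p H D U δ u := by linarith
  have h4 := mul_le_mul_of_nonneg_left h3 (Real.rpow_nonneg hδ.le (-p))
  have e3 : δ ^ (1 - p) = δ ^ (-p) * δ := by
    rw [show 1 - p = -p + 1 by ring, Real.rpow_add_one hδ.ne']
  have e4 : δ ^ (-p) * δ ^ p = 1 := by rw [← Real.rpow_add hδ]; simp
  rw [boundaryTerm, e3]
  calc δ ^ (-p) * δ * flux D U δ (fun x => |u x| ^ p)
      = δ ^ (-p) * (δ * flux D U δ (fun x => |u x| ^ p)) := by ring
    _ ≤ _ := h4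
    _ = (δ ^ (-p) * δ ^ p) * (η * remainderTerm p H D U δ u) +
        (p + 1 + θ⁻¹) * (δ ^ (-p) * A) := by ring
    _ = _ := by rw [e4, one_mul]

/-- The Hardy functional of the tube. -/
noncomputable def tubeHardy (p H : ℝ) (D : E n → ℝ) (U : Set (E n)) (δ : ℝ) (u : E n → ℝ) : ℝ :=
  (∫ x in sublevel D U δ, ‖gradient u x‖ ^ p) -
    |H| ^ p * ∫ x in sublevel D U δ, |u x| ^ p / D x ^ p

/-- In thin tubes the Hardy functional controls the remainder and the subcritical Hardy terms:
for all `u` if `0 < H`, up to a multiple of `∫ |u| ^ p` for all `H`, and for all `H` if `u` vanishes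
on the outer boundary of the tube. -/
lemma exists_tubeHardy_ge (hp : 2 ≤ p) (H : ℝ) : ∃ t c₁ M : ℝ, 0 < t ∧ 0 < c₁ ∧ 0 < M ∧ t ≤ 1 / 4 ∧
    ∀ {n : ℕ} {D : E n → ℝ} {U : Set (E n)} {r δ : ℝ} {u : E n → ℝ} {k c : ℝ}, p * H = p - k →
    IsTubularPair k c D U r δ u → c * δ ≤ t →
    (0 < H → c₁ * (remainderTerm p H D U δ u + weakHardyTerm p D U δ u) ≤ tubeHardy p H D U δ u) ∧
    (c₁ * (remainderTerm p H D U δ u + weakHardyTerm p D U δ u) ≤ tubeHardy p H D U δ u +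
      M * (δ ^ (-p) * ∫ x in sublevel D U δ, |u x| ^ p)) ∧
    ((∀ x, δ < D x → u x = 0) →
      c₁ * (remainderTerm p H D U δ u + weakHardyTerm p D U δ u) ≤ tubeHardy p H D U δ u) := by
  set a : ℝ := |H| ^ (p - 1) with ha
  have ha0 : 0 ≤ a := by positivity
  set m : ℝ := 2 ^ (1 - p) with hm
  have hm0 : 0 < m := by positivity
  have hη : 0 < m / (8 * (a + 1)) := by positivity
  set η := m / (8 * (a + 1)) with hη'
  have hηa : 8 * (a * η) ≤ m := by
    rw [hη', ← mul_div_assoc, ← mul_div_assoc, div_le_iff₀ (by positivity)]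
    nlinarith
  obtain ⟨C, hC, hY⟩ := exists_weakHardyTerm_le hp
  obtain ⟨B, hB, hZ⟩ := exists_boundaryTerm_le hp hη
  set t : ℝ := min (1 / 4) (m / (2 * (a * C + 1))) with ht
  have ht0 : 0 < t := by positivity
  have ht4 : t ≤ 1 / 4 := min_le_left _ _
  have htC : t * (a * C) ≤ m / 2 := by
    have : t * (2 * (a * C + 1)) ≤ m := by
      rw [← le_div_iff₀ (by positivity)]; exact min_le_right _ _
    nlinarith
  -- the constant for `0 < H`, and the one for the other two cases
  set c₂ : ℝ := min (a / 4) (m / 2 / (C + 1))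
  set c₃ : ℝ := m / 4 / (2 * η + C + 1)
  have hc3 : 0 < c₃ := by positivity
  have hc3' : c₃ * (2 * η + C + 1) = m / 4 := by
    simp only [c₃]; field_simp
  refine ⟨t, if 0 < H then min c₂ c₃ else c₃, 2 * a * B + 2 * c₃ * B, ht0, ?_, by positivity,
    ht4, ?_⟩
  · split_ifs with hH
    · have : 0 < a := by positivity
      positivity
    · exact hc3
  intro n D U r δ u k c hk h hcδ
  have hle3 : (if 0 < H then min c₂ c₃ else c₃) ≤ c₃ := by
    split_ifs
    · exact min_le_right _ _
    · exact le_rfl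
  have hδ := h.δ_pos
  have hY' := hY hk h (hcδ.trans ht4)
  have hZ' := hZ hk h (hcδ.trans ht4)
  have hX0 := remainderTerm_nonneg p H D U δ u
  have hY0 := h.weakHardyTerm_nonneg p
  have hΨ0 := h.boundaryTerm_nonneg (p := p) (by linarith)
  have hZ0 : 0 ≤ δ ^ (-p) * ∫ x in sublevel D U δ, |u x| ^ p :=
    mul_nonneg (by positivity) (integral_nonneg fun x => by positivity)
  have hI : |H| ^ (p - 2) * H * boundaryTerm p D U δ u -
      a * (c * δ * weakHardyTerm p D U δ u) + m * remainderTerm p H D U δ u ≤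
      tubeHardy p H D U δ u := by
    refine le_trans (le_of_eq ?_) (h.hardy_ge h.δ_pos h.δ_lt h.contDiff h.hasCompactSupport
      h.tsupport_subset hp hk)
    rw [weakHardyTerm, boundaryTerm, remainderTerm]
    field_simp
    simp only [a, m]
    ring
  set X := remainderTerm p H D U δ u
  set Y := weakHardyTerm p D U δ u
  set Ψ := boundaryTerm p D U δ u
  set Z := δ ^ (-p) * ∫ x in sublevel D U δ, |u x| ^ p
  set I := tubeHardy p H D U δ u
  have herr : a * (c * δ * Y) ≤ a * Ψ / 2 + m / 2 * X := by
    calc a * (c * δ * Y) ≤ a * (t * (2 * Ψ + C * X)) := by gcongr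
      _ = 2 * t * (a * Ψ) + t * (a * C) * X := by ring
      _ ≤ 2 * (1 / 4) * (a * Ψ) + m / 2 * X := by gcongr
      _ = _ := by ring
  have hXY : 0 ≤ X + Y := by linarith
  refine ⟨fun hH => ?_, ?_, fun hu => ?_⟩
  · have e : |H| ^ (p - 2) * H = a := by
      have := abs_abs_rpow_sub_two_mul (s := p) (by linarith) H
      rwa [abs_of_nonneg (by positivity)] at this
    rw [e] at hI
    have hc2 : (if 0 < H then min c₂ c₃ else c₃) ≤ c₂ := by
      rw [if_pos hH]; exact min_le_left _ _
    have h1 : c₂ ≤ a / 4 := min_le_left _ _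
    have h2 : c₂ * (C + 1) ≤ m / 2 := by
      rw [← le_div_iff₀ (by positivity)]; exact min_le_right _ _
    have hc20 : 0 ≤ c₂ := by positivity
    calc _ ≤ c₂ * (X + Y) := by gcongr
      _ ≤ c₂ * (X + (2 * Ψ + C * X)) := by gcongr
      _ = 2 * (c₂ * Ψ) + c₂ * (C + 1) * X := by ring
      _ ≤ 2 * (a / 4 * Ψ) + m / 2 * X := by gcongr
      _ ≤ I := by linarith
  · have e : -(a * Ψ) ≤ |H| ^ (p - 2) * H * Ψ := by
      have := abs_abs_rpow_sub_two_mul (s := p) (by linarith) H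
      have h2 := neg_abs_le (|H| ^ (p - 2) * H)
      rw [this] at h2
      nlinarith
    have h1 : a * Ψ ≤ a * η * X + a * B * Z := by
      calc a * Ψ ≤ a * (η * X + B * Z) := by gcongr
        _ = _ := by ring
    have h2 : a * η * X ≤ m / 8 * X := by gcongr; linarith
    have h3 : c₃ * (X + Y) ≤ m / 4 * X + 2 * c₃ * B * Z := by
      calc c₃ * (X + Y) ≤ c₃ * (X + (2 * (η * X + B * Z) + C * X)) := by gcongr; linarith
        _ = c₃ * (2 * η + C + 1) * X + 2 * c₃ * B * Z := by ring
        _ = _ := by rw [hc3']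
    have h4 := mul_le_mul_of_nonneg_right hle3 hXY
    have h5 : 0 ≤ a * B * Z := by positivity
    have h6 : (2 * a * B + 2 * c₃ * B) * Z = 2 * (a * B * Z) + 2 * c₃ * B * Z := by ring
    have h7 : 0 ≤ m * X := by positivity
    rw [h6]
    linarith
  · have hΨ : Ψ = 0 := h.boundaryTerm_eq_zero (by linarith) hu
    rw [hΨ] at hI herr hY'
    have h3 : c₃ * (X + Y) ≤ m / 4 * X := by
      calc c₃ * (X + Y) ≤ c₃ * (X + (2 * 0 + C * X)) := by gcongr
        _ = c₃ * (C + 1) * X := by ring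
        _ ≤ c₃ * (2 * η + C + 1) * X := by gcongr; linarith
        _ = _ := by rw [hc3']
    have h4 := mul_le_mul_of_nonneg_right hle3 hXY
    have h7 : 0 ≤ m * X := by positivity
    linarith

end TubeTerms

/-! ### The weighted Sobolev inequality -/

section WeightedSobolev

/-- Hölder's inequality `∫ f ^ a g ^ b ≤ (∫ f) ^ a (∫ g) ^ b` for `a + b = 1`. -/
lemma integral_rpow_mul_rpow_le {α : Type*} [MeasurableSpace α] {μ : Measure α} {f g : α → ℝ}
    (hf : Integrable f μ) (hg : Integrable g μ) (hf0 : 0 ≤ᵐ[μ] f) (hg0 : 0 ≤ᵐ[μ] g) {a b : ℝ}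
    (ha : 0 ≤ a) (hb : 0 ≤ b) (hab : a + b = 1) :
    ∫ x, f x ^ a * g x ^ b ∂μ ≤ (∫ x, f x ∂μ) ^ a * (∫ x, g x ∂μ) ^ b := by
  have hI : 0 ≤ ∫ x, f x ∂μ := integral_nonneg_of_ae hf0
  have hJ : 0 ≤ ∫ x, g x ∂μ := integral_nonneg_of_ae hg0
  have h := ENNReal.lintegral_mul_norm_pow_le (μ := μ) hf.aemeasurable.ennreal_ofReal
    hg.aemeasurable.ennreal_ofReal ha hb hab
  rw [← ofReal_integral_eq_lintegral_ofReal hf hf0, ← ofReal_integral_eq_lintegral_ofReal hg hg0,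
    ENNReal.ofReal_rpow_of_nonneg hI ha, ENNReal.ofReal_rpow_of_nonneg hJ hb,
    ← ENNReal.ofReal_mul (by positivity)] at h
  have hm : AEStronglyMeasurable (fun x => f x ^ a * g x ^ b) μ :=
    ((hf.aemeasurable.pow_const a).mul (hg.aemeasurable.pow_const b)).aestronglyMeasurable
  have hnn : 0 ≤ᵐ[μ] fun x => f x ^ a * g x ^ b := by
    filter_upwards [hf0, hg0] with x h1 h2
    exact mul_nonneg (Real.rpow_nonneg h1 _) (Real.rpow_nonneg h2 _)
  rw [integral_eq_lintegral_of_nonneg_ae hnn hm]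
  refine ENNReal.toReal_le_of_le_ofReal (by positivity) (le_trans (le_of_eq ?_) h)
  refine lintegral_congr_ae ?_
  filter_upwards [hf0, hg0] with x h1 h2
  rw [ENNReal.ofReal_rpow_of_nonneg h1 ha, ENNReal.ofReal_rpow_of_nonneg h2 hb,
    ← ENNReal.ofReal_mul (Real.rpow_nonneg h1 _)]

variable {n : ℕ} {D : E n → ℝ} {U : Set (E n)} {r δ : ℝ} {u : E n → ℝ} {k c p H : ℝ}

/-- The `L¹` estimate behind the weighted Sobolev inequality: if `κ = b + s H + k - 1 > 0`, the norm
of `D ^ b |u| ^ s` in `L^{n/(n-1)}` and its weighted `L¹` norm are controlled by the integral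
`N₁` of `D ^ b |u| ^ (s - 1) |V|`, `V` being the remainder, and by a zero order term `N₂` which is
small near `D = 0`. -/
lemma exists_sobolev_of_pos (hn : 2 ≤ n) {s b H k : ℝ} (hs : 1 < s) (hκ : 0 < b + s * H + k - 1) :
    ∃ C : ℝ, 0 < C ∧ ∀ {D : E n → ℝ} {U : Set (E n)} {r δ : ℝ} {u : E n → ℝ} {c : ℝ},
    IsTubularPair k c D U r δ u → c * δ ≤ 1 →
    (∫ x in sublevel D U δ, D x ^ (b - 1) * |u x| ^ s) ≤
        C * ((∫ x in sublevel D U δ, D x ^ b * |u x| ^ (s - 1) * ‖remainder H D u x‖) +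
          δ⁻¹ * ∫ x in sublevel D U δ, D x ^ b * |u x| ^ s) ∧
    (∫ x in sublevel D U δ, (D x ^ b * |u x| ^ s) ^ ((n : ℝ) / (n - 1))) ^ (((n : ℝ) - 1) / n) ≤
        C * ((∫ x in sublevel D U δ, D x ^ b * |u x| ^ (s - 1) * ‖remainder H D u x‖) +
          δ⁻¹ * ∫ x in sublevel D U δ, D x ^ b * |u x| ^ s) := by
  obtain ⟨S, hS, hsob⟩ := exists_sobolev_sublevel_const hn
  have hs0 : 0 < s := by linarith
  set κ : ℝ := b + s * H + k - 1 with hκdef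
  set C₀ : ℝ := (κ + 3 + 2 * s) / κ with hC₀
  have hC₀0 : 0 < C₀ := by positivity
  refine ⟨C₀ + S * (|b + s * H| * C₀ + 2 * s + κ + 2), by positivity, ?_⟩
  intro D U r δ u c h hcδ
  have hδ := h.δ_pos
  have k1 := h.abs_integral_sub_flux_le h.δ_pos h.δ_lt h.contDiff h.hasCompactSupport
    h.tsupport_subset H b hs
  have k2 := h.abs_integral_sub_flux_le h.δ_pos h.δ_lt h.contDiff h.hasCompactSupport
    h.tsupport_subset H (b + 1) hs
  have hsob' := hsob D U r δ (fun x => |u x| ^ s) h.toIsEikonal h.δ_pos h.δ_lt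
    (contDiff_abs_rpow_comp hs h.contDiff) (hasCompactSupport_abs_rpow hs0 h.hasCompactSupport)
    ((tsupport_abs_rpow hs0).trans h.tsupport_subset) (fun x => by positivity) b
  have hb1 := h.integral_rpow_le (b + 1) hs0
  have e1 : b + 1 - 1 = b := by ring
  rw [e1] at k2 hb1
  rw [show b + 1 + s * H + k - 1 = κ + 1 by rw [hκdef]; ring, Real.rpow_add_one hδ.ne'] at k2
  rw [← hκdef] at k1
  have i0 := h.integrableOn_rpow_mul h.δ_lt h.contDiff h.hasCompactSupport
    h.tsupport_subset (b - 1) hs0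
  have i1 : ∀ a : ℝ, IntegrableOn (fun x => D x ^ a * |u x| ^ (s - 1) * ‖remainder H D u x‖)
      (sublevel D U δ) := fun a => by
    simpa using h.integrableOn_rpow_mul_remainder h.δ_lt h.contDiff h.hasCompactSupport
      h.tsupport_subset H a (s := s - 1) (t := 1) (by linarith) one_pos
  have hN1' : ∫ x in sublevel D U δ, D x ^ (b + 1) * |u x| ^ (s - 1) * ‖remainder H D u x‖ ≤
      δ * ∫ x in sublevel D U δ, D x ^ b * |u x| ^ (s - 1) * ‖remainder H D u x‖ := by
    rw [← integral_const_mul]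
    refine setIntegral_mono_on (i1 _) ((i1 b).const_mul _) (h.measurableSet_sublevel δ)
      fun x hx => ?_
    have h0 := h.pos x hx.1
    rw [Real.rpow_add_one h0.ne']
    calc _ = D x * (D x ^ b * |u x| ^ (s - 1) * ‖remainder H D u x‖) := by ring
      _ ≤ _ := by gcongr; exact hx.2
  have hG : ∫ x in sublevel D U δ, ‖(b * D x ^ (b - 1) * |u x| ^ s) • gradient D x +
      D x ^ b • gradient (fun x => |u x| ^ s) x‖ ≤
      |b + s * H| * (∫ x in sublevel D U δ, D x ^ (b - 1) * |u x| ^ s) +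
      s * ∫ x in sublevel D U δ, D x ^ b * |u x| ^ (s - 1) * ‖remainder H D u x‖ := by
    rw [← integral_const_mul, ← integral_const_mul, ← integral_add (i0.const_mul _)
      ((i1 b).const_mul _)]
    refine integral_mono_of_nonneg (Eventually.of_forall fun x => norm_nonneg _)
      ((i0.const_mul _).add ((i1 b).const_mul _)) ((ae_restrict_iff' (h.measurableSet_sublevel δ)).2
        (Eventually.of_forall fun x hx => ?_))
    have h0 := h.pos x hx.1
    have hxr : D x < r := lt_of_le_of_lt hx.2 h.δ_lt
    have e : (b * D x ^ (b - 1) * |u x| ^ s) • gradient D x +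
        D x ^ b • gradient (fun x => |u x| ^ s) x =
        ((b + s * H) * (D x ^ (b - 1) * |u x| ^ s)) • gradient D x +
          (s * D x ^ b * (|u x| ^ (s - 2) * u x)) • remainder H D u x := by
      rw [gradient_abs_rpow hs (h.contDiff.differentiable (by norm_num) x), remainder, smul_sub,
        smul_smul, smul_smul, add_sub, add_comm (_ • gradient D x) (_ • gradient u x),
        add_comm (_ • gradient D x) (_ • gradient u x), add_sub_assoc, ← sub_smul]
      congr 2
      · ring
      · rw [Real.rpow_sub_one h0.ne', ← abs_rpow_sub_two_mul_sq hs (u x)]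
        field_simp
        ring
    beta_reduce
    rw [e]
    refine (norm_add_le _ _).trans (le_of_eq ?_)
    rw [norm_smul, norm_smul, h.norm_gradient x hx.1 hxr, Real.norm_eq_abs, Real.norm_eq_abs,
      abs_mul (b + s * H), abs_mul (s * D x ^ b), abs_abs_rpow_sub_two_mul hs,
      abs_of_nonneg (show 0 ≤ D x ^ (b - 1) * |u x| ^ s by positivity),
      abs_of_nonneg (show 0 ≤ s * D x ^ b by positivity)]
    ring
  set Φ := flux D U δ (fun x => |u x| ^ s)
  set N0 := ∫ x in sublevel D U δ, D x ^ (b - 1) * |u x| ^ s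
  set N1 := ∫ x in sublevel D U δ, D x ^ b * |u x| ^ (s - 1) * ‖remainder H D u x‖
  set B := ∫ x in sublevel D U δ, D x ^ b * |u x| ^ s
  set N2 := δ⁻¹ * B with hN2
  have hB : B = δ * N2 := by rw [hN2]; field_simp
  have hN1 : 0 ≤ N1 := setIntegral_nonneg (h.measurableSet_sublevel δ) fun x hx =>
    mul_nonneg (mul_nonneg (Real.rpow_nonneg (h.pos x hx.1).le _) (by positivity)) (norm_nonneg _)
  have hB0 : 0 ≤ B := setIntegral_nonneg (h.measurableSet_sublevel δ) fun x hx =>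
    mul_nonneg (Real.rpow_nonneg (h.pos x hx.1).le _) (by positivity)
  have hN20 : 0 ≤ N2 := by positivity
  -- the boundary term is controlled by the terms of the right-hand side
  have f2 : δ ^ b * Φ ≤ (κ + 2) * N2 + s * N1 := by
    have h1 := (abs_le.1 k2).1
    have h2 : c * (∫ x in sublevel D U δ, D x ^ (b + 1) * |u x| ^ s) ≤ δ * N2 := by
      calc _ ≤ c * (δ * B) := mul_le_mul_of_nonneg_left hb1 h.nonneg
        _ = c * δ * B := by ring
        _ ≤ 1 * B := by gcongr
        _ = δ * N2 := by rw [one_mul, hB]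
    have h3 : s * (∫ x in sublevel D U δ, D x ^ (b + 1) * |u x| ^ (s - 1) * ‖remainder H D u x‖) ≤
        s * (δ * N1) := by gcongr
    rw [hB] at h1
    have h4 : δ * (δ ^ b * Φ) ≤ δ * ((κ + 2) * N2 + s * N1) := by linarith
    exact le_of_mul_le_mul_left h4 hδ
  have f0 : N0 ≤ C₀ * (N1 + N2) := by
    have h1 := (abs_le.1 k1).2
    have h2 : c * B ≤ N2 := by
      rw [hB]
      calc c * (δ * N2) = c * δ * N2 := by ring
        _ ≤ 1 * N2 := by gcongr
        _ = N2 := one_mul _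
    rw [hC₀, div_mul_eq_mul_div, le_div_iff₀ hκ]
    nlinarith
  have hNN : 0 ≤ N1 + N2 := by positivity
  have hrest : 0 ≤ S * (|b + s * H| * C₀ + 2 * s + κ + 2) := by positivity
  refine ⟨f0.trans (by gcongr; linarith), hsob'.trans ?_⟩
  calc _ ≤ S * ((|b + s * H| * N0 + s * N1) + ((κ + 2) * N2 + s * N1)) := by gcongr
    _ ≤ S * ((|b + s * H| * (C₀ * (N1 + N2)) + s * N1) + ((κ + 2) * N2 + s * N1)) := by gcongr
    _ = S * (|b + s * H| * C₀ * (N1 + N2) + (2 * s) * N1 + (κ + 2) * N2) := by ring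
    _ ≤ S * (|b + s * H| * C₀ * (N1 + N2) + (2 * s) * (N1 + N2) + (κ + 2) * (N1 + N2)) := by
        gcongr <;> linarith
    _ = S * (|b + s * H| * C₀ + 2 * s + κ + 2) * (N1 + N2) := by ring
    _ ≤ _ := by gcongr; linarith

/-- The Hardy–Sobolev term is controlled by the remainder and the subcritical Hardy terms. -/
lemma exists_weightedSobolev (hn : 2 ≤ n) {p q H k : ℝ} (hp : 2 ≤ p) (hpn : p < n) (hkn : k < n)
    (hH : p * H = p - k) (hpq : p < q) (hq : q ≤ n * p / (n - p)) :
    ∃ C : ℝ, 0 < C ∧ ∀ {D : E n → ℝ} {U : Set (E n)} {r δ : ℝ} {u : E n → ℝ} {c : ℝ},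
    IsTubularPair k c D U r δ u → c * δ ≤ 1 →
    (∫ x in sublevel D U δ, D x ^ (-q + (q - p) / p * n) * |u x| ^ q) ^ (p / q) ≤
      C * (remainderTerm p H D U δ u + weakHardyTerm p D U δ u) := by
  have hp0 : 0 < p := by linarith
  have hq0 : 0 < q := by linarith
  have hn2 : (2 : ℝ) ≤ n := by exact_mod_cast hn
  have hnp : 0 < (n : ℝ) - p := by linarith
  -- `s` and `b` are such that `(D ^ e |u| ^ q) ^ ((p - 1) / p) = D ^ b |u| ^ (s - 1)`, and `μ` is
  -- the parameter of the interpolation of `D ^ e |u| ^ q` between `D ^ (b - 1) |u| ^ s` and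
  -- `(D ^ b |u| ^ s) ^ (n / (n - 1))`
  set s : ℝ := 1 + q * (p - 1) / p with hsdef
  set e : ℝ := -q + (q - p) / p * n with hedef
  set b : ℝ := e * (p - 1) / p with hbdef
  set μ : ℝ := (n - 1) * (q - p) / (p * s) with hμdef
  have hs : 1 < s := by
    have : 0 < q * (p - 1) / p := div_pos (mul_pos hq0 (by linarith)) hp0
    linarith
  have hs0 : 0 < s := by linarith
  have hps : p * s = p + q * (p - 1) := by rw [hsdef]; field_simp
  have hκ : 0 < b + s * H + k - 1 := by
    have : b + s * H + k - 1 = (q - p) * (p - 1) * (n - k) / p ^ 2 := by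
      have hHk : H = (p - k) / p := by rw [← hH]; field_simp
      rw [hbdef, hedef, hsdef, hHk]
      field_simp
      ring
    rw [this]
    have h1 : 0 < q - p := by linarith
    have h2 : 0 < p - 1 := by linarith
    have h3 : 0 < (n : ℝ) - k := by linarith
    positivity
  have hμ0 : 0 ≤ μ := div_nonneg (mul_nonneg (by linarith) (by linarith)) (by positivity)
  have hμ1 : μ ≤ 1 := by
    rw [hμdef, div_le_one (by positivity), hps]
    rw [le_div_iff₀ hnp] at hq
    nlinarith
  have hN : (n : ℝ) - 1 ≠ 0 := by linarith
  have hμs : s * (1 - μ) + s * ((n : ℝ) / (n - 1)) * μ = q := by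
    rw [hμdef]
    field_simp
    rw [mul_comm s p, hps]
    ring
  have hμe : (b - 1) * (1 - μ) + b * ((n : ℝ) / (n - 1)) * μ = e := by
    have h1 : (b - 1) * (1 - μ) + b * ((n : ℝ) / (n - 1)) * μ = b * q / s - 1 + μ := by
      rw [← hμs]; field_simp; ring
    have h2 : μ * (p * s) = (n - 1) * (q - p) := by rw [hμdef]; field_simp
    have h3 : e * p = -q * p + (q - p) * n := by rw [hedef]; field_simp
    have h4 : b * p = e * (p - 1) := by rw [hbdef]; field_simp
    rw [h1]
    have hps0 : p * (p * s) ≠ 0 := by positivity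
    apply mul_right_cancel₀ hps0
    have : b * q / s * (p * (p * s)) = (b * p) * (q * p) := by field_simp
    rw [sub_add, sub_mul, this, h4, sub_mul, one_mul]
    have h5 : μ * (p * (p * s)) = p * ((n - 1) * (q - p)) := by rw [← h2]; ring
    rw [h5, hps]
    linear_combination (q * (p - 1) - p - q * (p - 1)) * h3
  obtain ⟨C, hC, hsob⟩ := exists_sobolev_of_pos hn (H := H) hs hκ
  refine ⟨(2 * C) ^ p, by positivity, ?_⟩
  intro D U r δ u c h hcδ
  obtain ⟨hN0, hNs⟩ := hsob h hcδ
  have hδ := h.δ_pos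
  have hTm := h.measurableSet_sublevel δ
  have hint : ∀ (a : ℝ) {t : ℝ}, 0 < t →
      IntegrableOn (fun x => D x ^ a * |u x| ^ t) (sublevel D U δ) := fun a t ht =>
    h.integrableOn_rpow_mul h.δ_lt h.contDiff h.hasCompactSupport h.tsupport_subset a ht
  have hnn : ∀ (a t : ℝ), 0 ≤ᵐ[volume.restrict (sublevel D U δ)] fun x => D x ^ a * |u x| ^ t := by
    intro a t
    refine (ae_restrict_iff' hTm).2 (Eventually.of_forall fun x hx => ?_)
    exact mul_nonneg (Real.rpow_nonneg (h.pos x hx.1).le _) (by positivity)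
  have hX := h.integrableOn_remainder H hp0
  have hX0 := remainderTerm_nonneg p H D U δ u
  have hY0 := h.weakHardyTerm_nonneg p
  have hp1 : 0 ≤ (p - 1) / p := div_nonneg (by linarith) hp0.le
  have hp2 : 1 / p + (p - 1) / p = 1 := by field_simp; ring
  set W := ∫ x in sublevel D U δ, D x ^ e * |u x| ^ q with hW
  have hW0 : 0 ≤ W := integral_nonneg_of_ae (hnn e q)
  set N1 := ∫ x in sublevel D U δ, D x ^ b * |u x| ^ (s - 1) * ‖remainder H D u x‖ with hN1def
  set N2 := δ⁻¹ * ∫ x in sublevel D U δ, D x ^ b * |u x| ^ s with hN2def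
  have hfac : ∀ x ∈ sublevel D U δ, (D x ^ e * |u x| ^ q) ^ ((p - 1) / p) =
      D x ^ b * |u x| ^ (s - 1) := by
    intro x hx
    have h0 := h.pos x hx.1
    rw [Real.mul_rpow (by positivity) (by positivity), ← Real.rpow_mul h0.le,
      ← Real.rpow_mul (abs_nonneg _)]
    congr 2
    · rw [hbdef]; ring
    · rw [hsdef]; ring
  have hN1 : N1 ≤ remainderTerm p H D U δ u ^ (1 / p) * W ^ ((p - 1) / p) := by
    refine le_trans (le_of_eq ?_) (integral_rpow_mul_rpow_le hX (hint e hq0)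
      (Eventually.of_forall fun x => by positivity) (hnn e q) (by positivity) hp1 hp2)
    refine setIntegral_congr_fun hTm fun x hx => ?_
    rw [hfac x hx, ← Real.rpow_mul (norm_nonneg _), mul_one_div_cancel hp0.ne', Real.rpow_one]
    ring
  have hN2 : N2 ≤ weakHardyTerm p D U δ u ^ (1 / p) * W ^ ((p - 1) / p) := by
    have i1 := (hint (1 - p) hp0).const_mul δ⁻¹
    have hnn1 : 0 ≤ᵐ[volume.restrict (sublevel D U δ)]
        fun x => δ⁻¹ * (D x ^ (1 - p) * |u x| ^ p) := by
      filter_upwards [hnn (1 - p) p] with x hx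
      exact mul_nonneg (by positivity) hx
    have hH := integral_rpow_mul_rpow_le i1 (hint e hq0) hnn1 (hnn e q)
      (by positivity) hp1 hp2
    rw [integral_const_mul] at hH
    refine le_trans ?_ hH
    rw [hN2def, ← integral_const_mul]
    have hpt : ∀ x ∈ sublevel D U δ, (δ⁻¹ * (D x ^ (1 - p) * |u x| ^ p)) ^ (1 / p) *
        (D x ^ e * |u x| ^ q) ^ ((p - 1) / p) =
        δ ^ (-(1 / p)) * (D x ^ (b - (p - 1) / p) * |u x| ^ s) := by
      intro x hx
      have h0 := h.pos x hx.1
      rw [hfac x hx, Real.mul_rpow (by positivity) (by positivity),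
        Real.mul_rpow (by positivity) (by positivity), ← Real.rpow_mul h0.le,
        ← Real.rpow_mul (abs_nonneg _), mul_one_div_cancel hp0.ne', Real.rpow_one,
        Real.inv_rpow hδ.le, ← Real.rpow_neg hδ.le]
      have g1 : D x ^ (b - (p - 1) / p) = D x ^ ((1 - p) * (1 / p)) * D x ^ b := by
        rw [← Real.rpow_add h0]; congr 1; ring
      have g2 : |u x| ^ s = |u x| * |u x| ^ (s - 1) := by
        nth_rewrite 2 [← Real.rpow_one |u x|]
        rw [← Real.rpow_add_of_nonneg (abs_nonneg _) zero_le_one (by linarith)]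
        congr 1; ring
      rw [g1, g2]; ring
    have i2 : IntegrableOn (fun x => (δ⁻¹ * (D x ^ (1 - p) * |u x| ^ p)) ^ (1 / p) *
        (D x ^ e * |u x| ^ q) ^ ((p - 1) / p)) (sublevel D U δ) :=
      IntegrableOn.congr_fun ((hint (b - (p - 1) / p) hs0).const_mul (δ ^ (-(1 / p))))
        (fun x hx => (hpt x hx).symm) hTm
    refine setIntegral_mono_on ((hint b hs0).const_mul _) i2 hTm fun x hx => ?_
    have h0 := h.pos x hx.1
    rw [hpt x hx, Real.rpow_sub h0]
    have g3 : δ⁻¹ = δ ^ (-(1 / p)) * (δ ^ ((p - 1) / p))⁻¹ := by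
      rw [← Real.rpow_neg hδ.le, ← Real.rpow_add hδ, ← Real.rpow_neg_one]
      congr 1; linarith
    have g4 : (δ ^ ((p - 1) / p))⁻¹ ≤ (D x ^ ((p - 1) / p))⁻¹ := by
      have := hx.2
      gcongr
    rw [g3, div_eq_mul_inv (D x ^ b)]
    calc _ ≤ δ ^ (-(1 / p)) * (D x ^ ((p - 1) / p))⁻¹ * (D x ^ b * |u x| ^ s) :=
          mul_le_mul_of_nonneg_right (mul_le_mul_of_nonneg_left g4 (by positivity)) (by positivity)
      _ = _ := by ring
  -- interpolation between the two norms of `D ^ b |u| ^ s`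
  have hnpos : (0 : ℝ) < n / (n - 1) := div_pos (by linarith) (by linarith)
  have hM0 : 0 ≤ C * (N1 + N2) := (integral_nonneg_of_ae (hnn (b - 1) s)).trans hN0
  have hWle : W ≤ (C * (N1 + N2)) ^ (q / s) := by
    have hptJ : ∀ x ∈ sublevel D U δ, (D x ^ b * |u x| ^ s) ^ ((n : ℝ) / (n - 1)) =
        D x ^ (b * ((n : ℝ) / (n - 1))) * |u x| ^ (s * ((n : ℝ) / (n - 1))) := by
      intro x hx
      have h0 := h.pos x hx.1
      rw [Real.mul_rpow (by positivity) (by positivity), ← Real.rpow_mul h0.le,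
        ← Real.rpow_mul (abs_nonneg _)]
    have iJ : IntegrableOn (fun x => (D x ^ b * |u x| ^ s) ^ ((n : ℝ) / (n - 1)))
        (sublevel D U δ) :=
      (hint (b * ((n : ℝ) / (n - 1))) (by positivity)).congr_fun
        (fun x hx => (hptJ x hx).symm) hTm
    have hJ0 : 0 ≤ᵐ[volume.restrict (sublevel D U δ)]
        fun x => (D x ^ b * |u x| ^ s) ^ ((n : ℝ) / (n - 1)) := by
      filter_upwards [hnn b s] with x hx
      exact Real.rpow_nonneg hx _
    have hh := integral_rpow_mul_rpow_le (hint (b - 1) hs0) iJ (hnn (b - 1) s) hJ0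
      (show 0 ≤ 1 - μ by linarith) hμ0 (by ring)
    have hJ0' := integral_nonneg_of_ae hJ0
    have hJle : ∫ x in sublevel D U δ, (D x ^ b * |u x| ^ s) ^ ((n : ℝ) / (n - 1)) ≤
        (C * (N1 + N2)) ^ ((n : ℝ) / (n - 1)) := by
      have := Real.rpow_le_rpow (by positivity) hNs hnpos.le
      rwa [← Real.rpow_mul hJ0', div_mul_div_cancel₀ (by linarith), div_self hN,
        Real.rpow_one] at this
    have hqs : q / s = (1 - μ) + (n : ℝ) / (n - 1) * μ := by
      rw [div_eq_iff hs0.ne', ← hμs]; ring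
    calc W = ∫ x in sublevel D U δ, (D x ^ (b - 1) * |u x| ^ s) ^ (1 - μ) *
          ((D x ^ b * |u x| ^ s) ^ ((n : ℝ) / (n - 1))) ^ μ := by
          refine setIntegral_congr_fun hTm fun x hx => ?_
          have h0 := h.pos x hx.1
          rw [hptJ x hx, Real.mul_rpow (by positivity) (by positivity),
            Real.mul_rpow (by positivity) (by positivity), ← Real.rpow_mul h0.le,
            ← Real.rpow_mul (abs_nonneg _), ← Real.rpow_mul h0.le, ← Real.rpow_mul (abs_nonneg _),
            mul_mul_mul_comm, ← Real.rpow_add h0, hμe,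
            ← Real.rpow_add_of_nonneg (abs_nonneg _) (mul_nonneg hs0.le (by linarith))
              (by positivity), hμs]
      _ ≤ _ := hh
      _ ≤ (C * (N1 + N2)) ^ (1 - μ) * ((C * (N1 + N2)) ^ ((n : ℝ) / (n - 1))) ^ μ := by
          refine mul_le_mul (Real.rpow_le_rpow (integral_nonneg_of_ae (hnn _ _)) hN0
            (by linarith)) (Real.rpow_le_rpow hJ0' hJle hμ0) (by positivity) (by positivity)
      _ = _ := by
          rw [← Real.rpow_mul hM0, hqs, Real.rpow_add_of_nonneg hM0 (by linarith) (by positivity)]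
  rcases hW0.eq_or_lt with hW1 | hW1
  · rw [← hW1, Real.zero_rpow (by positivity)]
    positivity
  set X := remainderTerm p H D U δ u
  set Y := weakHardyTerm p D U δ u
  have hWs : W ^ (1 / q) * W ^ ((p - 1) / p) ≤ C * (N1 + N2) := by
    have h1 := Real.rpow_le_rpow hW0 hWle (show 0 ≤ s / q by positivity)
    rw [← Real.rpow_mul hM0, div_mul_div_cancel₀ hs0.ne', div_self hq0.ne', Real.rpow_one] at h1
    rw [← Real.rpow_add hW1]
    refine le_trans (le_of_eq ?_) h1
    congr 1
    rw [hsdef]; field_simp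
  have hWq : W ^ (1 / q) ≤ 2 * C * (X + Y) ^ (1 / p) := by
    have hWp : 0 < W ^ ((p - 1) / p) := Real.rpow_pos_of_pos hW1 _
    have hx1 : X ^ (1 / p) ≤ (X + Y) ^ (1 / p) :=
      Real.rpow_le_rpow hX0 (by linarith) (by positivity)
    have hy1 : Y ^ (1 / p) ≤ (X + Y) ^ (1 / p) :=
      Real.rpow_le_rpow hY0 (by linarith) (by positivity)
    refine le_of_mul_le_mul_right (hWs.trans ?_) hWp
    calc C * (N1 + N2)
        ≤ C * (X ^ (1 / p) * W ^ ((p - 1) / p) + Y ^ (1 / p) * W ^ ((p - 1) / p)) := by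
          gcongr
      _ ≤ C * ((X + Y) ^ (1 / p) * W ^ ((p - 1) / p) + (X + Y) ^ (1 / p) * W ^ ((p - 1) / p)) := by
          gcongr
      _ = _ := by ring
  have hfin := Real.rpow_le_rpow (by positivity) hWq hp0.le
  rw [← Real.rpow_mul hW0, Real.mul_rpow (by positivity) (by positivity),
    ← Real.rpow_mul (by linarith), one_div_mul_cancel hp0.ne', Real.rpow_one,
    one_div_mul_eq_div] at hfin
  exact hfin

end WeightedSobolev

/-! ### The distance to a surface, and the inequalities in thin tubes -/

section Surface

variable {n : ℕ}

lemma norm_gradient_eq_norm_fderiv (f : E n → ℝ) (x : E n) : ‖gradient f x‖ = ‖fderiv ℝ f x‖ := by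
  simp [gradient]

/-- The eikonal equation for the distance to a closed set. -/
lemma norm_gradient_infDist {K : Set (E n)} (hK : IsClosed K) (hne : K.Nonempty) {x : E n}
    (hx : x ∉ K) (hd : DifferentiableAt ℝ (d K) x) : ‖gradient (d K) x‖ = 1 := by
  rw [norm_gradient_eq_norm_fderiv]
  apply le_antisymm
  · simpa using norm_fderiv_le_of_lipschitz ℝ (f := d K) (x₀ := x) (Metric.lipschitz_infDist_pt K)
  obtain ⟨y, hyK, hy⟩ := hK.exists_infDist_eq_dist hne x
  have hpos : 0 < d K x := (hK.notMem_iff_infDist_pos hne).1 hx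
  -- `d` decreases at unit speed on the segment from `x` to its nearest point `y`
  have hline : HasDerivAt (fun t : ℝ => d K (x + t • (y - x))) (fderiv ℝ (d K) x (y - x)) 0 := by
    have h1 : HasDerivAt (fun t : ℝ => x + t • (y - x)) (y - x) 0 := by
      simpa using ((hasDerivAt_id (0 : ℝ)).smul_const (y - x)).const_add x
    have h2 : HasFDerivAt (d K) (fderiv ℝ (d K) x) (x + (0 : ℝ) • (y - x)) := by
      simpa using hd.hasFDerivAt
    exact h2.comp_hasDerivAt 0 h1
  have hslope := hline.tendsto_slope_zero_right
  have hle : fderiv ℝ (d K) x (y - x) ≤ -d K x := by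
    refine le_of_tendsto hslope ?_
    filter_upwards [Ioo_mem_nhdsGT (show (0 : ℝ) < 1 by norm_num)] with t ht
    have h1 : d K (x + t • (y - x)) ≤ (1 - t) * d K x := by
      refine (Metric.infDist_le_dist_of_mem hyK).trans (le_of_eq ?_)
      have : x + t • (y - x) - y = (1 - t) • (x - y) := by
        module
      rw [dist_eq_norm, this, norm_smul, Real.norm_of_nonneg (by linarith [ht.2]), d, hy,
        dist_eq_norm]
    simp only [zero_add, zero_smul, add_zero, smul_eq_mul]
    rw [inv_mul_le_iff₀ ht.1]
    linarith
  have h2 := (fderiv ℝ (d K) x).le_opNorm (y - x)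
  have h3 : ‖y - x‖ = d K x := by rw [d, hy, dist_comm, dist_eq_norm]
  rw [h3, Real.norm_eq_abs] at h2
  have h4 := neg_abs_le (fderiv ℝ (d K) x (y - x))
  have h5 : 1 * d K x ≤ ‖fderiv ℝ (d K) x‖ * d K x := by linarith
  exact le_of_mul_le_mul_right h5 hpos

lemma IsDomainWithSurface.nonempty {k : ℕ} {Ω K : Set (E n)} (h : IsDomainWithSurface n k Ω K)
    (hk : 1 ≤ k) (hkn : k < n) : K.Nonempty := by
  rcases hk.eq_or_lt with h1 | h1
  · rw [h.eq_frontier h1.symm]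
    by_contra hne
    rw [not_nonempty_iff_eq_empty, ← isClopen_iff_frontier_eq_empty] at hne
    have : Nonempty (Fin n) := ⟨⟨0, by omega⟩⟩
    rcases isClopen_iff.1 hne with h0 | h0
    · exact h.isConnected.nonempty.ne_empty h0
    · have hb := h.isBounded
      rw [h0] at hb
      exact NormedSpace.unbounded_univ ℝ (E n) hb
  · exact (h.meets h1).mono inter_subset_left

/-- The distance to the surface is a tubular function. -/
lemma isTubular_d {k : ℕ} {Ω K : Set (E n)} (h : IsDomainWithSurface n k Ω K)
    (hne : K.Nonempty) {c r : ℝ}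
    (hR : ∀ x ∈ tube Ω K r \ K, ContDiffAt ℝ 2 (d K) x ∧
      |d K x * Laplacian.laplacian (d K) x + 1 - (k : ℝ)| ≤ c * d K x) :
    IsTubular k c (d K) (Ω \ K) r where
  isOpen := h.isOpen.sdiff h.isC2Surface.isClosed
  continuous := Metric.continuous_infDist_pt K
  pos := fun x hx => (h.isC2Surface.isClosed.notMem_iff_infDist_pos hne).1 hx.2
  contDiffAt := fun x hx hxr => (hR x ⟨⟨hx.1, hxr.le⟩, hx.2⟩).1
  norm_gradient := fun x hx hxr => norm_gradient_infDist h.isC2Surface.isClosed hne hx.2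
    ((hR x ⟨⟨hx.1, hxr.le⟩, hx.2⟩).1.differentiableAt (by norm_num))
  abs_laplacian_le := fun x hx hxr => (hR x ⟨⟨hx.1, hxr.le⟩, hx.2⟩).2

lemma measurableSet_tube {Ω K : Set (E n)} (hΩ : IsOpen Ω) (δ : ℝ) : MeasurableSet (tube Ω K δ) :=
  hΩ.measurableSet.inter ((Metric.continuous_infDist_pt K).measurable measurableSet_Iic)

lemma setIntegral_tube {Ω K : Set (E n)} (hΩ : IsOpen Ω) (δ : ℝ) {f : E n → ℝ}
    (hf : ∀ x ∈ K, f x = 0) :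
    ∫ x in tube Ω K δ, f x = ∫ x in sublevel (d K) (Ω \ K) δ, f x := by
  refine setIntegral_eq_of_subset_of_forall_sdiff_eq_zero (measurableSet_tube hΩ δ)
    (fun x hx => ⟨hx.1.1, hx.2⟩) fun x hx => hf x ?_
  by_contra hxK
  exact hx.2 ⟨⟨hx.1.1, hxK⟩, hx.1.2⟩

section Test

variable {k : ℕ} {Ω K : Set (E n)} {u : E n → ℝ} {δ p q : ℝ}

lemma IsTestFunction.eq_zero (hu : IsTestFunction (Ω \ K) u) {x : E n} (hx : x ∈ K) :
    u x = 0 ∧ gradient u x = 0 := by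
  have : x ∉ tsupport u := fun h => (hu.2.2 h).2 hx
  exact ⟨image_eq_zero_of_notMem_tsupport this, gradient_eq_zero_of_notMem_tsupport this⟩

lemma hardyFunctional_eq_tubeHardy (hΩ : IsOpen Ω) (hu : IsTestFunction (Ω \ K) u) (hp : 0 < p) :
    hardyFunctional k p K (tube Ω K δ) u = tubeHardy p ((p - k) / p) (d K) (Ω \ K) δ u := by
  rw [hardyFunctional, tubeHardy, setIntegral_tube hΩ, setIntegral_tube hΩ]
  · intro x hx
    simp [(hu.eq_zero hx).1, Real.zero_rpow hp.ne']
  · intro x hx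
    simp [(hu.eq_zero hx).2, Real.zero_rpow hp.ne']

lemma weightedNormPow_eq (hΩ : IsOpen Ω) (hu : IsTestFunction (Ω \ K) u) (hq : 0 < q) :
    weightedNormPow p q K (tube Ω K δ) u = (∫ x in sublevel (d K) (Ω \ K) δ,
      d K x ^ (-q + (q - p) / p * n) * |u x| ^ q) ^ (p / q) := by
  rw [weightedNormPow, setIntegral_tube hΩ]
  intro x hx
  simp [(hu.eq_zero hx).1, Real.zero_rpow hq.ne']

lemma integral_tube_abs_rpow (hΩ : IsOpen Ω) (hu : IsTestFunction (Ω \ K) u) (hp : 0 < p) :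
    ∫ x in tube Ω K δ, |u x| ^ p = ∫ x in sublevel (d K) (Ω \ K) δ, |u x| ^ p := by
  rw [setIntegral_tube hΩ]
  intro x hx
  simp [(hu.eq_zero hx).1, Real.zero_rpow hp.ne']

end Test

/-- The Hardy–Sobolev inequalities in thin tubes. The constant `C q` is obtained before `Ω` and `K`
are chosen; the width `δ₀` is limited by the constants of condition (R) only, and not by `q`. -/
lemma hardySobolev_tube (n k : ℕ) (p : ℝ) (hk : 1 ≤ k) (hkn : k < n) (hp : 2 ≤ p) (hpn : p < n) :
    ∃ C : ℝ → ℝ, (∀ q : ℝ, p < q → q ≤ n * p / (n - p) → 0 < C q) ∧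
      ∀ Ω K : Set (E n), IsDomainWithSurface n k Ω K → ConditionR k Ω K →
        ∃ δ₀ : ℝ, 0 < δ₀ ∧ ∀ q : ℝ, p < q → q ≤ n * p / (n - p) →
          ∀ δ : ℝ, 0 < δ → δ ≤ δ₀ →
            ((k : ℝ) < p → ∀ u : E n → ℝ, IsTestFunction (Ω \ K) u →
              hardyFunctional k p K (tube Ω K δ) u ≥
                C q * weightedNormPow p q K (tube Ω K δ) u) ∧
            (p < (k : ℝ) → ∃ M : ℝ, 0 < M ∧
              ∀ u : E n → ℝ, IsTestFunction (Ω \ K) u →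
                hardyFunctional k p K (tube Ω K δ) u + M * ∫ x in tube Ω K δ, |u x| ^ p ≥
                  C q * weightedNormPow p q K (tube Ω K δ) u) ∧
            (p ≠ (k : ℝ) → ∀ u : E n → ℝ,
              IsTestFunction (tube Ω K δ \ K) u →
              hardyFunctional k p K (tube Ω K δ) u ≥
                C q * weightedNormPow p q K (tube Ω K δ) u) := by
  have hp0 : 0 < p := by linarith
  set H : ℝ := (p - k) / p with hHdef
  have hH : p * H = p - k := by rw [hHdef]; field_simp
  have hkn' : (k : ℝ) < n := by exact_mod_cast hkn
  obtain ⟨t, c₁, M, ht, hc₁, hM, ht4, hhardy⟩ := exists_tubeHardy_ge hp H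
  have hq : ∀ q : ℝ, ∃ C : ℝ, 0 < C ∧ (p < q → q ≤ n * p / (n - p) →
      ∀ {D : E n → ℝ} {U : Set (E n)} {r δ : ℝ} {u : E n → ℝ} {c : ℝ},
      IsTubularPair k c D U r δ u → c * δ ≤ 1 →
      C * (∫ x in sublevel D U δ, D x ^ (-q + (q - p) / p * n) * |u x| ^ q) ^ (p / q) ≤
        c₁ * (remainderTerm p H D U δ u + weakHardyTerm p D U δ u)) := by
    intro q
    by_cases h : p < q ∧ q ≤ n * p / (n - p)
    · obtain ⟨C, hC, hS⟩ := exists_weightedSobolev (by omega) hp hpn hkn' hH h.1 h.2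
      refine ⟨c₁ / C, by positivity, fun _ _ D U r δ u c hT hc => ?_⟩
      rw [div_mul_eq_mul_div, div_le_iff₀ hC]
      have := mul_le_mul_of_nonneg_left (hS hT hc) hc₁.le
      linarith
    · exact ⟨1, one_pos, fun h1 h2 => absurd ⟨h1, h2⟩ h⟩
  choose C hC hCq using hq
  refine ⟨C, fun q _ _ => hC q, fun Ω K hΩK hR => ?_⟩
  obtain ⟨c₀, hc₀, δs, hδs, hR⟩ := hR
  have hTub := isTubular_d hΩK (hΩK.nonempty hk hkn) (hR δs hδs le_rfl)
  refine ⟨min (δs / 2) (t / c₀), by positivity, fun q hpq hqn δ hδ hδ₀ => ?_⟩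
  have hδs' : δ < δs := by
    have := hδ₀.trans (min_le_left _ _)
    linarith
  have hct : c₀ * δ ≤ t := by
    have := hδ₀.trans (min_le_right _ _)
    rw [le_div_iff₀ hc₀] at this
    linarith
  have hc1 : c₀ * δ ≤ 1 := by linarith
  have hq0 : 0 < q := by linarith
  have hΩ := hΩK.isOpen
  have hpair : ∀ u : E n → ℝ, IsTestFunction (Ω \ K) u →
      IsTubularPair k c₀ (d K) (Ω \ K) δs δ u := fun u hu =>
    { toIsTubular := hTub
      nonneg := hc₀.le
      δ_pos := hδ
      δ_lt := hδs'
      contDiff := hu.1.of_le (by exact_mod_cast le_top)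
      hasCompactSupport := hu.2.1
      tsupport_subset := hu.2.2 }
  refine ⟨fun hkp u hu => ?_, fun _ => ⟨M * δ ^ (-p), by positivity, fun u hu => ?_⟩,
    fun _ u hu => ?_⟩
  · have hT := hpair u hu
    have hHpos : 0 < H := div_pos (by linarith) hp0
    rw [hardyFunctional_eq_tubeHardy hΩ hu hp0, weightedNormPow_eq hΩ hu hq0]
    exact (hCq q hpq hqn hT hc1).trans ((hhardy hH hT hct).1 hHpos)
  · have hT := hpair u hu
    rw [hardyFunctional_eq_tubeHardy hΩ hu hp0, weightedNormPow_eq hΩ hu hq0,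
      integral_tube_abs_rpow hΩ hu hp0, mul_assoc]
    exact (hCq q hpq hqn hT hc1).trans (hhardy hH hT hct).2.1
  · have hu' : IsTestFunction (Ω \ K) u :=
      ⟨hu.1, hu.2.1, hu.2.2.trans (Set.sdiff_subset_sdiff_left fun x hx => hx.1)⟩
    have hT := hpair u hu'
    rw [hardyFunctional_eq_tubeHardy hΩ hu' hp0, weightedNormPow_eq hΩ hu' hq0]
    refine (hCq q hpq hqn hT hc1).trans ((hhardy hH hT hct).2.2 fun x hx => ?_)
    exact image_eq_zero_of_notMem_tsupport fun h => absurd (hu.2.2 h).1.2 (not_le.2 hx)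

end Surface

/-! ### The distance to a sphere of higher codimension -/

section SphereDistance

section Laplacian

variable {n : ℕ}

lemma laplacian_eq_sum_fderiv_fderiv {ι : Type*} [Fintype ι] (e : OrthonormalBasis ι ℝ (E n))
    {f : E n → ℝ} {x : E n} (hf : ContDiffAt ℝ 2 f x) :
    Laplacian.laplacian f x = ∑ i, fderiv ℝ (fun y => fderiv ℝ f y (e i)) x (e i) := by
  rw [InnerProductSpace.laplacian_eq_iteratedFDeriv_orthonormalBasis f e]
  refine Finset.sum_congr rfl fun i _ => ?_
  have hd : DifferentiableAt ℝ (fderiv ℝ f) x :=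
    (hf.fderiv_right (m := 1) (by norm_num)).differentiableAt (by norm_num)
  rw [fderiv_clm_apply hd (differentiableAt_const _)]
  simp [iteratedFDeriv_two_apply]

/-- The Laplacian of a square. -/
lemma laplacian_sq {f : E n → ℝ} {x : E n} (hf : ContDiffAt ℝ 2 f x) :
    Laplacian.laplacian (fun y => f y ^ 2) x =
      2 * (f x * Laplacian.laplacian f x) + 2 * ‖gradient f x‖ ^ 2 := by
  set e := stdOrthonormalBasis ℝ (E n)
  rw [laplacian_eq_sum_fderiv_fderiv e (hf.pow 2), laplacian_eq_sum_fderiv_fderiv e hf,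
    ← e.sum_sq_norm_inner_right, Finset.mul_sum, Finset.mul_sum, Finset.mul_sum,
    ← Finset.sum_add_distrib]
  refine Finset.sum_congr rfl fun i _ => ?_
  have hev : (fun y => fderiv ℝ (fun y => f y ^ 2) y (e i)) =ᶠ[𝓝 x]
      fun y => 2 * f y * fderiv ℝ f y (e i) := by
    filter_upwards [hf.eventually (by simp)] with y hy
    have hd : DifferentiableAt ℝ f y := hy.differentiableAt (by norm_num)
    rw [(hd.hasFDerivAt.pow 2).fderiv]
    simp
  have hd : DifferentiableAt ℝ f x := hf.differentiableAt (by norm_num)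
  have hd2 : DifferentiableAt ℝ (fun y => fderiv ℝ f y (e i)) x :=
    ((hf.fderiv_right (m := 1) (by norm_num)).differentiableAt (by norm_num)).clm_apply
      (differentiableAt_const _)
  have h1 : HasFDerivAt (fun y => 2 * f y * fderiv ℝ f y (e i))
      ((2 * f x) • fderiv ℝ (fun y => fderiv ℝ f y (e i)) x +
        (fderiv ℝ f x (e i)) • ((2 : ℝ) • fderiv ℝ f x)) x :=
    (hd.hasFDerivAt.const_mul 2).mul hd2.hasFDerivAt
  rw [hev.fderiv_eq, h1.fderiv, real_inner_comm, inner_gradient, Real.norm_eq_abs, sq_abs]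
  simp
  ring

/-- The Laplacian of the square norm of a linear map is twice the square of its Hilbert–Schmidt
norm. -/
lemma laplacian_norm_sq_clm {ι : Type*} [Fintype ι] (e : OrthonormalBasis ι ℝ (E n)) {m : ℕ}
    (P : E n →L[ℝ] E m) (x : E n) :
    Laplacian.laplacian (fun y => ‖P y‖ ^ 2) x = 2 * ∑ i, ‖P (e i)‖ ^ 2 := by
  have hf : ContDiff ℝ 2 (fun y => ‖P y‖ ^ 2) := P.contDiff.norm_sq ℝ
  rw [laplacian_eq_sum_fderiv_fderiv e hf.contDiffAt, Finset.mul_sum]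
  refine Finset.sum_congr rfl fun i _ => ?_
  have h1 : (fun y => fderiv ℝ (fun y => ‖P y‖ ^ 2) y (e i)) =
      fun y => 2 * inner ℝ (P (e i)) (P y) := by
    funext y
    rw [(P.hasFDerivAt (x := y)).norm_sq.fderiv]
    simp [real_inner_comm]
  rw [h1]
  have h2 : HasFDerivAt (fun y => 2 * inner ℝ (P (e i)) (P y))
      ((2 : ℝ) • (innerSL ℝ (P (e i))).comp P) x :=
    ((innerSL ℝ (P (e i))).comp P).hasFDerivAt.const_mul 2
  rw [h2.fderiv]
  simp

end Laplacian

section Sphere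

variable {a j : ℕ}

/-- The splitting `ℝ^{a+j} = ℝ^a × ℝ^j`. -/
noncomputable def split (a j : ℕ) : E (a + j) ≃L[ℝ] E a × E j := EuclideanSpace.finAddEquivProd

/-- The projection to the first `a` coordinates. -/
noncomputable def projHead (a j : ℕ) : E (a + j) →L[ℝ] E a :=
  (ContinuousLinearMap.fst ℝ (E a) (E j)).comp (split a j : E (a + j) →L[ℝ] E a × E j)

/-- The projection to the last `j` coordinates. -/
noncomputable def projTail (a j : ℕ) : E (a + j) →L[ℝ] E j :=
  (ContinuousLinearMap.snd ℝ (E a) (E j)).comp (split a j : E (a + j) →L[ℝ] E a × E j)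

lemma projHead_apply (x : E (a + j)) (i : Fin a) : projHead a j x i = x (Fin.castAdd j i) := by
  simp [projHead, split, EuclideanSpace.sumEquivProd, PiLp.sumPiLpEquivProdLpPiLp]

lemma projTail_apply (x : E (a + j)) (i : Fin j) : projTail a j x i = x (Fin.natAdd a i) := by
  simp [projTail, split, EuclideanSpace.sumEquivProd, PiLp.sumPiLpEquivProdLpPiLp]

lemma projHead_symm (y : E a) (z : E j) : projHead a j ((split a j).symm (y, z)) = y := by
  simp [projHead]

lemma projTail_symm (y : E a) (z : E j) : projTail a j ((split a j).symm (y, z)) = z := by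
  simp [projTail]

lemma norm_sq_eq (x : E (a + j)) : ‖x‖ ^ 2 = ‖projHead a j x‖ ^ 2 + ‖projTail a j x‖ ^ 2 := by
  simp only [EuclideanSpace.norm_sq_eq, Fin.sum_univ_add, projHead_apply, projTail_apply]

lemma laplacian_norm_sq_projHead (x : E (a + j)) :
    Laplacian.laplacian (fun y => ‖projHead a j y‖ ^ 2) x = 2 * a := by
  rw [laplacian_norm_sq_clm (EuclideanSpace.basisFun (Fin (a + j)) ℝ)]
  congr 1
  have h1 : ∀ i : Fin a,
      ‖projHead a j (EuclideanSpace.basisFun (Fin (a + j)) ℝ (Fin.castAdd j i))‖ ^ 2 = 1 := by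
    intro i
    rw [EuclideanSpace.norm_sq_eq]
    simp [projHead_apply]
  have h2 : ∀ i : Fin j,
      ‖projHead a j (EuclideanSpace.basisFun (Fin (a + j)) ℝ (Fin.natAdd a i))‖ ^ 2 = 0 := by
    intro i
    rw [EuclideanSpace.norm_sq_eq]
    simp only [projHead_apply, EuclideanSpace.basisFun_apply]
    refine Finset.sum_eq_zero fun l _ => ?_
    have : Fin.castAdd j l ≠ Fin.natAdd a i := by
      intro h
      have := congrArg Fin.val h
      simp at this
      omega
    simp [this]
  simp only [Fin.sum_univ_add, h1, h2]
  simp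

/-- The unit sphere of the first `a` coordinates, a compact surface of dimension `a - 1`. -/
def unitSphere (a j : ℕ) : Set (E (a + j)) := {x | ‖projHead a j x‖ = 1 ∧ projTail a j x = 0}

lemma isCompact_unitSphere (a j : ℕ) : IsCompact (unitSphere a j) := by
  refine Metric.isCompact_of_isClosed_isBounded ?_ ?_
  · exact (isClosed_eq (projHead a j).continuous.norm continuous_const).inter
      (isClosed_eq (projTail a j).continuous continuous_const)
  · refine (Metric.isBounded_closedBall (x := 0) (r := 1)).subset fun x hx => ?_
    have := norm_sq_eq x
    rw [hx.1, hx.2] at this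
    rw [mem_closedBall_zero_iff]
    nlinarith [norm_nonneg x, norm_zero (E := E j)]

lemma norm_of_mem_unitSphere {x : E (a + j)} (hx : x ∈ unitSphere a j) : ‖x‖ = 1 := by
  have := norm_sq_eq x
  rw [hx.1, hx.2, norm_zero] at this
  have h0 := norm_nonneg x
  nlinarith

lemma unitSphere_nonempty (ha : 1 ≤ a) : (unitSphere a j).Nonempty := by
  refine ⟨(split a j).symm (EuclideanSpace.single ⟨0, ha⟩ 1, 0), ?_, ?_⟩
  · rw [projHead_symm]; simp
  · rw [projTail_symm]

/-- The square of the distance to a point of the sphere. -/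
lemma dist_sq_of_mem_unitSphere (x : E (a + j)) {y : E (a + j)} (hy : y ∈ unitSphere a j) :
    dist x y ^ 2 = ‖x‖ ^ 2 - 2 * inner ℝ (projHead a j x) (projHead a j y) + 1 := by
  rw [dist_eq_norm, norm_sq_eq (x - y), map_sub, map_sub, hy.2, sub_zero, @norm_sub_sq_real,
    hy.1, norm_sq_eq x]
  ring

lemma le_dist_sq (x : E (a + j)) {y : E (a + j)} (hy : y ∈ unitSphere a j) :
    ‖x‖ ^ 2 - 2 * ‖projHead a j x‖ + 1 ≤ dist x y ^ 2 := by
  rw [dist_sq_of_mem_unitSphere x hy]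
  have := real_inner_le_norm (projHead a j x) (projHead a j y)
  rw [hy.1, mul_one] at this
  linarith

lemma le_d_sq (ha : 1 ≤ a) (x : E (a + j)) :
    ‖x‖ ^ 2 - 2 * ‖projHead a j x‖ + 1 ≤ d (unitSphere a j) x ^ 2 := by
  obtain ⟨y, hy, h⟩ := (isCompact_unitSphere a j).isClosed.exists_infDist_eq_dist
    (unitSphere_nonempty ha) x
  rw [d, h]
  exact le_dist_sq x hy

lemma d_sq_eq (ha : 1 ≤ a) {x : E (a + j)} (hx : projHead a j x ≠ 0) :
    d (unitSphere a j) x ^ 2 = ‖x‖ ^ 2 - 2 * ‖projHead a j x‖ + 1 := by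
  apply le_antisymm _ (le_d_sq ha x)
  have hx0 : ‖projHead a j x‖ ≠ 0 := norm_ne_zero_iff.2 hx
  set y := (split a j).symm (‖projHead a j x‖⁻¹ • projHead a j x, 0) with hy
  have hyK : y ∈ unitSphere a j := by
    refine ⟨?_, ?_⟩
    · rw [hy, projHead_symm, norm_smul, norm_inv, norm_norm, inv_mul_cancel₀ hx0]
    · rw [hy, projTail_symm]
  have h1 : d (unitSphere a j) x ≤ dist x y := Metric.infDist_le_dist_of_mem hyK
  have h2 := dist_sq_of_mem_unitSphere x hyK
  rw [hy, projHead_symm, inner_smul_right, real_inner_self_eq_norm_sq, ← hy] at h2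
  have h3 : ‖projHead a j x‖⁻¹ * ‖projHead a j x‖ ^ 2 = ‖projHead a j x‖ := by field_simp
  rw [h3] at h2
  rw [← h2]
  have h0 : 0 ≤ d (unitSphere a j) x := Metric.infDist_nonneg
  gcongr

lemma abs_norm_projHead_sub_one_le (ha : 1 ≤ a) (x : E (a + j)) :
    |‖projHead a j x‖ - 1| ≤ d (unitSphere a j) x ∧ ‖projTail a j x‖ ≤ d (unitSphere a j) x := by
  have h1 := le_d_sq (j := j) ha x
  rw [norm_sq_eq x] at h1
  have h0 : 0 ≤ d (unitSphere a j) x := Metric.infDist_nonneg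
  constructor
  · apply abs_le_of_sq_le_sq _ h0
    nlinarith [sq_nonneg ‖projTail a j x‖]
  · apply le_of_sq_le_sq _ h0
    nlinarith [sq_nonneg (‖projHead a j x‖ - 1)]

lemma projHead_ne_zero (ha : 1 ≤ a) {x : E (a + j)} (hx : d (unitSphere a j) x < 1) :
    projHead a j x ≠ 0 := by
  intro h
  have := (abs_norm_projHead_sub_one_le ha x).1
  rw [h] at this
  norm_num at this
  linarith

lemma contDiffAt_d (ha : 1 ≤ a) {x : E (a + j)} (hx : d (unitSphere a j) x < 1)
    (hx0 : 0 < d (unitSphere a j) x) : ContDiffAt ℝ ∞ (d (unitSphere a j)) x := by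
  have hne := projHead_ne_zero ha hx
  have hev : d (unitSphere a j) =ᶠ[𝓝 x] fun y => √(‖y‖ ^ 2 - 2 * ‖projHead a j y‖ + 1) := by
    filter_upwards [(projHead a j).continuous.continuousAt.eventually_ne hne] with y hy
    rw [← d_sq_eq ha hy, Real.sqrt_sq (show 0 ≤ d _ y from Metric.infDist_nonneg)]
  refine ContDiffAt.congr_of_eventuallyEq ?_ hev
  have h1 : ContDiffAt ℝ ∞ (fun y : E (a + j) => ‖y‖ ^ 2 - 2 * ‖projHead a j y‖ + 1) x :=
    ((contDiff_norm_sq ℝ).contDiffAt.sub (contDiffAt_const.mul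
      ((projHead a j).contDiff.contDiffAt.norm ℝ hne))).add contDiffAt_const
  refine h1.sqrt ?_
  rw [← d_sq_eq ha hne]
  positivity

/-- The Laplacian of the distance to the sphere. -/
lemma d_mul_laplacian_d (ha : 1 ≤ a) {x : E (a + j)} (hx : d (unitSphere a j) x < 1)
    (hx0 : 0 < d (unitSphere a j) x) :
    d (unitSphere a j) x * Laplacian.laplacian (d (unitSphere a j)) x =
      (a + j : ℝ) - 1 - (a - 1) / ‖projHead a j x‖ := by
  have hne := projHead_ne_zero ha hx
  have hN0 : ‖projHead a j x‖ ≠ 0 := norm_ne_zero_iff.2 hne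
  have hd := (contDiffAt_d ha hx hx0).of_le
    (WithTop.coe_le_coe.2 le_top : ((2 : ℕ∞) : WithTop ℕ∞) ≤ ∞)
  have hN : ContDiffAt ℝ 2 (fun y => ‖projHead a j y‖) x :=
    (projHead a j).contDiff.contDiffAt.norm ℝ hne
  have hgd := norm_gradient_infDist (isCompact_unitSphere a j).isClosed (unitSphere_nonempty ha)
    (fun h => hx0.ne' (Metric.infDist_zero_of_mem h)) (hd.differentiableAt (by norm_num))
  -- the gradient of the distance `‖projHead x‖` to a subspace has norm one
  have hgN : ‖gradient (fun y => ‖projHead a j y‖) x‖ ^ 2 = 1 := by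
    have hle : ‖gradient (fun y => ‖projHead a j y‖) x‖ ≤ 1 := by
      rw [norm_gradient_eq_norm_fderiv]
      have hlip : LipschitzWith 1 (fun y => ‖projHead a j y‖) := by
        refine LipschitzWith.of_le_add fun y z => ?_
        have h1 : ‖projHead a j (y - z)‖ ≤ ‖y - z‖ := by
          have := norm_sq_eq (y - z)
          exact le_of_sq_le_sq (by nlinarith [sq_nonneg ‖projTail a j (y - z)‖]) (norm_nonneg _)
        have h2 := norm_le_norm_add_norm_sub (projHead a j z) (projHead a j y)
        rw [map_sub] at h1
        rw [dist_eq_norm]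
        rw [norm_sub_rev] at h2
        linarith
      simpa using norm_fderiv_le_of_lipschitz ℝ (x₀ := x) hlip
    have hge : ‖projHead a j x‖ ≤ ‖gradient (fun y => ‖projHead a j y‖) x‖ * ‖projHead a j x‖ := by
      set v := (split a j).symm (projHead a j x, 0) with hv
      have hvn : ‖v‖ = ‖projHead a j x‖ := by
        have := norm_sq_eq v
        rw [hv, projHead_symm, projTail_symm, norm_zero, ← hv] at this
        nlinarith [norm_nonneg v, norm_nonneg (projHead a j x)]
      have h1 : HasFDerivAt (fun y => ‖projHead a j y‖ ^ 2)
          (2 • (innerSL ℝ (projHead a j x)).comp (projHead a j)) x :=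
        ((projHead a j).hasFDerivAt (x := x)).norm_sq
      have h2 := ((hN.differentiableAt (by norm_num)).hasFDerivAt.pow 2)
      have h3 := congrArg (fun l => l v) (h1.unique h2)
      simp [hv, projHead_symm] at h3
      rw [← hv] at h3
      have h4 : fderiv ℝ (fun y => ‖projHead a j y‖) x v = ‖projHead a j x‖ := by
        apply mul_left_cancel₀ hN0
        nlinarith
      have h5 := (fderiv ℝ (fun y => ‖projHead a j y‖) x).le_opNorm v
      rw [h4, norm_norm, hvn, ← norm_gradient_eq_norm_fderiv] at h5
      exact h5
    have : 1 ≤ ‖gradient (fun y => ‖projHead a j y‖) x‖ := by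
      have hp : 0 < ‖projHead a j x‖ := norm_pos_iff.2 hne
      exact le_of_mul_le_mul_right (by linarith) hp
    rw [le_antisymm hle this, one_pow]
  have l1 := laplacian_sq hd
  have l2 := laplacian_sq hN
  rw [hgd] at l1
  rw [hgN, laplacian_norm_sq_projHead] at l2
  have l3 : Laplacian.laplacian (fun y => d (unitSphere a j) y ^ 2) x =
      2 * (a + j : ℝ) - 2 * Laplacian.laplacian (fun y => ‖projHead a j y‖) x := by
    have hev : (fun y => d (unitSphere a j) y ^ 2) =ᶠ[𝓝 x]
        ((fun y : E (a + j) => ‖y‖ ^ 2) + (-2 : ℝ) • (fun y => ‖projHead a j y‖)) + fun _ => 1 := by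
      filter_upwards [(projHead a j).continuous.continuousAt.eventually_ne hne] with y hy
      simp only [Pi.add_apply, Pi.smul_apply, smul_eq_mul]
      rw [d_sq_eq ha hy]; ring
    have c1 : ContDiffAt ℝ 2 (fun y : E (a + j) => ‖y‖ ^ 2) x := (contDiff_norm_sq ℝ).contDiffAt
    have c2 : ContDiffAt ℝ 2 ((-2 : ℝ) • (fun y => ‖projHead a j y‖)) x := hN.const_smul (-2 : ℝ)
    have c3 : ContDiffAt ℝ 2 ((fun y : E (a + j) => ‖y‖ ^ 2) +
        (-2 : ℝ) • (fun y => ‖projHead a j y‖)) x := c1.add c2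
    have hn : Laplacian.laplacian (fun y : E (a + j) => ‖y‖ ^ 2) x = 2 * (a + j : ℝ) := by
      have := laplacian_norm_sq_clm (EuclideanSpace.basisFun (Fin (a + j)) ℝ)
        (ContinuousLinearMap.id ℝ (E (a + j))) x
      simpa using this
    rw [(InnerProductSpace.laplacian_congr_nhds hev).eq_of_nhds,
      c3.laplacian_add contDiffAt_const, c1.laplacian_add c2,
      InnerProductSpace.laplacian_smul _ hN, hn, InnerProductSpace.laplacian_const]
    simp
    ring
  rw [l3] at l1
  have l4 : Laplacian.laplacian (fun y => ‖projHead a j y‖) x = (a - 1) / ‖projHead a j x‖ := by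
    rw [eq_div_iff hN0]; linarith
  rw [l4] at l1
  linarith

end Sphere

end SphereDistance

/-! ### The sphere as a surface, and the volume of its tubes -/

section SphereSurface

variable {a j : ℕ}

/-- The unit sphere of `ℝ^a`, in `ℝ^{a+j}`, is a surface of codimension `1 + j`: it is the zero set
of `x ↦ (‖y‖² - 1, z)`, where `y` is the head and `z` is the tail of `x`. -/
lemma isC2Surface_unitSphere (a j : ℕ) : IsC2Surface (a + j) (1 + j) (unitSphere a j) := by
  refine ⟨(isCompact_unitSphere a j).isClosed, fun x₀ hx₀ => ?_⟩
  set e : E 1 := EuclideanSpace.single 0 1 with he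
  set g : E (a + j) → E (1 + j) := fun x =>
    (split 1 j).symm ((‖projHead a j x‖ ^ 2 - 1) • e, projTail a j x) with hg
  have hsm : ContDiff ℝ 2 g := by
    have h1 : ContDiff ℝ 2 fun x => ‖projHead a j x‖ ^ 2 - 1 :=
      ((projHead a j).contDiff.norm_sq ℝ).sub contDiff_const
    have h2 : ContDiff ℝ 2 fun x => (‖projHead a j x‖ ^ 2 - 1) • e := h1.smul contDiff_const
    exact (split 1 j).symm.contDiff.comp (h2.prodMk (projTail a j).contDiff)
  refine ⟨{x | projHead a j x ≠ 0}, g,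
    isOpen_ne_fun (projHead a j).continuous continuous_const, ?_, hsm.contDiffOn, ?_, ?_⟩
  · intro h
    have := hx₀.1
    rw [h, norm_zero] at this
    exact zero_ne_one this
  · intro x hx w
    have hx0 : ‖projHead a j x‖ ≠ 0 := norm_ne_zero_iff.2 hx
    have h1 : HasFDerivAt (fun y => ‖projHead a j y‖ ^ 2 - 1)
        (2 • (innerSL ℝ (projHead a j x)).comp (projHead a j)) x :=
      ((projHead a j).hasFDerivAt (x := x)).norm_sq.sub_const 1
    have h2 := (split 1 j).symm.hasFDerivAt.comp x
      ((h1.smul_const e).prodMk (projTail a j).hasFDerivAt)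
    have h3 : fderiv ℝ g x = _ := h2.fderiv
    set w' := split 1 j w with hw'
    have hw1 : w'.1 = (w'.1 0) • e := by
      ext i
      fin_cases i
      simp [he]
    refine ⟨(split a j).symm ((w'.1 0 / (2 * ‖projHead a j x‖ ^ 2)) • projHead a j x, w'.2), ?_⟩
    rw [h3]
    have h4 : (2 * (w'.1 0 / (2 * ‖projHead a j x‖ ^ 2) * ‖projHead a j x‖ ^ 2)) = w'.1 0 := by
      field_simp
    apply (split 1 j).injective
    rw [← hw']
    refine Prod.ext ?_ ?_
    · rw [hw1]
      have he1 : e 0 = 1 := by simp [he]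
      simp [projHead_symm, he1]
      rw [h4]
    · simp [projTail_symm]
  · ext x
    simp only [unitSphere, mem_inter_iff, Set.mem_ofPred_eq, hg]
    constructor
    · rintro ⟨⟨h1, h2⟩, h3⟩
      refine ⟨h3, ?_⟩
      rw [h1, h2]
      simp
    · rintro ⟨h3, h4⟩
      have h5 := (split 1 j).symm.map_eq_zero_iff.1 h4
      rw [Prod.mk_eq_zero] at h5
      have he0 : e ≠ 0 := by simp [he]
      refine ⟨⟨?_, h5.2⟩, h3⟩
      have h6 := (smul_eq_zero.1 h5.1).resolve_right he0
      have h7 := norm_nonneg (projHead a j x)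
      nlinarith

lemma isDomainWithSurface_unitSphere (ha : 1 ≤ a) (hj : 1 ≤ j) :
    IsDomainWithSurface (a + j) (1 + j) (Metric.ball 0 3) (unitSphere a j) where
  isOpen := Metric.isOpen_ball
  isConnected := ⟨⟨0, by simp⟩, (convex_ball 0 3).isPreconnected⟩
  isBounded := Metric.isBounded_ball
  isC2Surface := isC2Surface_unitSphere a j
  eq_frontier := fun h => by omega
  meets := fun _ => by
    obtain ⟨x, hx⟩ := unitSphere_nonempty (j := j) ha
    refine ⟨x, hx, subset_closure ?_⟩
    rw [mem_ball_zero_iff, norm_of_mem_unitSphere hx]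
    norm_num

lemma conditionR_unitSphere (ha : 1 ≤ a) (Ω : Set (E (a + j))) :
    ConditionR (1 + j) Ω (unitSphere a j) := by
  refine ⟨2 * a, by positivity, 1 / 2, by norm_num, fun δ hδ hδ2 x hx => ?_⟩
  have hd : d (unitSphere a j) x < 1 := by
    have := hx.1.2
    linarith
  have hd0 : 0 < d (unitSphere a j) x :=
    ((isCompact_unitSphere a j).isClosed.notMem_iff_infDist_pos (unitSphere_nonempty ha)).1 hx.2
  refine ⟨(contDiffAt_d ha hd hd0).of_le
    (WithTop.coe_le_coe.2 le_top : ((2 : ℕ∞) : WithTop ℕ∞) ≤ ∞), ?_⟩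
  rw [d_mul_laplacian_d ha hd hd0]
  obtain ⟨h1, -⟩ := abs_norm_projHead_sub_one_le (j := j) ha x
  set N := ‖projHead a j x‖
  have hN : 1 / 2 ≤ N := by
    have := (abs_le.1 h1).1
    have := hx.1.2
    linarith
  have ha' : (1 : ℝ) ≤ a := by exact_mod_cast ha
  have e : (a + j : ℝ) - 1 - (a - 1) / N + 1 - ((1 + j : ℕ) : ℝ) = (a - 1) / N * (N - 1) := by
    have : N ≠ 0 := by linarith
    push_cast
    field_simp
    ring
  have h2 : (a - 1) / N ≤ 2 * a := by
    rw [div_le_iff₀ (by linarith)]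
    nlinarith
  rw [e, abs_mul, abs_of_nonneg (div_nonneg (by linarith) (by linarith))]
  exact mul_le_mul h2 h1 (abs_nonneg _) (by positivity)

/-- A tube of radius `ρ` around the sphere has volume at most a multiple of `ρ ^ (1 + j)`. -/
lemma exists_volume_tube_le (ha : 1 ≤ a) : ∃ C : ℝ, 0 ≤ C ∧ ∀ ρ : ℝ, 0 < ρ → ρ ≤ 1 →
    volume {x : E (a + j) | d (unitSphere a j) x ≤ ρ} ≤ ENNReal.ofReal (C * ρ ^ (1 + j)) := by
  have hH := (split a j).isAddHaarMeasure_map (volume : Measure (E (a + j)))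
  have hmap := Measure.isAddLeftInvariant_eq_smul
    (Measure.map (split a j) (volume : Measure (E (a + j))))
    ((volume : Measure (E a)).prod (volume : Measure (E j)))
  set c' := Measure.addHaarScalarFactor (Measure.map (split a j) (volume : Measure (E (a + j))))
    ((volume : Measure (E a)).prod (volume : Measure (E j)))
  obtain ⟨c, hcc⟩ : ∃ c : ENNReal, c = c' := ⟨_, rfl⟩
  have hc : c ≠ ⊤ := hcc ▸ ENNReal.coe_ne_top
  set ω₁ := volume (Metric.ball (0 : E a) 1)
  set ω₂ := volume (Metric.ball (0 : E j) 1)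
  have hω₁ : ω₁ ≠ ⊤ := measure_ball_lt_top.ne
  have hω₂ : ω₂ ≠ ⊤ := measure_ball_lt_top.ne
  have : Nonempty (Fin a) := ⟨⟨0, ha⟩⟩
  refine ⟨(c * ω₁ * ω₂).toReal * (2 * a * 2 ^ (a - 1)), by positivity, fun ρ hρ hρ1 => ?_⟩
  set A : Set (E a) := Metric.closedBall 0 (1 + ρ) \ Metric.ball 0 (1 - ρ) with hA
  have hAm : MeasurableSet A := Metric.isClosed_closedBall.measurableSet.diff
    Metric.isOpen_ball.measurableSet
  have hsub : {x : E (a + j) | d (unitSphere a j) x ≤ ρ} ⊆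
      split a j ⁻¹' (A ×ˢ Metric.closedBall 0 ρ) := by
    intro x hx
    obtain ⟨h1, h2⟩ := abs_norm_projHead_sub_one_le (j := j) ha x
    have h3 := abs_le.1 (h1.trans hx)
    refine ⟨⟨?_, ?_⟩, ?_⟩
    · rw [mem_closedBall_zero_iff]
      change ‖projHead a j x‖ ≤ _
      linarith
    · rw [mem_ball_zero_iff, not_lt]
      change _ ≤ ‖projHead a j x‖
      linarith
    · rw [mem_closedBall_zero_iff]
      exact h2.trans hx
  have hvA : volume A ≤ ENNReal.ofReal (ρ * (2 * a * 2 ^ (a - 1))) * ω₁ := by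
    rw [hA, measure_sdiff (Metric.ball_subset_closedBall.trans
      (Metric.closedBall_subset_closedBall (by linarith)))
      Metric.isOpen_ball.measurableSet.nullMeasurableSet measure_ball_lt_top.ne,
      Measure.addHaar_closedBall _ (r := 1 + ρ) _ (by linarith),
      Measure.addHaar_ball _ (r := 1 - ρ) _ (by linarith),
      ← ENNReal.sub_mul (fun _ _ => hω₁), ← ENNReal.ofReal_sub _ (by
        have : 0 ≤ 1 - ρ := by linarith
        positivity)]
    simp only [finrank_euclideanSpace, Fintype.card_fin]
    gcongr
    have h1 := abs_pow_sub_pow_le (1 + ρ) (1 - ρ) a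
    have h2 : max |1 + ρ| |1 - ρ| ≤ 2 := by
      rw [abs_of_nonneg (by linarith), abs_of_nonneg (by linarith)]
      exact max_le (by linarith) (by linarith)
    calc (1 + ρ) ^ a - (1 - ρ) ^ a ≤ |1 + ρ - (1 - ρ)| * a * max |1 + ρ| |1 - ρ| ^ (a - 1) :=
          (le_abs_self _).trans h1
      _ ≤ |1 + ρ - (1 - ρ)| * a * 2 ^ (a - 1) := by gcongr
      _ = ρ * (2 * a * 2 ^ (a - 1)) := by
          rw [show 1 + ρ - (1 - ρ) = 2 * ρ by ring, abs_of_nonneg (by linarith)]; ring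
  have hvB : volume (Metric.closedBall (0 : E j) ρ) = ENNReal.ofReal (ρ ^ j) * ω₂ := by
    rw [Measure.addHaar_closedBall _ _ hρ.le]
    simp [ω₂]
  calc volume {x : E (a + j) | d (unitSphere a j) x ≤ ρ}
      ≤ volume (split a j ⁻¹' (A ×ˢ Metric.closedBall 0 ρ)) := measure_mono hsub
    _ = Measure.map (split a j) volume (A ×ˢ Metric.closedBall 0 ρ) := by
        rw [Measure.map_apply (split a j).continuous.measurable
          (hAm.prod Metric.isClosed_closedBall.measurableSet)]
    _ = c * (volume A * volume (Metric.closedBall (0 : E j) ρ)) := by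
        rw [hmap, Measure.smul_apply, Measure.prod_prod, hcc, ENNReal.smul_def, smul_eq_mul]
    _ ≤ c * ((ENNReal.ofReal (ρ * (2 * a * 2 ^ (a - 1))) * ω₁) *
          (ENNReal.ofReal (ρ ^ j) * ω₂)) := by
        rw [hvB]; gcongr
    _ = (c * ω₁ * ω₂) * (ENNReal.ofReal (ρ * (2 * a * 2 ^ (a - 1))) * ENNReal.ofReal (ρ ^ j)) := by
        ring
    _ = ENNReal.ofReal ((c * ω₁ * ω₂).toReal * (2 * a * 2 ^ (a - 1)) * ρ ^ (1 + j)) := by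
        have hfin : c * ω₁ * ω₂ ≠ ⊤ := ENNReal.mul_ne_top (ENNReal.mul_ne_top hc hω₁) hω₂
        rw [← ENNReal.ofReal_mul (by positivity)]
        nth_rewrite 1 [← ENNReal.ofReal_toReal hfin]
        rw [← ENNReal.ofReal_mul ENNReal.toReal_nonneg]
        congr 1
        rw [pow_add, pow_one]
        ring

end SphereSurface

/-! ### Failure of the Hardy inequality below the codimension -/

section CounterExample

variable {a j : ℕ}

lemma exists_abs_deriv_cutoff_le : ∃ C : ℝ, 0 ≤ C ∧ ∀ δ ε t : ℝ, 0 < ε →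
    |deriv (cutoff δ ε) t| ≤ C / ε := by
  have hc : Continuous (deriv (cutoff 0 1)) := (contDiff_cutoff 0 1).continuous_deriv (by simp)
  obtain ⟨C, hC⟩ := isCompact_Icc.exists_bound_of_continuousOn (s := Icc (0 : ℝ) 1) hc.continuousOn
  refine ⟨max C 0, le_max_right _ _, fun δ ε t hε => ?_⟩
  have hb : |deriv (cutoff 0 1) ((t - δ) / ε)| ≤ max C 0 := by
    by_cases h : (t - δ) / ε ∈ Icc (0 : ℝ) 1
    · exact (hC _ h).trans (le_max_left _ _)
    · rcases le_or_gt ((t - δ) / ε) 0 with h0 | h0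
      · simp [deriv_cutoff_of_le one_pos h0]
      · have h1 : (0 : ℝ) + 1 ≤ (t - δ) / ε := by
          by_contra h1
          exact h ⟨h0.le, by linarith⟩
        simp [deriv_cutoff_of_ge one_pos h1]
  have he : cutoff δ ε = fun s => cutoff 0 1 ((s - δ) / ε) := by
    funext s
    unfold cutoff
    congr 1
    field_simp
    ring
  have hd : HasDerivAt (cutoff δ ε) (deriv (cutoff 0 1) ((t - δ) / ε) * (1 / ε)) t := by
    rw [he]
    have h1 : HasDerivAt (fun s => (s - δ) / ε) (1 / ε) t :=
      ((hasDerivAt_id t).sub_const δ).div_const ε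
    exact (((contDiff_cutoff 0 1).differentiable (by simp)).differentiableAt.hasDerivAt).comp t h1
  rw [hd.deriv, abs_mul, abs_of_pos (one_div_pos.2 hε), mul_one_div]
  gcongr

/-- The function which vanishes within distance `ρ` of the sphere and is one beyond distance
`2ρ`. -/
noncomputable def sphereCutoff (a j : ℕ) (ρ : ℝ) (x : E (a + j)) : ℝ :=
  1 - cutoff ρ ρ (d (unitSphere a j) x)

variable {ρ : ℝ} {x : E (a + j)}

lemma continuous_d (K : Set (E (a + j))) : Continuous (d K) := Metric.continuous_infDist_pt K

lemma sphereCutoff_of_le (hρ : 0 < ρ) (hx : d (unitSphere a j) x ≤ ρ) :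
    sphereCutoff a j ρ x = 0 := by
  rw [sphereCutoff, cutoff_eq_one hρ hx, sub_self]

lemma sphereCutoff_of_ge (hρ : 0 < ρ) (hx : 2 * ρ ≤ d (unitSphere a j) x) :
    sphereCutoff a j ρ x = 1 := by
  rw [sphereCutoff, cutoff_eq_zero hρ (by linarith), sub_zero]

lemma sphereCutoff_eventuallyEq_zero (hρ : 0 < ρ) (hx : d (unitSphere a j) x < ρ) :
    sphereCutoff a j ρ =ᶠ[𝓝 x] fun _ => 0 := by
  filter_upwards [(continuous_d (unitSphere a j)).continuousAt.eventually_lt_const hx] with y hy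
  exact sphereCutoff_of_le hρ hy.le

lemma sphereCutoff_eventuallyEq_one (hρ : 0 < ρ) (hx : 2 * ρ < d (unitSphere a j) x) :
    sphereCutoff a j ρ =ᶠ[𝓝 x] fun _ => 1 := by
  filter_upwards [(continuous_d (unitSphere a j)).continuousAt.eventually_const_lt hx] with y hy
  exact sphereCutoff_of_ge hρ hy.le

lemma contDiff_sphereCutoff (ha : 1 ≤ a) (hρ : 0 < ρ) (hρ1 : ρ ≤ 1 / 4) :
    ContDiff ℝ ∞ (sphereCutoff a j ρ) := by
  refine contDiff_iff_contDiffAt.2 fun x => ?_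
  rcases lt_or_ge (d (unitSphere a j) x) ρ with h | h
  · exact contDiffAt_const.congr_of_eventuallyEq (sphereCutoff_eventuallyEq_zero hρ h)
  rcases lt_or_ge (2 * ρ) (d (unitSphere a j) x) with h2 | h2
  · exact contDiffAt_const.congr_of_eventuallyEq (sphereCutoff_eventuallyEq_one hρ h2)
  · exact contDiffAt_const.sub ((contDiff_cutoff ρ ρ).contDiffAt.comp x
      (contDiffAt_d ha (by linarith) (by linarith)))

lemma norm_gradient_sphereCutoff_le (ha : 1 ≤ a) (hρ : 0 < ρ) (hρ1 : ρ ≤ 1 / 4) {C : ℝ}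
    (hC0 : 0 ≤ C) (hC : ∀ δ ε t : ℝ, 0 < ε → |deriv (cutoff δ ε) t| ≤ C / ε) (x : E (a + j)) :
    ‖gradient (sphereCutoff a j ρ) x‖ ≤
      {y | d (unitSphere a j) y ≤ 2 * ρ}.indicator (fun _ => C / ρ) x := by
  rw [norm_gradient_eq_norm_fderiv]
  by_cases h2 : d (unitSphere a j) x ≤ 2 * ρ
  · rw [indicator_of_mem (show x ∈ {y | d (unitSphere a j) y ≤ 2 * ρ} from h2)]
    rcases lt_or_ge (d (unitSphere a j) x) ρ with h | h
    · rw [(sphereCutoff_eventuallyEq_zero hρ h).fderiv_eq]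
      simp
      positivity
    · have hd : HasFDerivAt (d (unitSphere a j)) _ x :=
        ((contDiffAt_d ha (by linarith) (by linarith)).differentiableAt (by simp)).hasFDerivAt
      have hc : HasDerivAt (cutoff ρ ρ) _ (d (unitSphere a j) x) :=
        ((contDiff_cutoff ρ ρ).differentiable (by simp)).differentiableAt.hasDerivAt
      have h3 : HasFDerivAt (sphereCutoff a j ρ) _ x := (hc.comp_hasFDerivAt x hd).const_sub 1
      rw [h3.fderiv, norm_neg, norm_smul, Real.norm_eq_abs]
      have h4 : ‖fderiv ℝ (d (unitSphere a j)) x‖ ≤ 1 := by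
        simpa using norm_fderiv_le_of_lipschitz ℝ (f := d (unitSphere a j)) (x₀ := x)
          (Metric.lipschitz_infDist_pt _)
      have := mul_le_mul (hC ρ ρ (d (unitSphere a j) x) hρ) h4 (norm_nonneg _) (by positivity)
      simpa using this
  · rw [indicator_of_notMem (show x ∉ {y | d (unitSphere a j) y ≤ 2 * ρ} from h2),
      (sphereCutoff_eventuallyEq_one hρ (not_le.1 h2)).fderiv_eq]
    simp

lemma norm_lt_of_d_unitSphere_lt (ha : 1 ≤ a) {r : ℝ} (hx : d (unitSphere a j) x < r) :
    ‖x‖ < 1 + r := by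
  obtain ⟨y, hy, hxy⟩ := (Metric.infDist_lt_iff (unitSphere_nonempty ha)).1 hx
  have h1 := norm_of_mem_unitSphere hy
  rw [dist_eq_norm] at hxy
  have := norm_le_norm_add_norm_sub y x
  rw [norm_sub_rev] at this
  linarith

lemma exists_testFunction_eq_sphereCutoff (ha : 1 ≤ a) (hρ : 0 < ρ) (hρ1 : ρ ≤ 1 / 4) :
    ∃ u : E (a + j) → ℝ, IsTestFunction (Metric.ball 0 3 \ unitSphere a j) u ∧
      ∀ x, ‖x‖ < 2 → u =ᶠ[𝓝 x] sphereCutoff a j ρ := by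
  let φ : ContDiffBump (0 : E (a + j)) := ⟨2, 5 / 2, by norm_num, by norm_num⟩
  have hts : tsupport (fun x => sphereCutoff a j ρ x * φ x) ⊆ tsupport φ :=
    tsupport_mul_subset_right
  refine ⟨fun x => sphereCutoff a j ρ x * φ x,
    ⟨(contDiff_sphereCutoff ha hρ hρ1).mul φ.contDiff, φ.hasCompactSupport.mul_left, ?_⟩, ?_⟩
  · intro x hx
    refine ⟨?_, fun hxK => ?_⟩
    · have := hts hx
      rw [φ.tsupport_eq, mem_closedBall_zero_iff] at this
      rw [mem_ball_zero_iff]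
      exact this.trans_lt (by norm_num [φ])
    · have h0 : d (unitSphere a j) x = 0 := Metric.infDist_zero_of_mem hxK
      have hev := sphereCutoff_eventuallyEq_zero hρ (h0.trans_lt hρ)
      refine notMem_tsupport_iff_eventuallyEq.2 ?_ hx
      filter_upwards [hev] with y hy
      simp [hy]
  · intro x hx
    have h2 : x ∈ Metric.ball (0 : E (a + j)) φ.rIn := mem_ball_zero_iff.2 hx
    filter_upwards [φ.eventuallyEq_one_of_mem_ball h2] with y hy
    simp [hy]

/-- A shell around the sphere contains a nonempty open set. -/
lemma measure_shell_pos (ha : 1 ≤ a) {δ : ℝ} (hδ : 0 < δ) :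
    0 < volume {x : E (a + j) | δ / 2 < d (unitSphere a j) x ∧ d (unitSphere a j) x < δ} := by
  refine IsOpen.measure_pos _ ((isOpen_lt continuous_const (continuous_d _)).inter
    (isOpen_lt (continuous_d _) continuous_const)) ?_
  set e : E a := EuclideanSpace.single ⟨0, ha⟩ (1 + 3 * δ / 4) with he
  set x := (split a j).symm (e, 0) with hx
  have hn : ‖projHead a j x‖ = 1 + 3 * δ / 4 := by
    rw [hx, projHead_symm, he, PiLp.norm_single, Real.norm_of_nonneg (by positivity)]
  have h1 : projHead a j x ≠ 0 := by
    rw [← norm_ne_zero_iff, hn]; positivity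
  have h2 := d_sq_eq ha h1
  rw [norm_sq_eq, hn, hx, projTail_symm, norm_zero, ← hx] at h2
  have h3 : d (unitSphere a j) x ^ 2 = (3 * δ / 4) ^ 2 := by rw [h2]; ring
  have h4 : d (unitSphere a j) x = 3 * δ / 4 :=
    (pow_left_inj₀ Metric.infDist_nonneg (by positivity) two_ne_zero).1 h3
  refine ⟨x, ?_, ?_⟩
  · rw [h4]; linarith
  · rw [h4]; linarith

/-- Around a sphere of codimension `1 + j > p` there is no Hardy inequality in the tubes: such a
sphere has zero `p`-capacity, and the functional is negative at a function which is equal to one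
away from the sphere. -/
lemma exists_hardyFunctional_neg (ha : 1 ≤ a) {p : ℝ} (hp : 0 < p) (hpk : p < ((1 + j : ℕ) : ℝ))
    {δ : ℝ} (hδ : 0 < δ) (hδ1 : δ ≤ 1 / 2) :
    ∃ u : E (a + j) → ℝ, IsTestFunction (Metric.ball 0 3 \ unitSphere a j) u ∧
      hardyFunctional (1 + j) p (unitSphere a j)
        (tube (Metric.ball 0 3) (unitSphere a j) δ) u < 0 := by
  set K := unitSphere a j with hK
  set T := tube (Metric.ball 0 3) K δ with hT
  have hTm : MeasurableSet T := measurableSet_tube Metric.isOpen_ball δ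
  obtain ⟨C, hC0, hC⟩ := exists_abs_deriv_cutoff_le
  obtain ⟨V, hV0, hV⟩ := exists_volume_tube_le (j := j) ha
  set A : Set (E (a + j)) := {x | δ / 2 < d K x ∧ d K x < δ} with hA
  have hAm : MeasurableSet A := ((isOpen_lt continuous_const (continuous_d _)).inter
    (isOpen_lt (continuous_d _) continuous_const)).measurableSet
  have hA2 : ∀ x ∈ A, ‖x‖ < 2 := fun x hx => by
    have := norm_lt_of_d_unitSphere_lt ha hx.2
    linarith
  have hAfin : volume A ≠ ⊤ := ((measure_mono fun x hx => mem_ball_zero_iff.2 (hA2 x hx)).trans_lt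
    (measure_ball_lt_top (x := (0 : E (a + j))) (r := 2))).ne
  have hApos : 0 < volume.real A := ENNReal.toReal_pos (measure_shell_pos ha hδ).ne' hAfin
  have hAT : A ⊆ T := fun x hx => ⟨mem_ball_zero_iff.2 ((hA2 x hx).trans (by norm_num)), hx.2.le⟩
  have hs : 0 < ((1 + j : ℕ) : ℝ) - p := sub_pos.2 hpk
  set H := |(p - ((1 + j : ℕ) : ℝ)) / p| ^ p with hH
  have hHpos : 0 < H := by
    have : (p - ((1 + j : ℕ) : ℝ)) / p ≠ 0 := div_ne_zero (by linarith) hp.ne'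
    positivity
  -- the energy is `O(ρ ^ (1 + j - p))`
  obtain ⟨ρ, hρ, hρδ, hρs⟩ : ∃ ρ : ℝ, 0 < ρ ∧ ρ ≤ δ / 4 ∧
      C ^ p * V * 2 ^ (1 + j) * ρ ^ (((1 + j : ℕ) : ℝ) - p) <
        H * (volume.real A * (1 / δ ^ p)) := by
    have h1 : Tendsto (fun ρ : ℝ => C ^ p * V * 2 ^ (1 + j) * ρ ^ (((1 + j : ℕ) : ℝ) - p))
        (𝓝[>] 0) (𝓝 0) := by
      have := ((Real.continuousAt_rpow_const 0 _ (Or.inr hs.le)).tendsto.const_mul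
        (C ^ p * V * 2 ^ (1 + j))).mono_left (nhdsWithin_le_nhds (s := Ioi 0))
      rwa [Real.zero_rpow hs.ne', mul_zero] at this
    have h2 : 0 < H * (volume.real A * (1 / δ ^ p)) := by positivity
    obtain ⟨ρ, h3, h4, h5⟩ := ((h1.eventually_lt_const h2).and
      (Ioc_mem_nhdsGT (show 0 < δ / 4 by positivity))).exists
    exact ⟨ρ, h4, h5, h3⟩
  obtain ⟨u, hu, huc⟩ := exists_testFunction_eq_sphereCutoff (j := j) ha hρ (by linarith)
  refine ⟨u, hu, ?_⟩
  have hgrad : ∫ x in T, ‖gradient u x‖ ^ p ≤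
      C ^ p * V * 2 ^ (1 + j) * ρ ^ (((1 + j : ℕ) : ℝ) - p) := by
    set S : Set (E (a + j)) := {x | d K x ≤ 2 * ρ} with hS
    have hSm : MeasurableSet S := (isClosed_le (continuous_d _) continuous_const).measurableSet
    have hvol : volume S ≤ ENNReal.ofReal (V * (2 * ρ) ^ (1 + j)) :=
      hV (2 * ρ) (by positivity) (by linarith)
    have hSfin : volume S ≠ ⊤ := (hvol.trans_lt ENNReal.ofReal_lt_top).ne
    have hpt : ∀ x ∈ T, ‖gradient u x‖ ^ p ≤ S.indicator (fun _ => (C / ρ) ^ p) x := by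
      intro x hx
      have hx2 : ‖x‖ < 2 := by
        have := norm_lt_of_d_unitSphere_lt ha (hx.2.trans_lt (by linarith : δ < 1))
        linarith
      have h1 := norm_gradient_sphereCutoff_le ha hρ (by linarith) hC0 hC x
      rw [norm_gradient_eq_norm_fderiv, ← (huc x hx2).fderiv_eq,
        ← norm_gradient_eq_norm_fderiv] at h1
      refine (Real.rpow_le_rpow (norm_nonneg _) h1 hp.le).trans_eq ?_
      by_cases hxS : x ∈ S
      · rw [indicator_of_mem hxS, indicator_of_mem hxS]
      · rw [indicator_of_notMem hxS, indicator_of_notMem hxS, Real.zero_rpow hp.ne']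
    calc ∫ x in T, ‖gradient u x‖ ^ p
        ≤ ∫ x in T, S.indicator (fun _ => (C / ρ) ^ p) x := by
          refine integral_mono_of_nonneg (Eventually.of_forall fun x => by positivity) ?_ ?_
          · exact ((integrable_indicator_iff hSm).2
              (integrableOn_const hSfin)).integrableOn
          · filter_upwards [ae_restrict_mem hTm] with x hx
            exact hpt x hx
      _ = (volume.restrict T).real S * (C / ρ) ^ p := by
          rw [integral_indicator_const _ hSm, smul_eq_mul]
      _ ≤ (V * (2 * ρ) ^ (1 + j)) * (C / ρ) ^ p := by
          gcongr
          refine ENNReal.toReal_le_of_le_ofReal (by positivity) ?_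
          exact (Measure.restrict_apply_le _ _).trans hvol
      _ = C ^ p * V * 2 ^ (1 + j) * ρ ^ (((1 + j : ℕ) : ℝ) - p) := by
          rw [Real.rpow_sub hρ, Real.rpow_natCast, Real.div_rpow hC0 hρ.le, mul_pow]
          ring
  have hpot : volume.real A * (1 / δ ^ p) ≤ ∫ x in T, |u x| ^ p / d K x ^ p := by
    have hint : Integrable fun x => |u x| ^ p / d K x ^ p := by
      refine integrable_of_continuousOn_of_zero hu.2.1.isCompact ?_ ?_
      · intro x hx
        have hd0 : 0 < d K x := ((isCompact_unitSphere a j).isClosed.notMem_iff_infDist_pos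
          (unitSphere_nonempty ha)).1 (hu.2.2 hx).2
        refine ContinuousAt.continuousWithinAt ?_
        have h1 : ContinuousAt (fun x => |u x| ^ p) x :=
          hu.1.continuous.abs.continuousAt.rpow_const (Or.inr hp.le)
        exact h1.div ((continuous_d K).continuousAt.rpow_const (Or.inr hp.le)) (by positivity)
      · intro x hx
        rw [image_eq_zero_of_notMem_tsupport hx, abs_zero, Real.zero_rpow hp.ne', zero_div]
    have hnn : ∀ x, 0 ≤ |u x| ^ p / d K x ^ p := fun x =>
      div_nonneg (by positivity) (Real.rpow_nonneg Metric.infDist_nonneg _)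
    calc volume.real A * (1 / δ ^ p) = ∫ _ in A, 1 / δ ^ p := by
          rw [setIntegral_const, smul_eq_mul]
      _ ≤ ∫ x in A, |u x| ^ p / d K x ^ p := by
          refine setIntegral_mono_on (integrableOn_const hAfin) hint.integrableOn hAm fun x hx => ?_
          have hd0 : 0 < d K x := lt_trans (by positivity) hx.1
          have hux : u x = 1 := by
            rw [(huc x (hA2 x hx)).eq_of_nhds]
            exact sphereCutoff_of_ge hρ ((by linarith : 2 * ρ ≤ δ / 2).trans hx.1.le)
          rw [hux, abs_one, Real.one_rpow]
          have := hx.2.le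
          gcongr
      _ ≤ ∫ x in T, |u x| ^ p / d K x ^ p :=
          setIntegral_mono_set hint.integrableOn (Eventually.of_forall hnn) hAT.eventuallyLE
  rw [hardyFunctional, sub_neg]
  calc _ ≤ _ := hgrad
    _ < _ := hρs
    _ ≤ _ := by gcongr

/-- The Hardy inequality without lower order term fails when `p` is less than the codimension. -/
lemma exists_not_hardy {n k : ℕ} {p : ℝ} (hk : 1 ≤ k) (hkn : k < n) (hp : 2 ≤ p)
    (hpk : p < (k : ℝ)) : ∃ Ω K : Set (E n),
      IsDomainWithSurface n k Ω K ∧ ConditionR k Ω K ∧ IsCompact K ∧ K ⊆ Ω ∧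
      ∃ δ₁ : ℝ, 0 < δ₁ ∧ ∀ δ : ℝ, 0 < δ → δ ≤ δ₁ →
        ∃ u : E n → ℝ, IsTestFunction (Ω \ K) u ∧ hardyFunctional k p K (tube Ω K δ) u < 0 := by
  obtain ⟨j, rfl⟩ := Nat.exists_eq_add_of_le hk
  obtain ⟨a, rfl⟩ : ∃ a, n = a + j := ⟨n - j, by omega⟩
  have ha : 1 ≤ a := by omega
  have hj : 1 ≤ j := by
    have : (2 : ℝ) < ((1 + j : ℕ) : ℝ) := hp.trans_lt hpk
    have : 2 < 1 + j := by exact_mod_cast this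
    omega
  refine ⟨Metric.ball 0 3, unitSphere a j, isDomainWithSurface_unitSphere ha hj,
    conditionR_unitSphere ha _, isCompact_unitSphere a j, fun x hx => ?_, 1 / 2, by norm_num,
    fun δ hδ hδ1 => exists_hardyFunctional_neg ha (by linarith) hpk hδ hδ1⟩
  rw [mem_ball_zero_iff, norm_of_mem_unitSphere hx]
  norm_num

end CounterExample

end HardySobolev

theorem theorem5p1 (n k : ℕ) (p : ℝ) (hk : 1 ≤ k) (hkn : k < n) (hp : 2 ≤ p) (hpn : p < n) :
    -- the estimates, with `C` depending on `n, k, p, q` only and `δ₀` not on `q`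
    (∃ C : ℝ → ℝ, (∀ q : ℝ, p < q → q ≤ n * p / (n - p) → 0 < C q) ∧
      ∀ Ω K : Set (HardySobolev.E n), HardySobolev.IsDomainWithSurface n k Ω K →
        HardySobolev.ConditionR k Ω K →
        ∃ δ₀ : ℝ, 0 < δ₀ ∧ ∀ q : ℝ, p < q → q ≤ n * p / (n - p) →
          ∀ δ : ℝ, 0 < δ → δ ≤ δ₀ →
            -- (a)
            ((k : ℝ) < p → ∀ u : HardySobolev.E n → ℝ, HardySobolev.IsTestFunction (Ω \ K) u →
              HardySobolev.hardyFunctional k p K (HardySobolev.tube Ω K δ) u ≥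
                C q * HardySobolev.weightedNormPow p q K (HardySobolev.tube Ω K δ) u) ∧
            -- (b), the corrected estimate
            (p < (k : ℝ) → ∃ M : ℝ, 0 < M ∧
              ∀ u : HardySobolev.E n → ℝ, HardySobolev.IsTestFunction (Ω \ K) u →
                HardySobolev.hardyFunctional k p K (HardySobolev.tube Ω K δ) u +
                    M * ∫ x in HardySobolev.tube Ω K δ, |u x| ^ p ≥
                  C q * HardySobolev.weightedNormPow p q K (HardySobolev.tube Ω K δ) u) ∧
            -- (c)
            (p ≠ (k : ℝ) → ∀ u : HardySobolev.E n → ℝ,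
              HardySobolev.IsTestFunction (HardySobolev.tube Ω K δ \ K) u →
              HardySobolev.hardyFunctional k p K (HardySobolev.tube Ω K δ) u ≥
                C q * HardySobolev.weightedNormPow p q K (HardySobolev.tube Ω K δ) u)) ∧
    -- (b), failure of the plain Hardy inequality
    (p < (k : ℝ) → ∃ Ω K : Set (HardySobolev.E n),
      HardySobolev.IsDomainWithSurface n k Ω K ∧ HardySobolev.ConditionR k Ω K ∧
      IsCompact K ∧ K ⊆ Ω ∧
      ∃ δ₁ : ℝ, 0 < δ₁ ∧ ∀ δ : ℝ, 0 < δ → δ ≤ δ₁ →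
        ∃ u : HardySobolev.E n → ℝ, HardySobolev.IsTestFunction (Ω \ K) u ∧
          HardySobolev.hardyFunctional k p K (HardySobolev.tube Ω K δ) u < 0) :=
  ⟨HardySobolev.hardySobolev_tube n k p hk hkn hp hpn, HardySobolev.exists_not_hardy hk hkn hp⟩
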